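/- **Setting.** Let $T>0$, $\rho>0$, and let $f_0:[0,\infty)\times\mathbb R\to\mathbb R$ be jointly concave, nondecreasing in the second variable, Lipschitz with constant $C$ (that is, $|f_0(x,y)-f_0(x',y')|\le C(|x-x'|+|y-y'|)$), with $f_0(0,y)>0$ for $y>0$ and $f_0(x,0)\ge 0$ for $x\ge 0$. Let $U_1\in C([0,\infty))\cap C^2((0,\infty))$ be bounded with $U_1'>0$, $U_1''<0$, $U_1'(0^+)=+\infty$. For $n\ge 1$ let $U_2^n\in C((0,\infty);\mathbb R)$ be nondecreasing, concave, bounded above, with $\int_0^\infty e^{-\rho t}U_2^n(e^{-Ct})\,dt>-\infty$, and suppose that $U_2^n\le U_2^{n+1}$, $U_2^n\equiv 0$ on $[1/n,\infty)$ (so $U_2^n\uparrow 0$) and $\lim_{x\to0^+}x\,U_2^n(x)=-\infty$. Let $a_k\in W^{1,2}([-T,0])$, $k\in\mathbb N$, satisfy $a_k\ge 0$, $a_k(-T)=0$, $\int_{-\delta}^0a_k(\xi)\,d\xi>0$ for all $\delta\in(0,T]$, and $\int_{-T}^0 a_k\varphi\,d\xi\to\varphi(-T/2)$ for every $\varphi\in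 C([-T,0])$. Let $\eta=(\eta_0,\eta_1)\in H_{++}$, i.e. $\eta_0>0$, $\eta_1\in L^2([-T,0])$, $\eta_1\ge0$ a.e. For a control $c\in L^1_{loc}([0,\infty);[0,\infty))$ let $x_k$ and $y$ be the continuous solutions (of the integrated equations on $[0,\infty)$) of $$x_k'(t)=f_0\Big(x_k(t),\int_{-T}^0a_k(\xi)x_k(t+\xi)\,d\xi\Big)-c(t),\qquad y'(t)=f_0\big(y(t),y(t-\tfrac T2)\big)-c(t),$$ with value $\eta_0$ at $0$ and equal to $\eta_1$ on $[-T,0)$. The control is admissible for the first (second) equation if that equation has a solution on $[0,\infty)$ with $x_k>0$ ($y>0$) on $[0,\infty)$. Let $V_k^n(\eta)$ be the supremum of $\int_0^\infty e^{-\rho t}[U_1(c(t))+U_2^n(x_k(t))]\,dt$ over the controls admissible for the first equation, and let $V_0^n(\eta)$ and $V_0^0(\eta)$ be the suprema of $\int_0^\infty e^{-\rho t}[U_1(c(t))+U_2^n(y(t))]\,dt$ and of $\int_0^\infty e^{-\rho t}U_1(c(t))\,dt$ over the controls admissible for the second equation. A control is optimal if it is admissible and attains the supremum; it is $\varepsilon$-optimal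 if it is admissible and its payoff exceeds the supremum minus $\varepsilon$. An admissible control $c$ with trajectory $x$ is a feedback control for $V_k^n$ if, for every $t\ge 0$, the derivative $p(t)$ of $s\mapsto V_k^n\big(s,x(t+\cdot)|_{[-T,0)}\big)$ at $s=x(t)$ exists, is positive, and $c(t)$ maximizes $u\mapsto U_1(u)-p(t)u$ over $u\ge 0$. **Proposition.** (a) For all $n\ge1$ and $k\in\mathbb N$ the problem $V_k^n(\eta)$ has an optimal feedback control. (b) There are thresholds $\bar M(\varepsilon,n)$ and $\bar K(\varepsilon,n,M)$ and integers $n_\varepsilon\ge1$ ($\varepsilon>0$, $n\ge 1$, $M\in\mathbb R$) such that, for every choice of $M_{\varepsilon,n}\ge\bar M(\varepsilon,n)$ and $k_{\varepsilon,n}\ge\bar K(\varepsilon,n,M_{\varepsilon,n})$, $$\lim_{\varepsilon\downarrow0}V^{n_\varepsilon}_{k_{\varepsilon,n_\varepsilon}}(\eta)=V_0^0(\eta),$$ and, for every choice of optimal controls $c^*_{n,k}$ of the problems $V_k^n(\eta)$ (in particular for the optimal feedback controls), with $$c_{\varepsilon,n}(t):=c^*_{n,k_{\varepsilon,n}}(t)\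 \text{ for } 0\le t\le M_{\varepsilon,n},\qquad c_{\varepsilon,n}(t):=0\ \text{ for } t>M_{\varepsilon,n},$$ the following holds for every $\varepsilon>0$: $c_{\varepsilon,n}$ is admissible and $\varepsilon$-optimal for $V_0^n(\eta)$ for every $n\ge1$, and $c_{\varepsilon,n_\varepsilon}$ is admissible and $3\varepsilon$-optimal for $V_0^0(\eta)$. -/

import Mathlib

open Set Filter Topology MeasureTheory

noncomputable section

namespace DelayControl

/-- Integral over `(0, ∞)` of a real function whose positive part has finite integral,
with values in `[-∞, ∞]` (it is `-∞` when the negative part has infinite integral). -/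
def extIntegral (g : ℝ → ℝ) : EReal :=
  ((∫⁻ t in Ioi (0 : ℝ), ENNReal.ofReal (g t) : ENNReal) : EReal)
    - ((∫⁻ t in Ioi (0 : ℝ), ENNReal.ofReal (-g t) : ENNReal) : EReal)

/-- `a` is (the continuous representative of) an element of `W^{1,2}([-T,0]; ℝ)`. -/
def MemW12 (T : ℝ) (a : ℝ → ℝ) : Prop :=
  ∃ g : ℝ → ℝ, MemLp g 2 (volume.restrict (Icc (-T) 0)) ∧
    ∀ ξ ∈ Icc (-T) 0, a ξ = a (-T) + ∫ s in (-T)..ξ, g s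

/-- The assumptions on the production function `f₀ : [0,∞) × ℝ → ℝ` (the values of `f₀` at a
negative first argument are irrelevant); `C` is the Lipschitz constant. -/
structure ProductionHyp (f₀ : ℝ → ℝ → ℝ) (C : ℝ) : Prop where
  concave : ConcaveOn ℝ (Ici (0 : ℝ) ×ˢ (univ : Set ℝ)) (fun p : ℝ × ℝ => f₀ p.1 p.2)
  mono : ∀ x, 0 ≤ x → Monotone (f₀ x)
  lipschitz : ∀ x x' y y' : ℝ, 0 ≤ x → 0 ≤ x' →
    |f₀ x y - f₀ x' y'| ≤ C * (|x - x'| + |y - y'|)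
  pos : ∀ y, 0 < y → 0 < f₀ 0 y
  nonneg : ∀ x, 0 ≤ x → 0 ≤ f₀ x 0

/-- The assumptions on the utility from consumption `U₁ : [0,∞) → ℝ`. -/
structure ConsumptionUtility (U₁ : ℝ → ℝ) : Prop where
  continuousOn : ContinuousOn U₁ (Ici 0)
  contDiffOn : ContDiffOn ℝ 2 U₁ (Ioi 0)
  deriv_pos : ∀ x, 0 < x → 0 < deriv U₁ x
  deriv_zero : Tendsto (deriv U₁) (𝓝[>] 0) atTop
  deriv2_neg : ∀ x, 0 < x → deriv (deriv U₁) x < 0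
  bounded : ∃ B : ℝ, ∀ x, 0 ≤ x → |U₁ x| ≤ B

/-- The assumptions on a utility from the state `U₂ : (0,∞) → ℝ`. The last one says that
`∫₀^∞ e^{-ρt} U₂(e^{-Ct}) dt > -∞` (the integrand being bounded above by `const * e^{-ρt}`). -/
structure StateUtility (ρ C : ℝ) (U₂ : ℝ → ℝ) : Prop where
  continuousOn : ContinuousOn U₂ (Ioi 0)
  mono : MonotoneOn U₂ (Ioi 0)
  concave : ConcaveOn ℝ (Ioi 0) U₂
  bddAbove : ∃ B : ℝ, ∀ x, 0 < x → U₂ x ≤ B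
  integrable : IntegrableOn (fun t => Real.exp (-ρ * t) * U₂ (Real.exp (-C * t))) (Ioi 0)

/-- The assumptions on a delay kernel `a` on `[-T,0]`. -/
structure DelayKernel (T : ℝ) (a : ℝ → ℝ) : Prop where
  memW12 : MemW12 T a
  nonneg : ∀ ξ ∈ Icc (-T) 0, 0 ≤ a ξ
  left_zero : a (-T) = 0
  mass_near_zero : ∀ δ, 0 < δ → δ ≤ T → 0 < ∫ ξ in (-δ)..0, a ξ

/-- The distributed delay term `∫_{-T}^0 a(ξ) x(t+ξ) dξ`. -/
def distributedDelay (T : ℝ) (a : ℝ → ℝ) (x : ℝ → ℝ) (t : ℝ) : ℝ :=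
  ∫ ξ in (-T)..0, a ξ * x (t + ξ)

/-- The pointwise delay term `x(t - T/2)`. -/
def pointwiseDelay (T : ℝ) (x : ℝ → ℝ) (t : ℝ) : ℝ := x (t - T / 2)

/-- `x` solves `x' = f₀(x, D x) - c` on `[0,∞)` in integrated form, with `x(0) = η₀` and
`x = η₁` on `[-T,0)`; here `D x t` is the delay term. -/
structure IsSolution (T : ℝ) (f₀ : ℝ → ℝ → ℝ) (D : (ℝ → ℝ) → ℝ → ℝ) (η₀ : ℝ) (η₁ : ℝ → ℝ)
    (c x : ℝ → ℝ) : Prop where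
  history : ∀ s ∈ Ico (-T) 0, x s = η₁ s
  continuousOn : ContinuousOn x (Ici 0)
  integral_eq : ∀ t, 0 ≤ t →
    x t = η₀ + (∫ s in (0 : ℝ)..t, f₀ (x s) (D x s)) - ∫ s in (0 : ℝ)..t, c s

/-- `c ∈ L¹_loc([0,∞); ℝ⁺)` is an admissible control with state trajectory `x > 0`. Only
positive trajectories matter, and these are determined by `c` on `[0,∞)`. -/
structure IsAdmissiblePair (T : ℝ) (f₀ : ℝ → ℝ → ℝ) (D : (ℝ → ℝ) → ℝ → ℝ) (η₀ : ℝ)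
    (η₁ : ℝ → ℝ) (c x : ℝ → ℝ) : Prop where
  locallyIntegrable : LocallyIntegrableOn c (Ici 0)
  control_nonneg : ∀ t, 0 ≤ t → 0 ≤ c t
  solution : IsSolution T f₀ D η₀ η₁ c x
  state_pos : ∀ t, 0 ≤ t → 0 < x t

/-- The objective functional `∫₀^∞ e^{-ρt} [U₁(c(t)) + U₂(x(t))] dt ∈ [-∞,∞)`. -/
def payoff (ρ : ℝ) (U₁ U₂ : ℝ → ℝ) (c x : ℝ → ℝ) : EReal :=
  extIntegral (fun t => Real.exp (-ρ * t) * (U₁ (c t) + U₂ (x t)))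

/-- The value function (with `sup ∅ = -∞`). -/
def value (T ρ : ℝ) (f₀ : ℝ → ℝ → ℝ) (U₁ U₂ : ℝ → ℝ) (D : (ℝ → ℝ) → ℝ → ℝ)
    (η₀ : ℝ) (η₁ : ℝ → ℝ) : EReal :=
  sSup {J | ∃ c x, IsAdmissiblePair T f₀ D η₀ η₁ c x ∧ J = payoff ρ U₁ U₂ c x}

/-- `c` is admissible and its payoff equals the value. -/
def IsOptimal (T ρ : ℝ) (f₀ : ℝ → ℝ → ℝ) (U₁ U₂ : ℝ → ℝ) (D : (ℝ → ℝ) → ℝ → ℝ)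
    (η₀ : ℝ) (η₁ : ℝ → ℝ) (c : ℝ → ℝ) : Prop :=
  ∃ x, IsAdmissiblePair T f₀ D η₀ η₁ c x ∧
    payoff ρ U₁ U₂ c x = value T ρ f₀ U₁ U₂ D η₀ η₁

/-- `c` is admissible and its payoff is larger than the value minus `ε`. -/
def IsEpsOptimal (T ρ : ℝ) (f₀ : ℝ → ℝ → ℝ) (U₁ U₂ : ℝ → ℝ) (D : (ℝ → ℝ) → ℝ → ℝ)
    (η₀ : ℝ) (η₁ : ℝ → ℝ) (ε : ℝ) (c : ℝ → ℝ) : Prop :=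
  ∃ x, IsAdmissiblePair T f₀ D η₀ η₁ c x ∧
    value T ρ f₀ U₁ U₂ D η₀ η₁ - (ε : EReal) < payoff ρ U₁ U₂ c x

/-- `c` is an admissible feedback control: along its trajectory `x`, for every `t ≥ 0`, the
value function `V` has a partial derivative `p > 0` in its first variable at the current state
`(x(t), x(t+·)|_{[-T,0)})`, and `c(t)` maximises `u ↦ U₁(u) - p u` over `u ≥ 0`. Thus `x`
solves the closed loop equation of the feedback map `argmax_{u ≥ 0} (U₁(u) - u V_{η₀})`. -/
def IsFeedback (T ρ : ℝ) (f₀ : ℝ → ℝ → ℝ) (U₁ U₂ : ℝ → ℝ) (D : (ℝ → ℝ) → ℝ → ℝ)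
    (η₀ : ℝ) (η₁ : ℝ → ℝ) (c : ℝ → ℝ) : Prop :=
  ∃ x, IsAdmissiblePair T f₀ D η₀ η₁ c x ∧
    ∀ t, 0 ≤ t → ∃ p : ℝ, 0 < p ∧
      HasDerivAt (fun s => (value T ρ f₀ U₁ U₂ D s (fun ξ => x (t + ξ))).toReal) p (x t) ∧
      IsMaxOn (fun u => U₁ u - p * u) (Ici 0) (c t)

/-- The control equal to `c` on `[0,M]` and to `0` after `M`. -/
def truncate (M : ℝ) (c : ℝ → ℝ) (t : ℝ) : ℝ := if t ≤ M then c t else 0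

end DelayControl

end

open DelayControl

open Set Filter Topology MeasureTheory
namespace DelayControl

/-! Both equations have the form x' = f(x, Dx) - c, where D is a monotone linear delay operator
(`IsDelayOp`). Once f is extended to negative states, every control has a global trajectory, and
trajectories are ordered by initial capital minus cumulative consumption (`comparison`). Everything
that does not depend on the nature of the delay is proved for such a D.

Existence of optimal controls. Since f and the utilities are concave, mixing two controls does at
least as well as mixing their payoffs (`exists_combination`), so the 1/n-optimal controls form
decreasing midpoint convex sets. Minimising a strictly convex functional over them gives a sequence
that converges almost everywhere (`exists_ae_convergent_selection`). Consumption may be lost in the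
limit, but this only raises the state; dominated convergence for U₁ and Fatou for U₂ ≤ 0 show that
the limit is optimal. The limiting state is positive because x U₂(x) → -∞: a trajectory that comes
down to the level m stays below 2m for a time of order m, at a cost of order -m U₂(2m), which a
payoff bounded below cannot afford.

Feedback. The value function is concave in the initial capital, so it has one-sided derivatives, the
right one not exceeding the left one. Extra capital can be consumed at once, which bounds the right
derivative below by the marginal utility of present consumption. A deficit can be made up by
consuming less at once; the saving exceeds the deficit only by a factor 1 + O(δ), because a bounded
kernel transmits a disturbance lasting a time δ with weight O(δ) (`HasFadingMemory`). So the left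
derivative is bounded above by the same marginal utility (`IsOptimalPair.exists_hasDerivAt`). Tails
of optimal pairs are optimal, hence U₁'(c(t)) is the derivative of the value for almost every t, and
changing c on a null set gives the relation for every t.

From distributed to pointwise delay. A trajectory is its history followed by a difference of two
bounded monotone functions, so its translations are continuous in L¹ uniformly in the control. Weak
convergence of the kernels therefore gives uniform L¹ convergence of the delay terms
(`DelayConverges`), and a Gronwall argument gives closeness of the trajectories. To compare payoffs
one needs a lower bound for the states that is uniform in k. Bounds on the drift are useless here,
as they involve the supremum of the kernel. Instead the derivative formula bounds optimal controls
on [0,M] independently of k (`IsOptimalPair.control_le`); as the drift is nonnegative, a small state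
must have been small for some time before (`exists_backward_floor`). Stopping consumption at time M
costs little and extends the lower bound to all times. For the opposite inequality between the
values, a fixed near-optimal control of the limit problem is transferred to large k.

Removing the state utility. A truncated near-optimal control of the problem without state utility
keeps the state above some m > 0, where U₂ⁿ vanishes for large n (`exists_realValue_gt`). -/

/-- Production functions extended to all of `ℝ × ℝ`. -/
structure RegularProduction (f : ℝ → ℝ → ℝ) (C : ℝ) : Prop where
  concave : ConcaveOn ℝ (Ici (0 : ℝ) ×ˢ (univ : Set ℝ)) (fun p : ℝ × ℝ => f p.1 p.2)
  mono : ∀ x x' y y', x ≤ x' → y ≤ y' → f x y ≤ f x' y'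
  lipschitz : ∀ x x' y y' : ℝ, |f x y - f x' y'| ≤ C * (|x - x'| + |y - y'|)
  nonneg : ∀ x y, 0 ≤ y → 0 ≤ f x y

/-- Functions with integrable history on `[-T,0)` that are continuous on `[0,∞)`. -/
structure IsPath (T : ℝ) (x : ℝ → ℝ) : Prop where
  history : IntegrableOn x (Ico (-T) 0)
  continuousOn : ContinuousOn x (Ici 0)

/-- Integrable nonnegative histories on `[-T,0)`. -/
structure IsHistory (T : ℝ) (η : ℝ → ℝ) : Prop where
  integrable : IntegrableOn η (Ico (-T) 0)
  nonneg : ∀ᵐ s ∂(volume.restrict (Ico (-T) 0)), 0 ≤ η s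

/-- Monotone linear delay operators of norm at most `A`. -/
structure IsDelayOp (T A : ℝ) (D : (ℝ → ℝ) → ℝ → ℝ) : Prop where
  const_nonneg : 0 ≤ A
  le_add : ∀ x x', IsPath T x → IsPath T x' → (∀ s ∈ Ico (-T) 0, x s = x' s) →
    ∀ t, 0 ≤ t → ∀ d, 0 ≤ d → (∀ s ∈ Icc 0 t, x s ≤ x' s + d) → D x t ≤ D x' t + A * d
  combo : ∀ x x', IsPath T x → IsPath T x' → ∀ l m t : ℝ, 0 ≤ t →
    D (fun s => l * x s + m * x' s) t = l * D x t + m * D x' t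
  nonneg : ∀ x, IsPath T x → IsHistory T x →
    ∀ᵐ t ∂(volume.restrict (Ioi 0)), (∀ s ∈ Icc 0 t, 0 ≤ x s) → 0 ≤ D x t
  integrable : ∀ x, IsPath T x → ∀ S, 0 ≤ S → IntervalIntegrable (D x) volume 0 S
  congr : ∀ x x' t, (∀ s ∈ Icc (t - T) t, x s = x' s) → D x t = D x' t
  shift : ∀ x r t, D (fun s => x (r + s)) t = D x (r + t)

/-! ### Production functions: monotonicity in the state and extension. -/

lemma RegularProduction.const_nonneg {f : ℝ → ℝ → ℝ} {C : ℝ} (hf : RegularProduction f C) :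
    0 ≤ C := by
  have := hf.lipschitz 1 0 0 0
  have h2 := abs_nonneg (f 1 0 - f 0 0)
  norm_num at this
  linarith

/-- A concave function on a half-line that is bounded below cannot decrease. The lower bound -C|y|
comes from f₀(X,0) ≥ 0 and the Lipschitz condition in the second variable. -/
lemma ProductionHyp.mono_left {f₀ : ℝ → ℝ → ℝ} {C : ℝ} (hf : ProductionHyp f₀ C)
    {x x' : ℝ} (hx : 0 ≤ x) (hxx : x ≤ x') (y : ℝ) : f₀ x y ≤ f₀ x' y := by
  by_contra! hlt
  have hne : x < x' := lt_of_le_of_ne hxx (by rintro rfl; exact lt_irrefl _ hlt)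
  have hC : ∀ X, 0 ≤ X → -(C * |y|) ≤ f₀ X y := by
    intro X hX
    have h1 := hf.lipschitz X X y 0 hX hX
    have h2 := hf.nonneg X hX
    have h3 := neg_abs_le (f₀ X y - f₀ X 0)
    simp only [sub_self, abs_zero, sub_zero, zero_add] at h1
    linarith
  set d := f₀ x y - f₀ x' y with hd
  have hdpos : 0 < d := by linarith
  obtain ⟨n, hn⟩ := exists_nat_gt ((f₀ x y + C * |y|) / d)
  have hn' : f₀ x y + C * |y| < (n + 1) * d := by
    rw [div_lt_iff₀ hdpos] at hn
    nlinarith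
  -- A loss d over one step of length x' - x would be at least N * d over N steps. The point x' is
  -- the convex combination of x and the N-th step with weight 1/N on the latter.
  set N : ℝ := (n : ℝ) + 1 with hN
  have hNpos : 0 < N := by positivity
  have hX : 0 ≤ x + N * (x' - x) := by
    have : 0 ≤ N * (x' - x) := by apply mul_nonneg hNpos.le; linarith
    linarith
  have hNge : 1 ≤ N := by rw [hN]; have : (0 : ℝ) ≤ n := Nat.cast_nonneg n
                          linarith
  have hinv : N⁻¹ ≤ 1 := inv_le_one_of_one_le₀ hNge
  have hm1 : ((x, y) : ℝ × ℝ) ∈ Ici (0 : ℝ) ×ˢ (univ : Set ℝ) := ⟨hx, mem_univ _⟩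
  have hm2 : ((x + N * (x' - x), y) : ℝ × ℝ) ∈ Ici (0 : ℝ) ×ˢ (univ : Set ℝ) := ⟨hX, mem_univ _⟩
  have hc := hf.concave.2 hm1 hm2 (show 0 ≤ 1 - N⁻¹ by linarith)
    (show 0 ≤ N⁻¹ by positivity) (by ring)
  have e1 : ((1 - N⁻¹) • ((x, y) : ℝ × ℝ) + N⁻¹ • (x + N * (x' - x), y)) = (x', y) := by
    ext
    · simp; field_simp; ring
    · simp; ring
  rw [e1] at hc
  simp only [smul_eq_mul] at hc
  have h5 := hC _ hX
  have h6 : N * ((1 - N⁻¹) * f₀ x y + N⁻¹ * f₀ (x + N * (x' - x)) y) ≤ N * f₀ x' y :=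
    mul_le_mul_of_nonneg_left hc hNpos.le
  have h7 : N * ((1 - N⁻¹) * f₀ x y + N⁻¹ * f₀ (x + N * (x' - x)) y)
      = (N - 1) * f₀ x y + f₀ (x + N * (x' - x)) y := by field_simp
  rw [h7] at h6
  have : N * d = N * f₀ x y - N * f₀ x' y := by rw [hd]; ring
  linarith

lemma ProductionHyp.regular {f₀ : ℝ → ℝ → ℝ} {C : ℝ} (hf : ProductionHyp f₀ C) :
    RegularProduction (fun x y => f₀ (max x 0) y) C where
  concave := by
    refine hf.concave.congr ?_
    rintro ⟨x, y⟩ ⟨hx, -⟩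
    simp only [mem_Ici] at hx
    simp [max_eq_left hx]
  mono x x' y y' hx hy :=
    (hf.mono _ (le_max_right _ _) hy).trans
      (hf.mono_left (le_max_right _ _) (max_le_max_right 0 hx) y')
  lipschitz x x' y y' := by
    have h0 : 0 ≤ C := by
      have := hf.lipschitz 1 0 0 0 zero_le_one le_rfl
      have h2 := abs_nonneg (f₀ 1 0 - f₀ 0 0)
      norm_num at this
      linarith
    refine (hf.lipschitz _ _ _ _ (le_max_right _ _) (le_max_right _ _)).trans ?_
    have := abs_max_sub_max_le_abs x x' 0
    gcongr ?_ * (?_ + ?_)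
    exact le_rfl
  nonneg x y hy := (hf.nonneg _ (le_max_right _ _)).trans (hf.mono _ (le_max_right _ _) hy)

/-- The set where g ≤ u is compact, and at its least element the hypothesis applies and gives a
contradiction. At t = α the premise is vacuous, so the hypothesis also contains the initial
inequality. -/
lemma lt_of_bootstrap {u g : ℝ → ℝ} {α S : ℝ} (hu : ContinuousOn u (Icc α S))
    (hg : ContinuousOn g (Icc α S))
    (h : ∀ t ∈ Icc α S, (∀ s ∈ Ico α t, u s ≤ g s) → u t < g t) :
    ∀ t ∈ Icc α S, u t < g t := by
  by_contra! hcon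
  obtain ⟨t, ht, hgt⟩ := hcon
  have hcl : IsClosed (Icc α S ∩ {t | g t ≤ u t}) :=
    isClosed_Icc.isClosed_le hg hu
  have hcomp : IsCompact (Icc α S ∩ {t | g t ≤ u t}) :=
    isCompact_Icc.of_isClosed_subset hcl inter_subset_left
  obtain ⟨m, hm, hmin⟩ := hcomp.exists_isLeast ⟨t, ht, hgt⟩
  refine absurd (h m hm.1 fun s hs => ?_) (not_lt.2 hm.2)
  by_contra! hlt
  exact absurd (hmin ⟨⟨hs.1, hs.2.le.trans hm.1.2⟩, hlt.le⟩) (not_le.2 hs.2)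

/-! ### Integrability of the drift and the comparison principle. -/

section Drift

variable {T A C : ℝ} {f : ℝ → ℝ → ℝ} {D : (ℝ → ℝ) → ℝ → ℝ}

lemma RegularProduction.continuous (hf : RegularProduction f C) :
    Continuous (fun p : ℝ × ℝ => f p.1 p.2) := by
  have hC := hf.const_nonneg
  refine (LipschitzWith.of_dist_le_mul (K := Real.toNNReal (2 * C)) ?_).continuous
  rintro ⟨x, y⟩ ⟨x', y'⟩
  rw [Real.dist_eq, Real.coe_toNNReal _ (by positivity)]
  refine (hf.lipschitz _ _ _ _).trans ?_
  have h1 : |x - x'| ≤ dist (x, y) (x', y') := by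
    rw [Prod.dist_eq, ← Real.dist_eq]; exact le_max_left _ _
  have h2 : |y - y'| ≤ dist (x, y) (x', y') := by
    rw [Prod.dist_eq, ← Real.dist_eq]; exact le_max_right _ _
  simp only
  nlinarith

lemma IsPath.drift_integrable (hf : RegularProduction f C) (hD : IsDelayOp T A D) {x : ℝ → ℝ}
    (hx : IsPath T x) {S : ℝ} (hS : 0 ≤ S) :
    IntervalIntegrable (fun s => f (x s) (D x s)) volume 0 S := by
  have hDx := hD.integrable x hx S hS
  have hxc : ContinuousOn x (Icc 0 S) := hx.continuousOn.mono Icc_subset_Ici_self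
  have hxi : IntervalIntegrable x volume 0 S := by
    apply ContinuousOn.intervalIntegrable
    rwa [uIcc_of_le hS]
  have hC := hf.const_nonneg
  have hb : IntervalIntegrable (fun s => |f 0 0| + C * (|x s| + |D x s|)) volume 0 S :=
    (intervalIntegrable_const).add ((hxi.abs.add hDx.abs).const_mul C)
  rw [intervalIntegrable_iff] at *
  refine hb.mono' ?_ ?_
  · exact hf.continuous.comp_aestronglyMeasurable
      (hxi.aestronglyMeasurable.prodMk hDx.aestronglyMeasurable)
  · refine ae_of_all _ fun s => ?_
    have h1 := hf.lipschitz (x s) 0 (D x s) 0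
    simp only [sub_zero] at h1
    rw [Real.norm_eq_abs]
    have := abs_sub_abs_le_abs_sub (f (x s) (D x s)) (f 0 0)
    linarith

lemma IsPath.drift_integrable' (hf : RegularProduction f C) (hD : IsDelayOp T A D) {x : ℝ → ℝ}
    (hx : IsPath T x) {r S : ℝ} (hr : 0 ≤ r) (hS : 0 ≤ S) :
    IntervalIntegrable (fun s => f (x s) (D x s)) volume r S :=
  (hx.drift_integrable hf hD hr).symm.trans (hx.drift_integrable hf hD hS)

/-- Monotonicity in both arguments allows replacing x by x' + d, after which the Lipschitz condition
applies; hence one-sided closeness of the paths is enough. -/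
lemma drift_sub_le (hf : RegularProduction f C) (hD : IsDelayOp T A D) {x x' : ℝ → ℝ}
    (hx : IsPath T x) (hx' : IsPath T x') (hh : ∀ s ∈ Ico (-T) 0, x s = x' s) {t d : ℝ}
    (ht : 0 ≤ t) (hd : 0 ≤ d) (h : ∀ s ∈ Icc 0 t, x s ≤ x' s + d) :
    f (x t) (D x t) - f (x' t) (D x' t) ≤ C * (1 + A) * d := by
  have hA := hD.const_nonneg
  have h1 := hD.le_add x x' hx hx' hh t ht d hd h
  have h2 := hf.mono (x t) (x' t + d) (D x t) (D x' t + A * d) (h t ⟨ht, le_rfl⟩) h1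
  have h3 := hf.lipschitz (x' t + d) (x' t) (D x' t + A * d) (D x' t)
  have h4 := le_abs_self (f (x' t + d) (D x' t + A * d) - f (x' t) (D x' t))
  rw [add_sub_cancel_left, add_sub_cancel_left, abs_of_nonneg hd,
    abs_of_nonneg (mul_nonneg hA hd)] at h3
  linarith

lemma integral_exp_mul_const (L e α t : ℝ) :
    ∫ s in α..t, L * (e * Real.exp (L * s)) = e * (Real.exp (L * t) - Real.exp (L * α)) := by
  have : ∀ s ∈ uIcc α t, HasDerivAt (fun s => e * Real.exp (L * s))
      (L * (e * Real.exp (L * s))) s := by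
    intro s _
    have h1 : HasDerivAt (fun s => L * s) L s := by simpa using (hasDerivAt_id s).const_mul L
    exact (h1.exp.const_mul e).congr_deriv (by ring)
  rw [intervalIntegral.integral_eq_sub_of_hasDerivAt this
    (by apply Continuous.intervalIntegrable; fun_prop)]
  ring

/-- Comparison for the delay equation, with an additive defect `e`. -/
theorem comparison (hf : RegularProduction f C) (hD : IsDelayOp T A D) {x x' : ℝ → ℝ}
    (hx : IsPath T x) (hx' : IsPath T x') (hh : ∀ s ∈ Ico (-T) 0, x s = x' s) {S e : ℝ}
    (he : 0 ≤ e)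
    (h : ∀ t ∈ Icc 0 S, x t - x' t ≤
      e + ∫ s in (0 : ℝ)..t, (f (x s) (D x s) - f (x' s) (D x' s))) :
    ∀ t ∈ Icc 0 S, x t ≤ x' t + e * Real.exp (C * (1 + A) * t) := by
  set L := C * (1 + A) with hL
  have hL0 : 0 ≤ L := mul_nonneg hf.const_nonneg (by linarith [hD.const_nonneg])
  -- The barrier e' exp(L t) satisfies the integral equation of the worst case exactly; starting it
  -- strictly above e yields the strict inequality that the bootstrap needs.
  have key : ∀ e', e < e' → ∀ t ∈ Icc 0 S, x t - x' t < e' * Real.exp (L * t) := by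
    intro e' he'
    have he0 : 0 < e' := he.trans_lt he'
    refine lt_of_bootstrap
      ((hx.continuousOn.mono Icc_subset_Ici_self).sub (hx'.continuousOn.mono Icc_subset_Ici_self))
      (by fun_prop) fun t ht hb => ?_
    have hint : ∫ s in (0 : ℝ)..t, (f (x s) (D x s) - f (x' s) (D x' s)) ≤
        ∫ s in (0 : ℝ)..t, L * (e' * Real.exp (L * s)) := by
      refine intervalIntegral.integral_mono_on_of_le_Ioo ht.1
        ((hx.drift_integrable hf hD ht.1).sub (hx'.drift_integrable hf hD ht.1))
        (by apply Continuous.intervalIntegrable; fun_prop) fun s hs => ?_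
      refine drift_sub_le hf hD hx hx' hh hs.1.le (by positivity) fun r hr => ?_
      have h1 := hb r ⟨hr.1, hr.2.trans_lt hs.2⟩
      have h2 : e' * Real.exp (L * r) ≤ e' * Real.exp (L * s) := by
        gcongr
        exact hr.2
      linarith
    rw [integral_exp_mul_const] at hint
    have := h t ht
    simp only [mul_zero, Real.exp_zero] at hint
    linarith
  intro t ht
  have hp := Real.exp_pos (L * t)
  refine le_of_forall_pos_le_add fun ε hε => ?_
  -- The excess over e is scaled so that it contributes exactly ε at time t.
  have := key (e + ε * Real.exp (-(L * t))) (by have := Real.exp_pos (-(L * t)); nlinarith) t ht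
  have h1 : Real.exp (-(L * t)) * Real.exp (L * t) = 1 := by
    rw [← Real.exp_add, neg_add_cancel, Real.exp_zero]
  rw [add_mul, mul_assoc ε, h1] at this
  linarith

/-- Two-sided version of `comparison`. -/
theorem abs_sub_le_of_defect (hf : RegularProduction f C) (hD : IsDelayOp T A D) {x x' : ℝ → ℝ}
    (hx : IsPath T x) (hx' : IsPath T x') (hh : ∀ s ∈ Ico (-T) 0, x s = x' s) {S e : ℝ}
    (he : 0 ≤ e)
    (h : ∀ t ∈ Icc 0 S, |x t - x' t -
      ∫ s in (0 : ℝ)..t, (f (x s) (D x s) - f (x' s) (D x' s))| ≤ e) :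
    ∀ t ∈ Icc 0 S, |x t - x' t| ≤ e * Real.exp (C * (1 + A) * t) := by
  intro t ht
  rw [abs_le]
  constructor
  · have := comparison hf hD hx' hx (fun s hs => (hh s hs).symm) he (fun t ht => by
      have h1 := (abs_le.1 (h t ht)).1
      have h2 : ∫ s in (0 : ℝ)..t, (f (x' s) (D x' s) - f (x s) (D x s)) =
          -∫ s in (0 : ℝ)..t, (f (x s) (D x s) - f (x' s) (D x' s)) := by
        rw [← intervalIntegral.integral_neg]; simp
      linarith) t ht
    linarith
  · have := comparison hf hD hx hx' hh he (fun t ht => by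
      have h1 := (abs_le.1 (h t ht)).2
      linarith) t ht
    linarith

end Drift

/-! ### Global solutions by Picard iteration. -/

section Solutions

variable {T A C : ℝ} {f : ℝ → ℝ → ℝ} {D : (ℝ → ℝ) → ℝ → ℝ}

lemma intervalIntegrable_of_locallyIntegrableOn_Ici {c : ℝ → ℝ}
    (hc : LocallyIntegrableOn c (Ici 0)) {r t : ℝ} (hr : 0 ≤ r) (ht : 0 ≤ t) :
    IntervalIntegrable c volume r t := by
  rw [intervalIntegrable_iff']
  exact hc.integrableOn_compact_subset (fun s hs => (le_min hr ht).trans hs.1) isCompact_uIcc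

lemma locallyIntegrableOn_Ici_of_integrableOn {c : ℝ → ℝ}
    (hc : ∀ S, 0 ≤ S → IntegrableOn c (Icc 0 S)) : LocallyIntegrableOn c (Ici 0) := by
  rw [locallyIntegrableOn_iff isClosed_Ici.isLocallyClosed]
  intro k hk hkc
  obtain ⟨b, hb⟩ := hkc.bddAbove
  refine (hc (max b 0) (le_max_right _ _)).mono_set fun s hs => ⟨hk hs, (hb hs).trans (le_max_left _ _)⟩

lemma continuousOn_Ici_of_Icc {x : ℝ → ℝ} (h : ∀ S, 0 ≤ S → ContinuousOn x (Icc 0 S)) :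
    ContinuousOn x (Ici 0) := by
  intro t ht
  have ht0 : (0 : ℝ) ≤ t := ht
  refine ((h (t + 1) (by linarith)) t ⟨ht, by linarith⟩).mono_of_mem_nhdsWithin ?_
  rw [mem_nhdsWithin]
  exact ⟨Iio (t + 1), isOpen_Iio, by simp, fun s hs => ⟨hs.2, le_of_lt hs.1⟩⟩

lemma continuousOn_primitive_Ici {g : ℝ → ℝ}
    (hg : ∀ S, 0 ≤ S → IntervalIntegrable g volume 0 S) :
    ContinuousOn (fun t => ∫ s in (0 : ℝ)..t, g s) (Ici 0) := by
  refine continuousOn_Ici_of_Icc fun S hS => ?_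
  have := intervalIntegral.continuousOn_primitive_interval (f := g) (μ := volume) (a := 0) (b := S)
    (by have := hg S hS; rwa [intervalIntegrable_iff'] at this)
  rwa [uIcc_of_le hS] at this

lemma isPath_of_eq {T : ℝ} {η x : ℝ → ℝ} (hη : IntegrableOn η (Ico (-T) 0))
    (hh : ∀ s ∈ Ico (-T) 0, x s = η s) (hx : ContinuousOn x (Ici 0)) : IsPath T x :=
  ⟨hη.congr_fun (fun s hs => (hh s hs).symm) measurableSet_Ico, hx⟩

lemma isHistory_of_eq {T : ℝ} {η x : ℝ → ℝ} (hη : IsHistory T η)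
    (hh : ∀ s ∈ Ico (-T) 0, x s = η s) : IsHistory T x :=
  ⟨hη.integrable.congr_fun (fun s hs => (hh s hs).symm) measurableSet_Ico, by
    filter_upwards [hη.nonneg, ae_restrict_mem measurableSet_Ico] with s h1 h2
    rw [hh s h2]; exact h1⟩

/-- The Picard iterates of the delay equation. -/
noncomputable def picard (f : ℝ → ℝ → ℝ) (D : (ℝ → ℝ) → ℝ → ℝ) (η₀ : ℝ) (η₁ c : ℝ → ℝ) :
    ℕ → ℝ → ℝ
  | 0 => fun t => if t < 0 then η₁ t else η₀
  | n + 1 => fun t => if t < 0 then η₁ t else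
      η₀ + (∫ s in (0 : ℝ)..t, f (picard f D η₀ η₁ c n s) (D (picard f D η₀ η₁ c n) s))
        - ∫ s in (0 : ℝ)..t, c s

lemma picard_isPath (hf : RegularProduction f C) (hD : IsDelayOp T A D) {η₀ : ℝ} {η₁ c : ℝ → ℝ}
    (hη : IntegrableOn η₁ (Ico (-T) 0)) (hc : LocallyIntegrableOn c (Ici 0)) (n : ℕ) :
    IsPath T (picard f D η₀ η₁ c n) := by
  induction n with
  | zero =>
    refine isPath_of_eq hη (fun s hs => by simp [picard, hs.2]) ?_
    exact (continuousOn_const (c := η₀)).congr fun s hs => by simp [picard, not_lt.2 (mem_Ici.1 hs)]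
  | succ n ih =>
    refine isPath_of_eq hη (fun s hs => by simp [picard, hs.2]) ?_
    refine ContinuousOn.congr (f := fun t => η₀ + (∫ s in (0 : ℝ)..t,
      f (picard f D η₀ η₁ c n s) (D (picard f D η₀ η₁ c n) s)) - ∫ s in (0 : ℝ)..t, c s) ?_
      fun s hs => by simp [picard, not_lt.2 (mem_Ici.1 hs)]
    refine (continuousOn_const.add (continuousOn_primitive_Ici fun S hS =>
      ih.drift_integrable hf hD hS)).sub (continuousOn_primitive_Ici fun S hS =>
        intervalIntegrable_of_locallyIntegrableOn_Ici hc le_rfl hS)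

lemma abs_drift_sub_le (hf : RegularProduction f C) (hD : IsDelayOp T A D) {x x' : ℝ → ℝ}
    (hx : IsPath T x) (hx' : IsPath T x') (hh : ∀ s ∈ Ico (-T) 0, x s = x' s) {t d : ℝ}
    (ht : 0 ≤ t) (hd : 0 ≤ d) (h : ∀ s ∈ Icc 0 t, |x s - x' s| ≤ d) :
    |f (x t) (D x t) - f (x' t) (D x' t)| ≤ C * (1 + A) * d := by
  rw [abs_le]
  constructor
  · have := drift_sub_le hf hD hx' hx (fun s hs => (hh s hs).symm) ht hd
      (fun s hs => by have := (abs_le.1 (h s hs)).1; linarith)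
    linarith
  · exact drift_sub_le hf hD hx hx' hh ht hd
      (fun s hs => by have := (abs_le.1 (h s hs)).2; linarith)

/-- The extended drift is globally Lipschitz, so the Picard iterates converge uniformly on every
[0,S], for every control and without any positivity of the state. -/
theorem exists_solution (hf : RegularProduction f C) (hD : IsDelayOp T A D) (η₀ : ℝ)
    {η₁ c : ℝ → ℝ} (hη : IntegrableOn η₁ (Ico (-T) 0)) (hc : LocallyIntegrableOn c (Ici 0)) :
    ∃ x, IsSolution T f D η₀ η₁ c x := by
  set X := picard f D η₀ η₁ c with hX
  have hp := picard_isPath hf hD (η₀ := η₀) hη hc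
  have hhist : ∀ n, ∀ s < 0, X n s = η₁ s := by
    intro n s hs; cases n <;> simp [hX, picard, hs]
  have hsucc : ∀ n t, 0 ≤ t → X (n + 1) t = η₀ + (∫ s in (0 : ℝ)..t, f (X n s) (D (X n) s))
      - ∫ s in (0 : ℝ)..t, c s := by
    intro n t ht; simp [hX, picard, not_lt.2 ht]
  set L := C * (1 + A) + 1 with hL
  have hL0 : 0 < L := by
    have := mul_nonneg hf.const_nonneg (by linarith [hD.const_nonneg] : 0 ≤ 1 + A); linarith
  -- In the supremum norm weighted by exp(-2 L t) each Picard step is a contraction by 1/2.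
  have hstep : ∀ S, 0 ≤ S → ∃ M, 0 ≤ M ∧ ∀ n, ∀ t ∈ Icc 0 S,
      |X (n + 1) t - X n t| ≤ M / 2 ^ n * Real.exp (2 * L * t) := by
    intro S hS
    have hcont : ContinuousOn (fun t => X 1 t - X 0 t) (Icc 0 S) :=
      ((hp 1).continuousOn.mono Icc_subset_Ici_self).sub
        ((hp 0).continuousOn.mono Icc_subset_Ici_self)
    obtain ⟨M, hM⟩ := isCompact_Icc.exists_bound_of_continuousOn hcont
    have hM0 : 0 ≤ M := (norm_nonneg _).trans (hM 0 ⟨le_rfl, hS⟩)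
    refine ⟨M, hM0, fun n => ?_⟩
    induction n with
    | zero =>
      intro t ht
      have h1 := hM t ht
      rw [Real.norm_eq_abs] at h1
      have h2 : 1 ≤ Real.exp (2 * L * t) := Real.one_le_exp (by have := ht.1; positivity)
      simp only [pow_zero, div_one]
      simp only [zero_add]
      nlinarith
    | succ n ih =>
      intro t ht
      rw [hsucc (n + 1) t ht.1, hsucc n t ht.1]
      have hi1 := (hp (n + 1)).drift_integrable hf hD ht.1
      have hi0 := (hp n).drift_integrable hf hD ht.1
      have e1 : η₀ + (∫ s in (0 : ℝ)..t, f (X (n + 1) s) (D (X (n + 1)) s))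
          - (∫ s in (0 : ℝ)..t, c s) - (η₀ + (∫ s in (0 : ℝ)..t, f (X n s) (D (X n) s))
          - ∫ s in (0 : ℝ)..t, c s) =
          ∫ s in (0 : ℝ)..t, (f (X (n + 1) s) (D (X (n + 1)) s) - f (X n s) (D (X n) s)) := by
        rw [intervalIntegral.integral_sub hi1 hi0]; ring
      rw [e1]
      have hM2 : 0 ≤ M / 2 ^ n := by positivity
      have hint := intervalIntegral.norm_integral_le_of_norm_le (μ := volume) (a := 0) (b := t)
        (f := fun s => f (X (n + 1) s) (D (X (n + 1)) s) - f (X n s) (D (X n) s))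
        (g := fun s => 2 * L * (M / 2 ^ (n + 1) * Real.exp (2 * L * s))) ht.1
        (ae_of_all _ fun s hs => by
          have := abs_drift_sub_le hf hD (hp (n + 1)) (hp n)
            (fun r hr => by rw [← hX, hhist _ r hr.2, hhist _ r hr.2]) hs.1.le
            (d := M / 2 ^ n * Real.exp (2 * L * s)) (by positivity) (fun r hr => by
              refine (ih r ⟨hr.1, hr.2.trans (hs.2.trans ht.2)⟩).trans ?_
              gcongr
              exact hr.2)
          rw [Real.norm_eq_abs]
          refine this.trans ?_
          have e2 : 2 * L * (M / 2 ^ (n + 1) * Real.exp (2 * L * s)) =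
            L * (M / 2 ^ n * Real.exp (2 * L * s)) := by rw [pow_succ]; field_simp
          rw [e2]
          gcongr
          linarith) (by apply Continuous.intervalIntegrable; fun_prop)
      rw [integral_exp_mul_const] at hint
      rw [← Real.norm_eq_abs]
      refine hint.trans ?_
      have h3 : 0 ≤ M / 2 ^ (n + 1) := by positivity
      simp only [mul_zero, Real.exp_zero]
      nlinarith
  have hbound : ∀ S, 0 ≤ S → ∃ M, 0 ≤ M ∧ ∀ n, ∀ t ∈ Icc 0 S,
      dist (X n t) (X (n + 1) t) ≤ M / 2 / 2 ^ n := by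
    intro S hS
    obtain ⟨M, hM0, hM⟩ := hstep S hS
    refine ⟨2 * (M * Real.exp (2 * L * S)), by positivity, fun n t ht => ?_⟩
    rw [dist_comm, Real.dist_eq]
    refine (hM n t ht).trans ?_
    have : M / 2 ^ n * Real.exp (2 * L * t) ≤ M / 2 ^ n * Real.exp (2 * L * S) := by
      gcongr; exact ht.2
    refine this.trans (le_of_eq ?_)
    ring
  have hlim : ∀ t, ∃ l, Tendsto (fun n => X n t) atTop (𝓝 l) := by
    intro t
    rcases lt_or_ge t 0 with ht | ht
    · exact ⟨η₁ t, by simp_rw [fun n => hhist n t ht]; exact tendsto_const_nhds⟩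
    · obtain ⟨M, -, hM⟩ := hbound t ht
      exact cauchySeq_tendsto_of_complete
        (cauchySeq_of_le_geometric_two (C := M) fun n => hM n t ⟨ht, le_rfl⟩)
  choose x hx using hlim
  have hunif : ∀ S, 0 ≤ S → ∃ M, 0 ≤ M ∧ ∀ n, ∀ t ∈ Icc 0 S, |X n t - x t| ≤ M / 2 ^ n := by
    intro S hS
    obtain ⟨M, hM0, hM⟩ := hbound S hS
    exact ⟨M, hM0, fun n t ht =>
      dist_le_of_le_geometric_two_of_tendsto (fun n => hM n t ht) (hx t) n⟩
  have hxh : ∀ s < 0, x s = η₁ s := by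
    intro s hs
    refine tendsto_nhds_unique (hx s) ?_
    simp_rw [fun n => hhist n s hs]; exact tendsto_const_nhds
  have hgeo : ∀ M : ℝ, Tendsto (fun n : ℕ => M / 2 ^ n) atTop (𝓝 0) := by
    intro M
    have := (tendsto_pow_atTop_nhds_zero_of_lt_one (r := (2 : ℝ)⁻¹) (by norm_num)
      (by norm_num)).const_mul M
    simpa [div_eq_mul_inv] using this
  have hxc : ContinuousOn x (Ici 0) := by
    refine continuousOn_Ici_of_Icc fun S hS => ?_
    obtain ⟨M, hM0, hM⟩ := hunif S hS
    refine TendstoUniformlyOn.continuousOn (F := fun n => X n) (p := atTop) ?_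
      (Frequently.of_forall fun n => (hp n).continuousOn.mono Icc_subset_Ici_self)
    rw [Metric.tendstoUniformlyOn_iff]
    intro ε hε
    filter_upwards [(hgeo M).eventually (gt_mem_nhds hε)] with n hn t ht
    rw [dist_comm, Real.dist_eq]
    exact (hM n t ht).trans_lt hn
  have hxp : IsPath T x := isPath_of_eq hη (fun s hs => hxh s hs.2) hxc
  refine ⟨x, fun s hs => hxh s hs.2, hxc, fun t ht => ?_⟩
  obtain ⟨M, hM0, hM⟩ := hunif t ht
  have hI : Tendsto (fun n => ∫ s in (0 : ℝ)..t, f (X n s) (D (X n) s)) atTop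
      (𝓝 (∫ s in (0 : ℝ)..t, f (x s) (D x s))) := by
    rw [tendsto_iff_dist_tendsto_zero]
    refine squeeze_zero (fun _ => dist_nonneg) (g := fun n => (L * M * t) / 2 ^ n) (fun n => ?_)
      (hgeo _)
    rw [Real.dist_eq, ← intervalIntegral.integral_sub ((hp n).drift_integrable hf hD ht)
      (hxp.drift_integrable hf hD ht), ← Real.norm_eq_abs]
    have := intervalIntegral.norm_integral_le_of_norm_le_const (a := 0) (b := t)
      (f := fun s => f (X n s) (D (X n) s) - f (x s) (D x s)) (C := L * (M / 2 ^ n))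
      (fun s hs => by
        rw [uIoc_of_le ht] at hs
        rw [Real.norm_eq_abs]
        refine (abs_drift_sub_le hf hD (hp n) hxp
          (fun r hr => by rw [← hX, hhist _ r hr.2, hxh r hr.2]) hs.1.le
          (d := M / 2 ^ n) (by positivity) (fun r hr => hM n r ⟨hr.1, hr.2.trans hs.2⟩)).trans ?_
        gcongr
        linarith)
    refine this.trans (le_of_eq ?_)
    rw [sub_zero, abs_of_nonneg ht]; ring
  refine tendsto_nhds_unique ((hx t).comp (tendsto_add_atTop_nat 1)) ?_
  have : (fun n => X n t) ∘ (fun a => a + 1) = fun n =>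
      η₀ + (∫ s in (0 : ℝ)..t, f (X n s) (D (X n) s)) - ∫ s in (0 : ℝ)..t, c s := by
    funext n; exact hsucc n t ht
  rw [this]
  exact (hI.const_add η₀).sub_const _

end Solutions

/-! ### Order properties of trajectories. -/

section Trajectories

variable {T A C : ℝ} {f : ℝ → ℝ → ℝ} {D : (ℝ → ℝ) → ℝ → ℝ} {η₀ η₀' : ℝ} {η₁ c c' x x' : ℝ → ℝ}

lemma IsSolution.isPath (h : IsSolution T f D η₀ η₁ c x) (hη : IsHistory T η₁) : IsPath T x :=
  isPath_of_eq hη.integrable h.history h.continuousOn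

lemma IsSolution.isHistory (h : IsSolution T f D η₀ η₁ c x) (hη : IsHistory T η₁) :
    IsHistory T x :=
  isHistory_of_eq hη h.history

lemma IsSolution.apply_zero (h : IsSolution T f D η₀ η₁ c x) : x 0 = η₀ := by
  simpa using h.integral_eq 0 le_rfl

lemma IsSolution.le_add_of_cost_le (hf : RegularProduction f C) (hD : IsDelayOp T A D)
    (hη : IsHistory T η₁) (h : IsSolution T f D η₀ η₁ c x) (h' : IsSolution T f D η₀' η₁ c' x')
    {S e : ℝ} (he : 0 ≤ e)
    (hc : ∀ t ∈ Icc 0 S, η₀ - (∫ s in (0 : ℝ)..t, c s) ≤ η₀' - (∫ s in (0 : ℝ)..t, c' s) + e) :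
    ∀ t ∈ Icc 0 S, x t ≤ x' t + e * Real.exp (C * (1 + A) * t) := by
  refine comparison hf hD (h.isPath hη) (h'.isPath hη)
    (fun s hs => (h.history s hs).trans (h'.history s hs).symm) he fun t ht => ?_
  rw [intervalIntegral.integral_sub ((h.isPath hη).drift_integrable hf hD ht.1)
    ((h'.isPath hη).drift_integrable hf hD ht.1), h.integral_eq t ht.1, h'.integral_eq t ht.1]
  have := hc t ht
  linarith

lemma IsSolution.le_of_cost_le (hf : RegularProduction f C) (hD : IsDelayOp T A D)
    (hη : IsHistory T η₁) (h : IsSolution T f D η₀ η₁ c x) (h' : IsSolution T f D η₀' η₁ c' x')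
    {S : ℝ}
    (hc : ∀ t ∈ Icc 0 S, η₀ - (∫ s in (0 : ℝ)..t, c s) ≤ η₀' - (∫ s in (0 : ℝ)..t, c' s)) :
    ∀ t ∈ Icc 0 S, x t ≤ x' t := by
  intro t ht
  have := h.le_add_of_cost_le hf hD hη h' (S := S) (e := 0) le_rfl (by simpa using hc) t ht
  simpa using this

/-- Comparison with defect zero. The paths y of interest are frozen trajectories and convex
combinations of trajectories, which only satisfy an integral inequality. -/
lemma IsSolution.ge_of_subsolution (hf : RegularProduction f C) (hD : IsDelayOp T A D)
    (hη : IsHistory T η₁) (h : IsSolution T f D η₀ η₁ c x) {y : ℝ → ℝ} (hy : IsPath T y)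
    (hyh : ∀ s ∈ Ico (-T) 0, y s = η₁ s) {S : ℝ}
    (hsub : ∀ t ∈ Icc 0 S, y t ≤ η₀ + (∫ s in (0 : ℝ)..t, f (y s) (D y s))
      - ∫ s in (0 : ℝ)..t, c s) :
    ∀ t ∈ Icc 0 S, y t ≤ x t := by
  intro t ht
  have := comparison hf hD hy (h.isPath hη)
    (fun s hs => (hyh s hs).trans (h.history s hs).symm) (S := S) (e := 0) le_rfl (fun t ht => by
      rw [intervalIntegral.integral_sub (hy.drift_integrable hf hD ht.1)
        ((h.isPath hη).drift_integrable hf hD ht.1), h.integral_eq t ht.1]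
      have := hsub t ht
      linarith) t ht
  simpa using this

/-- A trajectory that is nonnegative up to time `M`, with no consumption afterwards, stays above
its value at `M`. -/
lemma IsSolution.ge_after (hf : RegularProduction f C) (hD : IsDelayOp T A D)
    (hη : IsHistory T η₁) (h : IsSolution T f D η₀ η₁ c x) (hc : LocallyIntegrableOn c (Ici 0))
    {M : ℝ} (hM : 0 ≤ M) (hx : ∀ t ∈ Icc 0 M, 0 ≤ x t) (hc0 : ∀ t, M < t → c t = 0) :
    ∀ t, M ≤ t → x M ≤ x t := by
  intro t hMt
  -- The path frozen at time M is a subsolution: after M nothing is consumed, and its drift is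
  -- nonnegative because the path and hence its delay term are nonnegative.
  set y : ℝ → ℝ := fun s => x (min s M) with hy
  have hyle : ∀ s, s ≤ M → y s = x s := fun s hs => by simp [hy, min_eq_left hs]
  have hyge : ∀ s, M ≤ s → y s = x M := fun s hs => by simp [hy, min_eq_right hs]
  have hyh : ∀ s ∈ Ico (-T) 0, y s = η₁ s := fun s hs =>
    (hyle s (hs.2.le.trans hM)).trans (h.history s hs)
  have hyp : IsPath T y := isPath_of_eq hη.integrable hyh
    (h.continuousOn.comp (by fun_prop) fun s hs => le_min hs hM)
  have hynn : ∀ s, 0 ≤ s → 0 ≤ y s := fun s hs => hx _ ⟨le_min hs hM, min_le_right _ _⟩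
  have hDy : ∀ s, s ≤ M → D y s = D x s := fun s hs =>
    hD.congr _ _ _ fun r hr => hyle r (hr.2.trans hs)
  have hint : ∀ r, 0 ≤ r → r ≤ M → ∫ s in (0 : ℝ)..r, f (y s) (D y s) =
      ∫ s in (0 : ℝ)..r, f (x s) (D x s) := by
    intro r hr hrM
    refine intervalIntegral.integral_congr fun s hs => ?_
    rw [uIcc_of_le hr] at hs
    rw [hyle s (hs.2.trans hrM), hDy s (hs.2.trans hrM)]
  have hnn := hD.nonneg y hyp (isHistory_of_eq hη hyh)
  have := h.ge_of_subsolution hf hD hη hyp hyh (S := t) (fun r hr => by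
    rcases le_total r M with hrM | hrM
    · rw [hyle r hrM, hint r hr.1 hrM, h.integral_eq r hr.1]
    · rw [hyge r hrM, h.integral_eq M hM, ← hint M hM le_rfl,
        ← intervalIntegral.integral_add_adjacent_intervals (hyp.drift_integrable hf hD hM)
          (hyp.drift_integrable' hf hD hM hr.1),
        ← intervalIntegral.integral_add_adjacent_intervals (a := 0) (b := M) (c := r) (f := c)
          (intervalIntegrable_of_locallyIntegrableOn_Ici hc le_rfl hM)
          (intervalIntegrable_of_locallyIntegrableOn_Ici hc hM hr.1)]
      have e1 : ∫ s in M..r, c s = 0 := by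
        apply intervalIntegral.integral_zero_ae
        refine ae_of_all _ fun s hs => ?_
        rw [uIoc_of_le hrM] at hs
        exact hc0 s hs.1
      have e2 : 0 ≤ ∫ s in M..r, f (y s) (D y s) := by
        apply intervalIntegral.integral_nonneg_of_ae_restrict hrM
        have h1 : volume.restrict (Icc M r) = volume.restrict (Ioc M r) :=
          Measure.restrict_congr_set Ioc_ae_eq_Icc.symm
        rw [h1]
        have h2 := ae_restrict_of_ae_restrict_of_subset (s := Ioc M r) (t := Ioi 0)
          (fun s hs => lt_of_le_of_lt hM hs.1) hnn
        filter_upwards [h2] with s hs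
        exact hf.nonneg _ _ (hs fun q hq => hynn q hq.1)
      linarith) t ⟨hM.trans hMt, le_rfl⟩
  rwa [hyge t hMt] at this

lemma IsSolution.ge_initial (hf : RegularProduction f C) (hD : IsDelayOp T A D)
    (hη : IsHistory T η₁) (h : IsSolution T f D η₀ η₁ (fun _ => 0) x) (h0 : 0 ≤ η₀) :
    ∀ t, 0 ≤ t → η₀ ≤ x t := by
  intro t ht
  have := h.ge_after hf hD hη ((locallyIntegrable_const (0 : ℝ)).locallyIntegrableOn _) (M := 0) le_rfl
    (fun s hs => by
      have : s = 0 := le_antisymm hs.2 hs.1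
      rw [this, h.apply_zero]; exact h0) (fun _ _ => rfl) t ht
  rwa [h.apply_zero] at this

lemma IsSolution.drift_integral_mono (hf : RegularProduction f C) (hD : IsDelayOp T A D)
    (hη : IsHistory T η₁) (h : IsSolution T f D η₀ η₁ c x) (h' : IsSolution T f D η₀' η₁ c' x')
    {r t : ℝ} (hr : 0 ≤ r) (hrt : r ≤ t) (hle : ∀ s ∈ Icc 0 t, x s ≤ x' s) :
    ∫ s in r..t, f (x s) (D x s) ≤ ∫ s in r..t, f (x' s) (D x' s) := by
  refine intervalIntegral.integral_mono_on hrt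
    ((h.isPath hη).drift_integrable' hf hD hr (hr.trans hrt))
    ((h'.isPath hη).drift_integrable' hf hD hr (hr.trans hrt)) fun s hs => ?_
  have := drift_sub_le hf hD (h.isPath hη) (h'.isPath hη)
    (fun s hs => (h.history s hs).trans (h'.history s hs).symm) (hr.trans hs.1) le_rfl (fun q hq => by
      have := hle q ⟨hq.1, hq.2.trans hs.2⟩
      simpa using this)
  simp only [mul_zero] at this
  linarith

lemma integral_nonneg_of_control_nonneg (hc0 : ∀ t, 0 ≤ t → 0 ≤ c t) {r t : ℝ} (hr : 0 ≤ r)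
    (hrt : r ≤ t) : 0 ≤ ∫ s in r..t, c s :=
  intervalIntegral.integral_nonneg hrt fun s hs => hc0 s (hr.trans hs.1)

/-- Trajectories lie below the one without consumption. -/
lemma IsSolution.le_free (hf : RegularProduction f C) (hD : IsDelayOp T A D)
    (hη : IsHistory T η₁) (h : IsSolution T f D η₀ η₁ c x)
    (h' : IsSolution T f D η₀ η₁ (fun _ => 0) x') (hc0 : ∀ t, 0 ≤ t → 0 ≤ c t) :
    ∀ t, 0 ≤ t → x t ≤ x' t := fun t ht =>
  h.le_of_cost_le hf hD hη h' (S := t) (fun s hs => by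
    have := integral_nonneg_of_control_nonneg hc0 le_rfl hs.1
    simp [this]) t ⟨ht, le_rfl⟩

/-- Total consumption is bounded by the state without consumption. -/
lemma IsSolution.integral_control_le_free (hf : RegularProduction f C) (hD : IsDelayOp T A D)
    (hη : IsHistory T η₁) (h : IsSolution T f D η₀ η₁ c x)
    (h' : IsSolution T f D η₀ η₁ (fun _ => 0) x') (hc0 : ∀ t, 0 ≤ t → 0 ≤ c t) {t : ℝ}
    (ht : 0 ≤ t) (hx : 0 ≤ x t) : ∫ s in (0 : ℝ)..t, c s ≤ x' t := by
  have h1 := h.drift_integral_mono hf hD hη h' le_rfl ht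
    (fun s hs => h.le_free hf hD hη h' hc0 s hs.1)
  have h2 := h.integral_eq t ht
  have h3 := h'.integral_eq t ht
  simp only [intervalIntegral.integral_zero, sub_zero] at h3
  linarith

end Trajectories

/-! ### Discounted payoffs as real numbers. -/

section Payoff

/-- Nonpositive, nondecreasing, concave utilities of the state. -/
structure NonposUtility (U₂ : ℝ → ℝ) : Prop where
  continuousOn : ContinuousOn U₂ (Ioi 0)
  mono : MonotoneOn U₂ (Ioi 0)
  concave : ConcaveOn ℝ (Ioi 0) U₂
  nonpos : ∀ x, 0 < x → U₂ x ≤ 0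

/-- The discounted utility of the state is integrable. -/
def HasFinitePayoff (ρ : ℝ) (U₂ x : ℝ → ℝ) : Prop :=
  IntegrableOn (fun t => Real.exp (-ρ * t) * U₂ (x t)) (Ioi 0)

/-- The real valued objective functional. -/
noncomputable def realPayoff (ρ : ℝ) (U₁ U₂ c x : ℝ → ℝ) : ℝ :=
  (∫ t in Ioi (0 : ℝ), Real.exp (-ρ * t) * U₁ (c t)) +
    ∫ t in Ioi (0 : ℝ), Real.exp (-ρ * t) * U₂ (x t)

variable {ρ : ℝ} {U₁ U₂ c x : ℝ → ℝ}

lemma integrableOn_discount (hρ : 0 < ρ) (a : ℝ) :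
    IntegrableOn (fun t => Real.exp (-ρ * t)) (Ioi a) :=
  exp_neg_integrableOn_Ioi a hρ

lemma integral_discount (hρ : 0 < ρ) (a : ℝ) :
    ∫ t in Ioi a, Real.exp (-ρ * t) = Real.exp (-ρ * a) / ρ := by
  have h := integral_exp_mul_Ioi (a := -ρ) (by linarith) a
  rw [h]; field_simp

lemma extIntegral_of_integrable {g : ℝ → ℝ} (hg : IntegrableOn g (Ioi 0)) :
    extIntegral g = ((∫ t in Ioi (0 : ℝ), g t : ℝ) : EReal) := by
  have h1 : ∫⁻ t in Ioi (0 : ℝ), ENNReal.ofReal (g t) ≠ ⊤ :=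
    hg.lintegral_lt_top.ne
  have h2 : ∫⁻ t in Ioi (0 : ℝ), ENNReal.ofReal (-g t) ≠ ⊤ :=
    hg.neg.lintegral_lt_top.ne
  rw [integral_eq_lintegral_pos_part_sub_lintegral_neg_part hg, extIntegral]
  rw [EReal.coe_sub, EReal.coe_ennreal_toReal h1, EReal.coe_ennreal_toReal h2]

/-- The integrable upper bound makes the positive part finite, so only the negative part can be
responsible for the failure of integrability. -/
lemma extIntegral_of_not_integrable {g b : ℝ → ℝ}
    (hg : AEStronglyMeasurable g (volume.restrict (Ioi 0))) (hb : IntegrableOn b (Ioi 0))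
    (hgb : ∀ t ∈ Ioi (0 : ℝ), g t ≤ b t) (hn : ¬ IntegrableOn g (Ioi 0)) :
    extIntegral g = ⊥ := by
  have h1 : ∫⁻ t in Ioi (0 : ℝ), ENNReal.ofReal (g t) ≠ ⊤ := by
    refine ne_top_of_le_ne_top hb.lintegral_lt_top.ne ?_
    exact setLIntegral_mono_ae' measurableSet_Ioi
      (ae_of_all _ fun t ht => ENNReal.ofReal_le_ofReal (hgb t ht))
  have h2 : ∫⁻ t in Ioi (0 : ℝ), ENNReal.ofReal (-g t) = ⊤ := by
    by_contra h2
    refine hn ⟨hg, ?_⟩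
    rw [hasFiniteIntegral_iff_norm]
    have : ∀ t, ENNReal.ofReal ‖g t‖ ≤ ENNReal.ofReal (g t) + ENNReal.ofReal (-g t) := by
      intro t
      rcases le_total 0 (g t) with h | h
      · rw [Real.norm_of_nonneg h]; exact le_self_add
      · rw [Real.norm_of_nonpos h]; exact le_add_self
    refine (lintegral_mono this).trans_lt ?_
    rw [lintegral_add_left' hg.aemeasurable.ennreal_ofReal]
    exact ENNReal.add_lt_top.2 ⟨lt_top_iff_ne_top.2 h1, lt_top_iff_ne_top.2 h2⟩
  rw [extIntegral, h2]
  lift ∫⁻ t in Ioi (0 : ℝ), ENNReal.ofReal (g t) to NNReal using h1 with r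
  simp

lemma ConsumptionUtility.continuous_max (hU : ConsumptionUtility U₁) :
    Continuous (fun u => U₁ (max u 0)) :=
  hU.continuousOn.comp_continuous (by fun_prop) fun u => le_max_right u 0

lemma aestronglyMeasurable_control (hc : LocallyIntegrableOn c (Ici 0)) :
    AEStronglyMeasurable c (volume.restrict (Ioi 0)) :=
  hc.aestronglyMeasurable.mono_measure (Measure.restrict_mono_set _ Ioi_subset_Ici_self)

lemma ConsumptionUtility.integrableOn (hU : ConsumptionUtility U₁) (hρ : 0 < ρ)
    (hc : LocallyIntegrableOn c (Ici 0)) (hc0 : ∀ t, 0 ≤ t → 0 ≤ c t) :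
    IntegrableOn (fun t => Real.exp (-ρ * t) * U₁ (c t)) (Ioi 0) := by
  obtain ⟨B, hB⟩ := hU.bounded
  refine ((integrableOn_discount hρ 0).mul_const B).mono' ?_ ?_
  · refine (by fun_prop : Continuous fun t => Real.exp (-ρ * t)).aestronglyMeasurable.mul ?_
    have := hU.continuous_max.comp_aestronglyMeasurable (aestronglyMeasurable_control hc)
    refine this.congr ?_
    filter_upwards [ae_restrict_mem measurableSet_Ioi] with t ht
    rw [max_eq_left (hc0 t (le_of_lt ht))]
  · filter_upwards [ae_restrict_mem measurableSet_Ioi] with t ht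
    rw [norm_mul, Real.norm_of_nonneg (Real.exp_pos _).le, Real.norm_eq_abs]
    gcongr
    exact hB _ (hc0 t (le_of_lt ht))

lemma NonposUtility.aestronglyMeasurable (hU : NonposUtility U₂) (hx : ContinuousOn x (Ici 0))
    (hx0 : ∀ t, 0 ≤ t → 0 < x t) :
    AEStronglyMeasurable (fun t => Real.exp (-ρ * t) * U₂ (x t)) (volume.restrict (Ioi 0)) := by
  refine ContinuousOn.aestronglyMeasurable (ContinuousOn.mul (by fun_prop) ?_) measurableSet_Ioi
  exact hU.continuousOn.comp (hx.mono Ioi_subset_Ici_self) fun t ht => hx0 t (le_of_lt ht)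

lemma NonposUtility.finite_of_le (hU : NonposUtility U₂) {x' : ℝ → ℝ} {e : ℝ → ℝ}
    (he : IntegrableOn e (Ioi 0))
    (hx' : ContinuousOn x' (Ici 0)) (hx0' : ∀ t, 0 ≤ t → 0 < x' t)
    (hle : ∀ t ∈ Ioi (0 : ℝ), e t ≤ Real.exp (-ρ * t) * U₂ (x' t)) :
    HasFinitePayoff ρ U₂ x' := by
  refine Integrable.mono' he.neg (hU.aestronglyMeasurable hx' hx0') ?_
  filter_upwards [ae_restrict_mem measurableSet_Ioi] with t ht
  have h1 := hU.nonpos _ (hx0' t (le_of_lt ht))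
  rw [Real.norm_of_nonpos (mul_nonpos_of_nonneg_of_nonpos (Real.exp_pos _).le h1)]
  have := hle t ht
  simp only [Pi.neg_apply]
  linarith

lemma HasFinitePayoff.of_ge (h : HasFinitePayoff ρ U₂ x) (hU : NonposUtility U₂) {x' : ℝ → ℝ}
    (hx0 : ∀ t, 0 ≤ t → 0 < x t) (hx' : ContinuousOn x' (Ici 0))
    (hle : ∀ t, 0 < t → x t ≤ x' t) (hx0' : ∀ t, 0 ≤ t → 0 < x' t) : HasFinitePayoff ρ U₂ x' := by
  refine hU.finite_of_le h hx' hx0' fun t ht => ?_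
  have := hU.mono (hx0 t (le_of_lt ht)) (hx0' t (le_of_lt ht)) (hle t ht)
  gcongr

lemma NonposUtility.finite_of_bounded_below (hU : NonposUtility U₂) (hρ : 0 < ρ) {m : ℝ}
    (hm : 0 < m) (hx : ContinuousOn x (Ici 0)) (hxm : ∀ t, 0 ≤ t → m ≤ x t) :
    HasFinitePayoff ρ U₂ x := by
  refine hU.finite_of_le (e := fun t => Real.exp (-ρ * t) * U₂ m)
    ((integrableOn_discount hρ 0).mul_const _) hx (fun t ht => hm.trans_le (hxm t ht)) fun t ht => ?_
  have := hU.mono (show m ∈ Ioi 0 from hm) (hm.trans_le (hxm t (le_of_lt ht))) (hxm t (le_of_lt ht))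
  gcongr

lemma payoff_eq (hρ : 0 < ρ) (hU₁ : ConsumptionUtility U₁)
    (hc : LocallyIntegrableOn c (Ici 0)) (hc0 : ∀ t, 0 ≤ t → 0 ≤ c t)
    (hfin : HasFinitePayoff ρ U₂ x) :
    payoff ρ U₁ U₂ c x = ((realPayoff ρ U₁ U₂ c x : ℝ) : EReal) := by
  have h1 := hU₁.integrableOn hρ hc hc0
  have e : (fun t => Real.exp (-ρ * t) * (U₁ (c t) + U₂ (x t))) =
      fun t => Real.exp (-ρ * t) * U₁ (c t) + Real.exp (-ρ * t) * U₂ (x t) := by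
    funext t; ring
  have h2 : IntegrableOn (fun t => Real.exp (-ρ * t) * U₁ (c t) + Real.exp (-ρ * t) * U₂ (x t))
    (Ioi 0) := h1.add hfin
  rw [payoff, e, extIntegral_of_integrable h2, realPayoff, integral_add h1 hfin]

lemma payoff_eq_bot (hρ : 0 < ρ) (hU₁ : ConsumptionUtility U₁) (hU₂ : NonposUtility U₂)
    (hc : LocallyIntegrableOn c (Ici 0)) (hc0 : ∀ t, 0 ≤ t → 0 ≤ c t)
    (hx : ContinuousOn x (Ici 0)) (hx0 : ∀ t, 0 ≤ t → 0 < x t)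
    (hfin : ¬ HasFinitePayoff ρ U₂ x) : payoff ρ U₁ U₂ c x = ⊥ := by
  have h1 := hU₁.integrableOn hρ hc hc0
  have e : (fun t => Real.exp (-ρ * t) * (U₁ (c t) + U₂ (x t))) =
      fun t => Real.exp (-ρ * t) * U₁ (c t) + Real.exp (-ρ * t) * U₂ (x t) := by
    funext t; ring
  rw [payoff, e]
  refine extIntegral_of_not_integrable (h1.aestronglyMeasurable.add
    (hU₂.aestronglyMeasurable hx hx0)) h1 (fun t ht => ?_) fun hi => hfin ?_
  · have := mul_nonpos_of_nonneg_of_nonpos (Real.exp_pos (-ρ * t)).le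
      (hU₂.nonpos _ (hx0 t (le_of_lt ht)))
    linarith
  · exact (hi.sub h1).congr (ae_of_all _ fun t => by simp)

end Payoff

/-- The standing assumptions on a control problem with delay operator `D`. -/
structure IsControlProblem (T A C ρ : ℝ) (f : ℝ → ℝ → ℝ) (D : (ℝ → ℝ) → ℝ → ℝ)
    (U₁ U₂ : ℝ → ℝ) : Prop where
  discount_pos : 0 < ρ
  production : RegularProduction f C
  delay : IsDelayOp T A D
  consumption : ConsumptionUtility U₁
  state : NonposUtility U₂

/-- The value function as a real number. -/
noncomputable def realValue (T ρ : ℝ) (f : ℝ → ℝ → ℝ) (U₁ U₂ : ℝ → ℝ) (D : (ℝ → ℝ) → ℝ → ℝ)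
    (η₀ : ℝ) (η₁ : ℝ → ℝ) : ℝ := (value T ρ f U₁ U₂ D η₀ η₁).toReal

/-! ### The value function is finite. -/

section Value

variable {T A C ρ : ℝ} {f : ℝ → ℝ → ℝ} {D : (ℝ → ℝ) → ℝ → ℝ} {U₁ U₂ : ℝ → ℝ}
  {η₀ : ℝ} {η₁ c x : ℝ → ℝ}

lemma integral_discount_mul_le {g : ℝ → ℝ} (hρ : 0 < ρ) {B a : ℝ}
    (hg : IntegrableOn (fun t => Real.exp (-ρ * t) * g t) (Ioi a)) (hB : ∀ t, a < t → g t ≤ B) :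
    ∫ t in Ioi a, Real.exp (-ρ * t) * g t ≤ Real.exp (-ρ * a) * B / ρ := by
  have h1 : IntegrableOn (fun t => Real.exp (-ρ * t) * B) (Ioi a) :=
    (integrableOn_discount hρ a).mul_const B
  have h2 := setIntegral_mono_on hg h1 measurableSet_Ioi fun t ht =>
    mul_le_mul_of_nonneg_left (hB t ht) (Real.exp_pos (-ρ * t)).le
  rw [integral_mul_const, integral_discount hρ] at h2
  calc _ ≤ _ := h2
    _ = _ := by ring

lemma le_integral_discount_mul {g : ℝ → ℝ} (hρ : 0 < ρ) {B a : ℝ}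
    (hg : IntegrableOn (fun t => Real.exp (-ρ * t) * g t) (Ioi a)) (hB : ∀ t, a < t → B ≤ g t) :
    Real.exp (-ρ * a) * B / ρ ≤ ∫ t in Ioi a, Real.exp (-ρ * t) * g t := by
  have h1 : IntegrableOn (fun t => Real.exp (-ρ * t) * B) (Ioi a) :=
    (integrableOn_discount hρ a).mul_const B
  have h2 := setIntegral_mono_on h1 hg measurableSet_Ioi fun t ht =>
    mul_le_mul_of_nonneg_left (hB t ht) (Real.exp_pos (-ρ * t)).le
  rw [integral_mul_const, integral_discount hρ] at h2
  calc _ = _ := by ring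
    _ ≤ _ := h2

lemma IsControlProblem.integrable_consumption (hP : IsControlProblem T A C ρ f D U₁ U₂)
    (h : IsAdmissiblePair T f D η₀ η₁ c x) :
    IntegrableOn (fun t => Real.exp (-ρ * t) * U₁ (c t)) (Ioi 0) :=
  hP.consumption.integrableOn hP.discount_pos h.locallyIntegrable h.control_nonneg

lemma IsControlProblem.payoff_eq (hP : IsControlProblem T A C ρ f D U₁ U₂)
    (h : IsAdmissiblePair T f D η₀ η₁ c x) (hfin : HasFinitePayoff ρ U₂ x) :
    payoff ρ U₁ U₂ c x = ((realPayoff ρ U₁ U₂ c x : ℝ) : EReal) :=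
  DelayControl.payoff_eq hP.discount_pos hP.consumption h.locallyIntegrable h.control_nonneg hfin

lemma IsControlProblem.payoff_eq_bot (hP : IsControlProblem T A C ρ f D U₁ U₂)
    (h : IsAdmissiblePair T f D η₀ η₁ c x) (hfin : ¬ HasFinitePayoff ρ U₂ x) :
    payoff ρ U₁ U₂ c x = ⊥ :=
  DelayControl.payoff_eq_bot hP.discount_pos hP.consumption hP.state h.locallyIntegrable
    h.control_nonneg h.solution.continuousOn h.state_pos hfin

lemma IsControlProblem.state_integral_nonpos (hP : IsControlProblem T A C ρ f D U₁ U₂)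
    (hx0 : ∀ t, 0 ≤ t → 0 < x t) {s : Set ℝ} (hs : s ⊆ Ioi 0) (hsm : MeasurableSet s) :
    ∫ t in s, Real.exp (-ρ * t) * U₂ (x t) ≤ 0 :=
  setIntegral_nonpos hsm fun t ht => mul_nonpos_of_nonneg_of_nonpos (Real.exp_pos _).le
    (hP.state.nonpos _ (hx0 t (le_of_lt (hs ht))))

lemma IsControlProblem.realPayoff_le (hP : IsControlProblem T A C ρ f D U₁ U₂)
    (h : IsAdmissiblePair T f D η₀ η₁ c x) {B : ℝ} (hB : ∀ u, 0 ≤ u → |U₁ u| ≤ B) :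
    realPayoff ρ U₁ U₂ c x ≤ B / ρ := by
  have h1 := integral_discount_mul_le hP.discount_pos (hP.integrable_consumption h) (B := B)
    fun t ht => (le_abs_self _).trans (hB _ (h.control_nonneg t (le_of_lt ht)))
  have h2 := hP.state_integral_nonpos h.state_pos Subset.rfl measurableSet_Ioi
  simp only [mul_zero, Real.exp_zero, one_mul] at h1
  rw [realPayoff]; linarith

lemma IsControlProblem.exists_free (hP : IsControlProblem T A C ρ f D U₁ U₂)
    (hη : IsHistory T η₁) (η₀ : ℝ) : ∃ x, IsSolution T f D η₀ η₁ (fun _ => 0) x :=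
  exists_solution hP.production hP.delay η₀ hη.integrable
    ((locallyIntegrable_const (0 : ℝ)).locallyIntegrableOn _)

lemma IsControlProblem.free_admissible (hP : IsControlProblem T A C ρ f D U₁ U₂)
    (hη : IsHistory T η₁) (hη₀ : 0 < η₀) (h : IsSolution T f D η₀ η₁ (fun _ => 0) x) :
    IsAdmissiblePair T f D η₀ η₁ (fun _ => 0) x :=
  ⟨(locallyIntegrable_const (0 : ℝ)).locallyIntegrableOn _, fun _ _ => le_rfl, h, fun t ht =>
    hη₀.trans_le (h.ge_initial hP.production hP.delay hη hη₀.le t ht)⟩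

lemma IsControlProblem.payoff_le (hP : IsControlProblem T A C ρ f D U₁ U₂)
    (h : IsAdmissiblePair T f D η₀ η₁ c x) {B : ℝ} (hB : ∀ u, 0 ≤ u → |U₁ u| ≤ B) :
    payoff ρ U₁ U₂ c x ≤ ((B / ρ : ℝ) : EReal) := by
  by_cases hfin : HasFinitePayoff ρ U₂ x
  · rw [hP.payoff_eq h hfin]
    exact EReal.coe_le_coe_iff.2 (hP.realPayoff_le h hB)
  · rw [hP.payoff_eq_bot h hfin]; exact bot_le

lemma IsControlProblem.value_le (hP : IsControlProblem T A C ρ f D U₁ U₂) {B : ℝ}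
    (hB : ∀ u, 0 ≤ u → |U₁ u| ≤ B) : value T ρ f U₁ U₂ D η₀ η₁ ≤ ((B / ρ : ℝ) : EReal) :=
  sSup_le (by rintro _ ⟨c, x, h, rfl⟩; exact hP.payoff_le h hB)

lemma IsControlProblem.le_value (hP : IsControlProblem T A C ρ f D U₁ U₂)
    (hη : IsHistory T η₁) (hη₀ : 0 < η₀) {B : ℝ} (hB : ∀ u, 0 ≤ u → |U₁ u| ≤ B) :
    (((-B + U₂ η₀) / ρ : ℝ) : EReal) ≤ value T ρ f U₁ U₂ D η₀ η₁ := by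
  obtain ⟨x, hx⟩ := hP.exists_free hη η₀
  have hadm := hP.free_admissible hη hη₀ hx
  have hge := hx.ge_initial hP.production hP.delay hη hη₀.le
  have hfin : HasFinitePayoff ρ U₂ x :=
    hP.state.finite_of_bounded_below hP.discount_pos hη₀ hx.continuousOn hge
  refine le_trans ?_ (le_sSup ⟨_, x, hadm, rfl⟩)
  rw [hP.payoff_eq hadm hfin]
  refine EReal.coe_le_coe_iff.2 ?_
  have h1 := le_integral_discount_mul hP.discount_pos (hP.integrable_consumption hadm) (B := -B)
    fun t ht => (abs_le.1 (hB 0 le_rfl)).1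
  have h2 := le_integral_discount_mul hP.discount_pos hfin (B := U₂ η₀)
    fun t ht => hP.state.mono (show η₀ ∈ Ioi 0 from hη₀) (hadm.state_pos t (le_of_lt ht))
      (hge t (le_of_lt ht))
  simp only [mul_zero, Real.exp_zero, one_mul] at h1 h2
  rw [realPayoff, add_div]; linarith

/-- The upper bound comes from U₁ ≤ B and U₂ ≤ 0, the lower one from consuming nothing, which keeps
the state above its initial value. -/
lemma IsControlProblem.value_eq_coe (hP : IsControlProblem T A C ρ f D U₁ U₂)
    (hη : IsHistory T η₁) (hη₀ : 0 < η₀) :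
    value T ρ f U₁ U₂ D η₀ η₁ = ((realValue T ρ f U₁ U₂ D η₀ η₁ : ℝ) : EReal) := by
  obtain ⟨B, hB⟩ := hP.consumption.bounded
  refine (EReal.coe_toReal ?_ ?_).symm
  · exact ne_top_of_le_ne_top (EReal.coe_ne_top _) (hP.value_le hB)
  · exact ne_bot_of_le_ne_bot (EReal.coe_ne_bot _) (hP.le_value hη hη₀ hB)

lemma IsControlProblem.le_realValue (hP : IsControlProblem T A C ρ f D U₁ U₂)
    (hη : IsHistory T η₁) (hη₀ : 0 < η₀) {B : ℝ} (hB : ∀ u, 0 ≤ u → |U₁ u| ≤ B) :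
    (-B + U₂ η₀) / ρ ≤ realValue T ρ f U₁ U₂ D η₀ η₁ := by
  have := hP.le_value hη hη₀ hB
  rw [hP.value_eq_coe hη hη₀] at this
  exact EReal.coe_le_coe_iff.1 this

lemma IsControlProblem.realPayoff_le_realValue (hP : IsControlProblem T A C ρ f D U₁ U₂)
    (hη : IsHistory T η₁) (hη₀ : 0 < η₀) (h : IsAdmissiblePair T f D η₀ η₁ c x)
    (hfin : HasFinitePayoff ρ U₂ x) :
    realPayoff ρ U₁ U₂ c x ≤ realValue T ρ f U₁ U₂ D η₀ η₁ := by
  have : payoff ρ U₁ U₂ c x ≤ value T ρ f U₁ U₂ D η₀ η₁ := le_sSup ⟨c, x, h, rfl⟩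
  rw [hP.value_eq_coe hη hη₀, hP.payoff_eq h hfin] at this
  exact EReal.coe_le_coe_iff.1 this

lemma IsControlProblem.exists_near (hP : IsControlProblem T A C ρ f D U₁ U₂)
    (hη : IsHistory T η₁) (hη₀ : 0 < η₀) {r : ℝ} (hr : r < realValue T ρ f U₁ U₂ D η₀ η₁) :
    ∃ c x, IsAdmissiblePair T f D η₀ η₁ c x ∧ HasFinitePayoff ρ U₂ x ∧
      r < realPayoff ρ U₁ U₂ c x := by
  have : (r : EReal) < value T ρ f U₁ U₂ D η₀ η₁ := by
    rw [hP.value_eq_coe hη hη₀]; exact EReal.coe_lt_coe_iff.2 hr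
  obtain ⟨_, ⟨c, x, h, rfl⟩, hlt⟩ := lt_sSup_iff.1 this
  have hfin : HasFinitePayoff ρ U₂ x := by
    by_contra hfin
    rw [hP.payoff_eq_bot h hfin] at hlt
    exact not_lt_bot hlt
  rw [hP.payoff_eq h hfin] at hlt
  exact ⟨c, x, h, hfin, EReal.coe_lt_coe_iff.1 hlt⟩

/-- `(c, x)` is an admissible pair that attains the value. -/
structure IsOptimalPair (T ρ : ℝ) (f : ℝ → ℝ → ℝ) (U₁ U₂ : ℝ → ℝ) (D : (ℝ → ℝ) → ℝ → ℝ)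
    (η₀ : ℝ) (η₁ c x : ℝ → ℝ) : Prop where
  admissible : IsAdmissiblePair T f D η₀ η₁ c x
  finite : HasFinitePayoff ρ U₂ x
  realPayoff_eq : realPayoff ρ U₁ U₂ c x = realValue T ρ f U₁ U₂ D η₀ η₁

lemma IsControlProblem.isOptimal_iff (hP : IsControlProblem T A C ρ f D U₁ U₂)
    (hη : IsHistory T η₁) (hη₀ : 0 < η₀) :
    IsOptimal T ρ f U₁ U₂ D η₀ η₁ c ↔ ∃ x, IsOptimalPair T ρ f U₁ U₂ D η₀ η₁ c x := by
  constructor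
  · rintro ⟨x, h, heq⟩
    rw [hP.value_eq_coe hη hη₀] at heq
    have hfin : HasFinitePayoff ρ U₂ x := by
      by_contra hfin
      rw [hP.payoff_eq_bot h hfin] at heq
      exact EReal.coe_ne_bot _ heq.symm
    rw [hP.payoff_eq h hfin] at heq
    exact ⟨x, h, hfin, EReal.coe_eq_coe_iff.1 heq⟩
  · rintro ⟨x, h⟩
    refine ⟨x, h.admissible, ?_⟩
    rw [hP.value_eq_coe hη hη₀, hP.payoff_eq h.admissible h.finite, h.realPayoff_eq]

lemma IsControlProblem.isEpsOptimal (hP : IsControlProblem T A C ρ f D U₁ U₂)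
    (hη : IsHistory T η₁) (hη₀ : 0 < η₀) (h : IsAdmissiblePair T f D η₀ η₁ c x)
    (hfin : HasFinitePayoff ρ U₂ x) {ε : ℝ}
    (hlt : realValue T ρ f U₁ U₂ D η₀ η₁ - ε < realPayoff ρ U₁ U₂ c x) :
    IsEpsOptimal T ρ f U₁ U₂ D η₀ η₁ ε c := by
  refine ⟨x, h, ?_⟩
  rw [hP.value_eq_coe hη hη₀, hP.payoff_eq h hfin, ← EReal.coe_sub]
  exact EReal.coe_lt_coe_iff.2 hlt

end Value

/-! ### Marginal utility of consumption. -/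

section ConsumptionUtility

variable {U₁ : ℝ → ℝ}

lemma ConsumptionUtility.hasDerivAt (hU : ConsumptionUtility U₁) {u : ℝ} (hu : 0 < u) :
    HasDerivAt U₁ (deriv U₁ u) u :=
  (((hU.contDiffOn u hu).contDiffAt (Ioi_mem_nhds hu)).differentiableAt (by norm_num)).hasDerivAt

lemma ConsumptionUtility.strictConcaveOn (hU : ConsumptionUtility U₁) :
    StrictConcaveOn ℝ (Ici 0) U₁ :=
  strictConcaveOn_of_deriv2_neg (convex_Ici 0) hU.continuousOn fun u hu => by
    rw [interior_Ici] at hu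
    exact hU.deriv2_neg u hu

lemma ConsumptionUtility.strictAntiOn_deriv (hU : ConsumptionUtility U₁) :
    StrictAntiOn (deriv U₁) (Ioi 0) :=
  strictAntiOn_of_deriv_neg (convex_Ioi 0)
    (hU.contDiffOn.continuousOn_deriv_of_isOpen isOpen_Ioi (by norm_num)) fun u hu => by
      rw [interior_Ioi] at hu
      exact hU.deriv2_neg u hu

lemma ConsumptionUtility.continuousOn_deriv (hU : ConsumptionUtility U₁) :
    ContinuousOn (deriv U₁) (Ioi 0) :=
  hU.contDiffOn.continuousOn_deriv_of_isOpen isOpen_Ioi (by norm_num)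

lemma ConsumptionUtility.le_tangent (hU : ConsumptionUtility U₁) {u v : ℝ} (hu : 0 < u)
    (hv : 0 ≤ v) : U₁ v ≤ U₁ u + deriv U₁ u * (v - u) := by
  have hc := hU.strictConcaveOn.concaveOn
  rcases lt_trichotomy v u with h | h | h
  · have := hc.le_slope_of_hasDerivAt (mem_Ici.2 hv) (mem_Ici.2 hu.le) h (hU.hasDerivAt hu)
    rw [slope_def_field, le_div_iff₀ (by linarith)] at this
    linarith
  · subst h; simp
  · have := hc.slope_le_of_hasDerivAt (mem_Ici.2 hu.le) (mem_Ici.2 hv) h (hU.hasDerivAt hu)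
    rw [slope_def_field, div_le_iff₀ (by linarith)] at this
    linarith

/-- The tangent at N evaluated at 0 gives N * U₁'(N) ≤ 2B, so boundedness of U₁ forces the marginal
utility to become small. -/
lemma ConsumptionUtility.exists_deriv_lt (hU : ConsumptionUtility U₁) {ε : ℝ} (hε : 0 < ε) :
    ∃ N, 0 < N ∧ deriv U₁ N < ε := by
  obtain ⟨B, hB⟩ := hU.bounded
  have hB0 : 0 ≤ B := (abs_nonneg _).trans (hB 0 le_rfl)
  by_contra! hcon
  have hN : (0 : ℝ) < (2 * B + 1) / ε := by positivity
  have h1 := hU.le_tangent (v := 0) hN le_rfl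
  have h2 := mul_le_mul_of_nonneg_right (hcon _ hN) hN.le
  have h3 : ε * ((2 * B + 1) / ε) = 2 * B + 1 := by field_simp
  have h4 := (abs_le.1 (hB 0 le_rfl)).1
  have h5 := (abs_le.1 (hB _ hN.le)).2
  rw [h3] at h2
  linarith

/-- Intermediate values: the marginal utility is infinite at 0⁺ and arbitrarily small far out. This
provides the maximiser of U₁(u) - p u. -/
lemma ConsumptionUtility.exists_deriv_eq (hU : ConsumptionUtility U₁) {p : ℝ} (hp : 0 < p) :
    ∃ u, 0 < u ∧ deriv U₁ u = p := by
  obtain ⟨N, hN, hNp⟩ := hU.exists_deriv_lt hp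
  have h0 : ∀ᶠ u in 𝓝[>] (0 : ℝ), p < deriv U₁ u ∧ u < N ∧ 0 < u :=
    (hU.deriv_zero.eventually_gt_atTop p).and
      (((eventually_lt_nhds hN).filter_mono nhdsWithin_le_nhds).and self_mem_nhdsWithin)
  obtain ⟨a, hpa, haN, ha⟩ := h0.exists
  have := intermediate_value_Icc' haN.le
    (hU.continuousOn_deriv.mono fun u hu => ha.trans_le hu.1) ⟨hNp.le, hpa.le⟩
  obtain ⟨u, hu, hup⟩ := this
  exact ⟨u, ha.trans_le hu.1, hup⟩

lemma ConsumptionUtility.isMaxOn (hU : ConsumptionUtility U₁) {u : ℝ} (hu : 0 < u) :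
    IsMaxOn (fun v => U₁ v - deriv U₁ u * v) (Ici 0) u := by
  intro v hv
  have := hU.le_tangent hu hv
  change U₁ v - deriv U₁ u * v ≤ U₁ u - deriv U₁ u * u
  linarith

end ConsumptionUtility

/-! ### Mixing controls and concavity of the value in the initial capital. -/

section Concavity

variable {T A C ρ : ℝ} {f : ℝ → ℝ → ℝ} {D : (ℝ → ℝ) → ℝ → ℝ} {U₁ U₂ : ℝ → ℝ}
  {η₀ s₁ s₂ : ℝ} {η₁ c x c₁ c₂ x₁ x₂ : ℝ → ℝ}

/-- Convex combinations of controls do at least as well as the convex combination of payoffs. -/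
theorem IsControlProblem.exists_combination (hP : IsControlProblem T A C ρ f D U₁ U₂)
    (hη : IsHistory T η₁) (h₁ : IsAdmissiblePair T f D s₁ η₁ c₁ x₁)
    (h₂ : IsAdmissiblePair T f D s₂ η₁ c₂ x₂) (hf₁ : HasFinitePayoff ρ U₂ x₁)
    (hf₂ : HasFinitePayoff ρ U₂ x₂) {l m : ℝ} (hl : 0 ≤ l) (hm : 0 ≤ m) (hlm : l + m = 1) :
    ∃ x, IsAdmissiblePair T f D (l * s₁ + m * s₂) η₁ (fun t => l * c₁ t + m * c₂ t) x ∧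
      HasFinitePayoff ρ U₂ x ∧
      l * realPayoff ρ U₁ U₂ c₁ x₁ + m * realPayoff ρ U₁ U₂ c₂ x₂ ≤
        realPayoff ρ U₁ U₂ (fun t => l * c₁ t + m * c₂ t) x := by
  have hf := hP.production
  have hD := hP.delay
  have hp₁ := h₁.solution.isPath hη
  have hp₂ := h₂.solution.isPath hη
  have hcl : LocallyIntegrableOn (fun t => l * c₁ t + m * c₂ t) (Ici 0) :=
    locallyIntegrableOn_Ici_of_integrableOn fun S hS =>
      ((h₁.locallyIntegrable.integrableOn_compact_subset Icc_subset_Ici_self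
        isCompact_Icc).const_mul l).add ((h₂.locallyIntegrable.integrableOn_compact_subset
        Icc_subset_Ici_self isCompact_Icc).const_mul m)
  have hc0 : ∀ t, 0 ≤ t → 0 ≤ l * c₁ t + m * c₂ t := fun t ht =>
    add_nonneg (mul_nonneg hl (h₁.control_nonneg t ht)) (mul_nonneg hm (h₂.control_nonneg t ht))
  obtain ⟨x, hx⟩ := exists_solution hf hD (l * s₁ + m * s₂) hη.integrable hcl
  set y : ℝ → ℝ := fun t => l * x₁ t + m * x₂ t with hy
  have hyh : ∀ s ∈ Ico (-T) 0, y s = η₁ s := fun s hs => by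
    simp only [hy]
    rw [h₁.solution.history s hs, h₂.solution.history s hs, ← add_mul, hlm, one_mul]
  have hyp : IsPath T y := isPath_of_eq hη.integrable hyh
    ((h₁.solution.continuousOn.const_smul l).add (h₂.solution.continuousOn.const_smul m))
  have hy0 : ∀ t, 0 ≤ t → 0 < y t := fun t ht => by
    have a1 := h₁.state_pos t ht
    have a2 := h₂.state_pos t ht
    rcases hl.eq_or_lt with rfl | hl'
    · have : m = 1 := by linarith
      simp only [hy, this]; linarith
    · have := mul_pos hl' a1
      have := mul_nonneg hm a2.le
      simp only [hy]; linarith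
  -- By concavity of the production function the mixture of the two states is a subsolution for the
  -- mixed control.
  have hyx : ∀ t, 0 ≤ t → y t ≤ x t := fun t ht => by
    refine hx.ge_of_subsolution hf hD hη hyp hyh (S := t) (fun r hr => ?_) t ⟨ht, le_rfl⟩
    have hi₁ := hp₁.drift_integrable hf hD hr.1
    have hi₂ := hp₂.drift_integrable hf hD hr.1
    have hd : l * (∫ s in (0 : ℝ)..r, f (x₁ s) (D x₁ s)) + m * (∫ s in (0 : ℝ)..r, f (x₂ s) (D x₂ s))
        ≤ ∫ s in (0 : ℝ)..r, f (y s) (D y s) := by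
      rw [← intervalIntegral.integral_const_mul, ← intervalIntegral.integral_const_mul,
        ← intervalIntegral.integral_add (hi₁.const_mul l) (hi₂.const_mul m)]
      refine intervalIntegral.integral_mono_on hr.1 ((hi₁.const_mul l).add (hi₂.const_mul m))
        (hyp.drift_integrable hf hD hr.1) fun s hs => ?_
      have hm₁ : ((x₁ s, D x₁ s) : ℝ × ℝ) ∈ Ici (0 : ℝ) ×ˢ (univ : Set ℝ) :=
        ⟨(h₁.state_pos s hs.1).le, mem_univ _⟩
      have hm₂ : ((x₂ s, D x₂ s) : ℝ × ℝ) ∈ Ici (0 : ℝ) ×ˢ (univ : Set ℝ) :=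
        ⟨(h₂.state_pos s hs.1).le, mem_univ _⟩
      have := hf.concave.2 hm₁ hm₂ hl hm hlm
      simp only [smul_eq_mul, Prod.smul_mk, Prod.mk_add_mk] at this
      rw [show D y s = l * D x₁ s + m * D x₂ s from hD.combo x₁ x₂ hp₁ hp₂ l m s hs.1]
      exact this
    have hcs : ∫ s in (0 : ℝ)..r, (l * c₁ s + m * c₂ s) =
        l * (∫ s in (0 : ℝ)..r, c₁ s) + m * ∫ s in (0 : ℝ)..r, c₂ s := by
      rw [intervalIntegral.integral_add
        ((intervalIntegrable_of_locallyIntegrableOn_Ici h₁.locallyIntegrable le_rfl hr.1).const_mul l)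
        ((intervalIntegrable_of_locallyIntegrableOn_Ici h₂.locallyIntegrable le_rfl hr.1).const_mul m),
        intervalIntegral.integral_const_mul, intervalIntegral.integral_const_mul]
    rw [hcs]
    simp only [hy]
    rw [h₁.solution.integral_eq r hr.1, h₂.solution.integral_eq r hr.1]
    simp only [hy] at hd
    linarith
  have hx0 : ∀ t, 0 ≤ t → 0 < x t := fun t ht => (hy0 t ht).trans_le (hyx t ht)
  have hadm : IsAdmissiblePair T f D (l * s₁ + m * s₂) η₁ (fun t => l * c₁ t + m * c₂ t) x :=
    ⟨hcl, hc0, hx, hx0⟩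
  have hle : ∀ t ∈ Ioi (0 : ℝ), l * (Real.exp (-ρ * t) * U₂ (x₁ t)) +
      m * (Real.exp (-ρ * t) * U₂ (x₂ t)) ≤ Real.exp (-ρ * t) * U₂ (x t) := by
    intro t ht
    have ht0 := le_of_lt (mem_Ioi.1 ht)
    have a1 := hP.state.concave.2 (mem_Ioi.2 (h₁.state_pos t ht0))
      (mem_Ioi.2 (h₂.state_pos t ht0)) hl hm hlm
    have a2 := hP.state.mono (mem_Ioi.2 (hy0 t ht0)) (mem_Ioi.2 (hx0 t ht0)) (hyx t ht0)
    simp only [smul_eq_mul] at a1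
    have := mul_le_mul_of_nonneg_left (a1.trans a2) (Real.exp_pos (-ρ * t)).le
    linarith
  have hi : IntegrableOn (fun t => l * (Real.exp (-ρ * t) * U₂ (x₁ t)) +
      m * (Real.exp (-ρ * t) * U₂ (x₂ t))) (Ioi 0) := (hf₁.const_mul l).add (hf₂.const_mul m)
  have hfin : HasFinitePayoff ρ U₂ x :=
    hP.state.finite_of_le hi hx.continuousOn hx0 hle
  refine ⟨x, hadm, hfin, ?_⟩
  have b1 := setIntegral_mono_on hi hfin measurableSet_Ioi hle
  have hi₁ := hP.integrable_consumption h₁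
  have hi₂ := hP.integrable_consumption h₂
  have b2 := setIntegral_mono_on ((hi₁.const_mul l).add (hi₂.const_mul m))
    (hP.integrable_consumption hadm) measurableSet_Ioi fun t ht => by
      have ht0 := le_of_lt (mem_Ioi.1 ht)
      have a1 := hP.consumption.strictConcaveOn.concaveOn.2 (mem_Ici.2 (h₁.control_nonneg t ht0))
        (mem_Ici.2 (h₂.control_nonneg t ht0)) hl hm hlm
      simp only [smul_eq_mul] at a1
      have := mul_le_mul_of_nonneg_left a1 (Real.exp_pos (-ρ * t)).le
      simp only [Pi.add_apply]
      linarith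
  rw [integral_add (hf₁.const_mul l) (hf₂.const_mul m), integral_const_mul, integral_const_mul]
    at b1
  rw [integral_add' (hi₁.const_mul l) (hi₂.const_mul m), integral_const_mul, integral_const_mul]
    at b2
  simp only [realPayoff]
  linarith

theorem IsControlProblem.concaveOn_realValue (hP : IsControlProblem T A C ρ f D U₁ U₂)
    (hη : IsHistory T η₁) : ConcaveOn ℝ (Ioi 0) (fun s => realValue T ρ f U₁ U₂ D s η₁) := by
  refine ⟨convex_Ioi 0, fun s₁ hs₁ s₂ hs₂ l m hl hm hlm => ?_⟩
  have hs : 0 < l * s₁ + m * s₂ := (convex_Ioi (0 : ℝ)) hs₁ hs₂ hl hm hlm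
  simp only [smul_eq_mul]
  refine le_of_forall_pos_le_add fun ε hε => ?_
  obtain ⟨c₁, x₁, h₁, hf₁, hlt₁⟩ := hP.exists_near hη hs₁
    (sub_lt_self (realValue T ρ f U₁ U₂ D s₁ η₁) hε)
  obtain ⟨c₂, x₂, h₂, hf₂, hlt₂⟩ := hP.exists_near hη hs₂
    (sub_lt_self (realValue T ρ f U₁ U₂ D s₂ η₁) hε)
  obtain ⟨x, h, hfin, hge⟩ := hP.exists_combination hη h₁ h₂ hf₁ hf₂ hl hm hlm
  have := hP.realPayoff_le_realValue hη hs h hfin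
  have e1 := mul_le_mul_of_nonneg_left hlt₁.le hl
  have e2 := mul_le_mul_of_nonneg_left hlt₂.le hm
  have e3 : l * ε + m * ε = ε := by rw [← add_mul, hlm, one_mul]
  linarith

end Concavity

/-! ### Shifting and concatenating controls; the dynamic programming principle. -/

section DynamicProgramming

variable {T A C ρ : ℝ} {f : ℝ → ℝ → ℝ} {D : (ℝ → ℝ) → ℝ → ℝ} {U₁ U₂ : ℝ → ℝ}
  {η₀ : ℝ} {η₁ c x c' x' : ℝ → ℝ}

lemma preimage_shift (r : ℝ) : (fun t => r + t) ⁻¹' Ioi r = Ioi 0 := by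
  ext t; simp

lemma integrableOn_shift {g : ℝ → ℝ} (r : ℝ) :
    IntegrableOn (fun t => g (r + t)) (Ioi 0) ↔ IntegrableOn g (Ioi r) := by
  have := (measurePreserving_add_left volume r).integrableOn_comp_preimage
    (measurableEmbedding_addLeft r) (f := g) (s := Ioi r)
  rw [preimage_shift] at this
  exact this

lemma integral_shift {g : ℝ → ℝ} (r : ℝ) :
    ∫ t in Ioi 0, g (r + t) = ∫ t in Ioi r, g t := by
  have := (measurePreserving_add_left volume r).setIntegral_preimage_emb
    (measurableEmbedding_addLeft r) g (Ioi r)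
  rw [preimage_shift] at this
  exact this

lemma integral_Ioi_split {g : ℝ → ℝ} {r : ℝ} (hr : 0 ≤ r) (hg : IntegrableOn g (Ioi 0)) :
    ∫ t in Ioi 0, g t = (∫ t in Ioc 0 r, g t) + ∫ t in Ioi 0, g (r + t) := by
  rw [integral_shift, ← Ioc_union_Ioi_eq_Ioi hr, setIntegral_union (by simp) measurableSet_Ioi]
  · exact hg.mono_set Ioc_subset_Ioi_self
  · exact hg.mono_set (Ioi_subset_Ioi hr)

lemma exp_shift (r t : ℝ) : Real.exp (-ρ * (r + t)) = Real.exp (-ρ * r) * Real.exp (-ρ * t) := by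
  rw [← Real.exp_add]; ring_nf

lemma HasFinitePayoff.shift (h : HasFinitePayoff ρ U₂ x) {r : ℝ} (hr : 0 ≤ r) :
    HasFinitePayoff ρ U₂ (fun t => x (r + t)) := by
  have h1 : IntegrableOn (fun t => Real.exp (-ρ * t) * U₂ (x t)) (Ioi r) :=
    IntegrableOn.mono_set h (Ioi_subset_Ioi hr)
  rw [← integrableOn_shift] at h1
  refine (h1.const_mul (Real.exp (-ρ * r))⁻¹).congr (ae_of_all _ fun t => ?_)
  simp only [exp_shift]
  have := Real.exp_ne_zero (-ρ * r)
  field_simp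

lemma integral_discount_shift (g : ℝ → ℝ) (r : ℝ) :
    ∫ t in Ioi 0, Real.exp (-ρ * (r + t)) * g (r + t) =
      Real.exp (-ρ * r) * ∫ t in Ioi 0, Real.exp (-ρ * t) * g (r + t) := by
  rw [← integral_const_mul]
  congr 1; funext t
  rw [exp_shift]; ring

lemma IsAdmissiblePair.history_shift (hT : 0 < T) (hη : IsHistory T η₁)
    (h : IsAdmissiblePair T f D η₀ η₁ c x) {r : ℝ} (hr : 0 ≤ r) :
    IsHistory T (fun s => x (r + s)) := by
  have hx1 : IntegrableOn x (Ico (-T) r) := by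
    rw [← Ico_union_Ico_eq_Ico (show -T ≤ 0 by linarith) hr]
    exact (h.solution.isPath hη).history.union
      (((h.solution.continuousOn.mono Icc_subset_Ici_self).integrableOn_Icc (a := 0)
        (b := r)).mono_set Ico_subset_Icc_self)
  have hx2 : ∀ᵐ s ∂(volume.restrict (Ico (-T) r)), 0 ≤ x s := by
    rw [← Ico_union_Ico_eq_Ico (show -T ≤ 0 by linarith) hr, ae_restrict_union_iff]
    refine ⟨(h.solution.isHistory hη).nonneg, ?_⟩
    filter_upwards [ae_restrict_mem measurableSet_Ico] with s hs
    exact (h.state_pos s hs.1).le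
  have hpre : (fun s => r + s) ⁻¹' Ico (r - T) r = Ico (-T) 0 := by
    ext s; simp only [mem_preimage, mem_Ico]; constructor <;> rintro ⟨h1, h2⟩ <;> constructor <;> linarith
  have hsub : Ico (r - T) r ⊆ Ico (-T) r := Ico_subset_Ico_left (by linarith)
  have hmp := measurePreserving_add_left (volume : Measure ℝ) r
  constructor
  · have := hmp.integrableOn_comp_preimage (measurableEmbedding_addLeft r) (f := x)
      (s := Ico (r - T) r)
    rw [hpre] at this
    exact this.2 (hx1.mono_set hsub)
  · have h3 := ae_restrict_of_ae_restrict_of_subset hsub hx2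
    have h4 := hmp.restrict_preimage (measurableSet_Ico (a := r - T) (b := r))
    rw [hpre] at h4
    exact h4.quasiMeasurePreserving.ae h3

lemma IsAdmissiblePair.shift (hP : IsControlProblem T A C ρ f D U₁ U₂) (hη : IsHistory T η₁)
    (h : IsAdmissiblePair T f D η₀ η₁ c x) {r : ℝ} (hr : 0 ≤ r) :
    IsAdmissiblePair T f D (x r) (fun s => x (r + s)) (fun t => c (r + t)) (fun t => x (r + t)) where
  locallyIntegrable := locallyIntegrableOn_Ici_of_integrableOn fun S hS => by
    have h1 := (intervalIntegrable_of_locallyIntegrableOn_Ici h.locallyIntegrable hr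
      (add_nonneg hr hS)).comp_add_left r
    simp only [sub_self, add_sub_cancel_left] at h1
    rwa [intervalIntegrable_iff', uIcc_of_le hS] at h1
  control_nonneg t ht := h.control_nonneg _ (add_nonneg hr ht)
  state_pos t ht := h.state_pos _ (add_nonneg hr ht)
  solution :=
    { history := fun _ _ => rfl
      continuousOn := h.solution.continuousOn.comp (by fun_prop) fun t ht => add_nonneg hr ht
      integral_eq := fun t ht => by
        have hp := h.solution.isPath hη
        have h1 := h.solution.integral_eq (r + t) (add_nonneg hr ht)
        have h2 := h.solution.integral_eq r hr
        rw [← intervalIntegral.integral_add_adjacent_intervals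
          (hp.drift_integrable hP.production hP.delay hr)
          (hp.drift_integrable' hP.production hP.delay hr (add_nonneg hr ht)),
          ← intervalIntegral.integral_add_adjacent_intervals (a := 0) (b := r) (c := r + t) (f := c)
          (intervalIntegrable_of_locallyIntegrableOn_Ici h.locallyIntegrable le_rfl hr)
          (intervalIntegrable_of_locallyIntegrableOn_Ici h.locallyIntegrable hr
            (add_nonneg hr ht))] at h1
        have e1 := intervalIntegral.integral_comp_add_left (fun s => f (x s) (D x s)) r
          (a := 0) (b := t)
        have e2 := intervalIntegral.integral_comp_add_left c r (a := 0) (b := t)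
        rw [add_zero] at e1 e2
        simp only [hP.delay.shift]
        rw [e1, e2]
        linarith }

/-- Following `(c, x)` up to time `r` and then `(c', x')`. -/
lemma IsAdmissiblePair.concat (hP : IsControlProblem T A C ρ f D U₁ U₂) (hT : 0 < T)
    (hη : IsHistory T η₁) (h : IsAdmissiblePair T f D η₀ η₁ c x) {r : ℝ} (hr : 0 ≤ r)
    (h' : IsAdmissiblePair T f D (x r) (fun s => x (r + s)) c' x') :
    IsAdmissiblePair T f D η₀ η₁ (fun t => if t ≤ r then c t else c' (t - r))
      (fun t => if t ≤ r then x t else x' (t - r)) := by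
  set c'' : ℝ → ℝ := fun t => if t ≤ r then c t else c' (t - r) with hc''
  set x'' : ℝ → ℝ := fun t => if t ≤ r then x t else x' (t - r) with hx''
  have hcle : ∀ t, t ≤ r → c'' t = c t := fun t ht => by simp [hc'', ht]
  have hcge : ∀ t, r < t → c'' t = c' (t - r) := fun t ht => by simp [hc'', not_le.2 ht]
  have hxle : ∀ t, t ≤ r → x'' t = x t := fun t ht => by simp [hx'', ht]
  have hxge : ∀ t, r ≤ t → x'' t = x' (t - r) := fun t ht => by
    rcases ht.eq_or_lt with rfl | ht
    · rw [hxle _ le_rfl, sub_self, h'.solution.apply_zero]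
    · simp [hx'', not_le.2 ht]
  have hη' := h.history_shift hT hη hr
  have hp := h.solution.isPath hη
  have hp' := h'.solution.isPath hη'
  have hDle : ∀ t, t ≤ r → D x'' t = D x t := fun t ht =>
    hP.delay.congr _ _ _ fun s hs => hxle s (hs.2.trans ht)
  have hDge : ∀ t, r ≤ t → D x'' t = D x' (t - r) := fun t ht => by
    have e1 := hP.delay.shift x'' r (t - r)
    rw [add_sub_cancel] at e1
    rw [← e1]
    refine hP.delay.congr _ _ _ fun s hs => ?_
    rcases lt_or_ge s 0 with hs0 | hs0
    · rw [hxle _ (by linarith), h'.solution.history s ⟨by linarith [hs.1], hs0⟩]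
    · rw [hxge _ (by linarith), add_sub_cancel_left]
  have hci : ∀ t, 0 ≤ t → IntervalIntegrable c volume 0 t := fun t ht =>
    intervalIntegrable_of_locallyIntegrableOn_Ici h.locallyIntegrable le_rfl ht
  have hci' : ∀ t, r ≤ t → IntervalIntegrable (fun s => c' (s - r)) volume r t := fun t ht => by
    have := (intervalIntegrable_of_locallyIntegrableOn_Ici h'.locallyIntegrable le_rfl
      (sub_nonneg.2 ht)).comp_sub_right r
    simpa using this
  have hcint1 : ∀ t, 0 ≤ t → t ≤ r → IntervalIntegrable c'' volume 0 t := fun t ht htr =>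
    (hci t ht).congr (fun s hs => by
      rw [uIoc_of_le ht] at hs; exact (hcle s (hs.2.trans htr)).symm)
  have hcint2 : ∀ t, r ≤ t → IntervalIntegrable c'' volume r t := fun t ht =>
    (hci' t ht).congr (fun s hs => by
      rw [uIoc_of_le ht] at hs; exact (hcge s hs.1).symm)
  have hcint : ∀ t, 0 ≤ t → IntervalIntegrable c'' volume 0 t := fun t ht => by
    rcases le_total t r with htr | htr
    · exact hcint1 t ht htr
    · exact (hcint1 r hr le_rfl).trans (hcint2 t htr)
  have hxc : ContinuousOn x'' (Ici 0) := by
    refine ContinuousOn.congr (f := fun t => x (min t r) + x' (max (t - r) 0) - x r) ?_ ?_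
    · refine ((h.solution.continuousOn.comp (by fun_prop) fun t ht => le_min ht hr).add
        (h'.solution.continuousOn.comp (by fun_prop) fun t _ => le_max_right (t - r) 0)).sub
        continuousOn_const
    · intro t ht
      rcases le_total t r with htr | htr
      · simp only
        rw [hxle t htr, min_eq_left htr, max_eq_right (by linarith), h'.solution.apply_zero]; ring
      · simp only
        rw [hxge t htr, min_eq_right htr, max_eq_left (by linarith)]; ring
  refine ⟨locallyIntegrableOn_Ici_of_integrableOn fun S hS => ?_, fun t ht => ?_, ⟨?_, hxc, ?_⟩, ?_⟩
  · have := hcint S hS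
    rwa [intervalIntegrable_iff', uIcc_of_le hS] at this
  · rcases le_or_gt t r with htr | htr
    · rw [hcle t htr]; exact h.control_nonneg t ht
    · rw [hcge t htr]; exact h'.control_nonneg _ (by linarith)
  · intro s hs
    rw [hxle s (hs.2.le.trans hr)]; exact h.solution.history s hs
  · have key1 : ∀ t, 0 ≤ t → t ≤ r → ∫ s in (0 : ℝ)..t, f (x'' s) (D x'' s) =
        ∫ s in (0 : ℝ)..t, f (x s) (D x s) := fun t ht htr =>
      intervalIntegral.integral_congr fun s hs => by
        rw [uIcc_of_le ht] at hs
        rw [hxle s (hs.2.trans htr), hDle s (hs.2.trans htr)]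
    have key2 : ∀ t, 0 ≤ t → t ≤ r → ∫ s in (0 : ℝ)..t, c'' s = ∫ s in (0 : ℝ)..t, c s :=
      fun t ht htr => intervalIntegral.integral_congr fun s hs => by
        rw [uIcc_of_le ht] at hs
        exact hcle s (hs.2.trans htr)
    intro t ht
    rcases le_total t r with htr | htr
    · rw [hxle t htr, key1 t ht htr, key2 t ht htr]
      exact h.solution.integral_eq t ht
    · have hxp : IsPath T x'' := isPath_of_eq hη.integrable
        (fun s hs => (hxle s (hs.2.le.trans hr)).trans (h.solution.history s hs)) hxc
      rw [hxge t htr, ← intervalIntegral.integral_add_adjacent_intervals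
        (hxp.drift_integrable hP.production hP.delay hr)
        (hxp.drift_integrable' hP.production hP.delay hr ht),
        ← intervalIntegral.integral_add_adjacent_intervals (hcint1 r hr le_rfl) (hcint2 t htr),
        key1 r hr le_rfl, key2 r hr le_rfl, h'.solution.integral_eq _ (sub_nonneg.2 htr),
        h.solution.integral_eq r hr]
      have e1 : ∫ s in r..t, f (x'' s) (D x'' s) =
          ∫ s in (0 : ℝ)..(t - r), f (x' s) (D x' s) := by
        have := intervalIntegral.integral_comp_sub_right (fun s => f (x' s) (D x' s)) r
          (a := r) (b := t)
        rw [sub_self] at this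
        rw [← this]
        refine intervalIntegral.integral_congr fun s hs => ?_
        rw [uIcc_of_le htr] at hs
        rw [hxge s hs.1, hDge s hs.1]
      have e2 : ∫ s in r..t, c'' s = ∫ s in (0 : ℝ)..(t - r), c' s := by
        have := intervalIntegral.integral_comp_sub_right c' r (a := r) (b := t)
        rw [sub_self] at this
        rw [← this]
        refine intervalIntegral.integral_congr_ae (ae_of_all _ fun s hs => ?_)
        rw [uIoc_of_le htr] at hs
        exact hcge s hs.1
      rw [e1, e2]; ring
  · intro t ht
    rcases le_total t r with htr | htr
    · rw [hxle t htr]; exact h.state_pos t ht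
    · rw [hxge t htr]; exact h'.state_pos _ (sub_nonneg.2 htr)

lemma realPayoff_split (hP : IsControlProblem T A C ρ f D U₁ U₂)
    (h : IsAdmissiblePair T f D η₀ η₁ c x) (hfin : HasFinitePayoff ρ U₂ x) {r : ℝ} (hr : 0 ≤ r) :
    realPayoff ρ U₁ U₂ c x = (∫ t in Ioc 0 r, Real.exp (-ρ * t) * U₁ (c t)) +
      (∫ t in Ioc 0 r, Real.exp (-ρ * t) * U₂ (x t)) +
      Real.exp (-ρ * r) * realPayoff ρ U₁ U₂ (fun t => c (r + t)) (fun t => x (r + t)) := by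
  rw [realPayoff, integral_Ioi_split hr (hP.integrable_consumption h), integral_Ioi_split hr hfin,
    integral_discount_shift (fun t => U₁ (c t)), integral_discount_shift (fun t => U₂ (x t)),
    realPayoff]
  ring

/-- Dynamic programming: tails of optimal pairs are optimal. -/
theorem IsOptimalPair.shift (hP : IsControlProblem T A C ρ f D U₁ U₂) (hT : 0 < T)
    (hη : IsHistory T η₁) (hη₀ : 0 < η₀) (h : IsOptimalPair T ρ f U₁ U₂ D η₀ η₁ c x) {r : ℝ}
    (hr : 0 ≤ r) :
    IsOptimalPair T ρ f U₁ U₂ D (x r) (fun s => x (r + s)) (fun t => c (r + t))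
      (fun t => x (r + t)) := by
  have hadm := h.admissible.shift hP hη hr
  have hη' := h.admissible.history_shift hT hη hr
  have hxr := h.admissible.state_pos r hr
  refine ⟨hadm, h.finite.shift hr, le_antisymm
    (hP.realPayoff_le_realValue hη' hxr hadm (h.finite.shift hr)) ?_⟩
  -- A continuation better than the tail, attached to the optimal pair at time r, cannot beat the
  -- optimum; cancelling the common payoff on [0,r] and the factor exp(-ρ r) gives the claim.
  refine le_of_forall_lt fun v hv => ?_
  obtain ⟨c', x', h', hfin', hlt⟩ := hP.exists_near hη' hxr hv
  refine hlt.trans_le ?_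
  have hcon := h.admissible.concat hP hT hη hr h'
  have e1 : ∀ t ∈ Ioi (0 : ℝ), (if r + t ≤ r then x (r + t) else x' (r + t - r)) = x' t := by
    intro t ht
    rw [if_neg (by have := mem_Ioi.1 ht; linarith), add_sub_cancel_left]
  have e2 : ∀ t ∈ Ioi (0 : ℝ), (if r + t ≤ r then c (r + t) else c' (r + t - r)) = c' t := by
    intro t ht
    rw [if_neg (by have := mem_Ioi.1 ht; linarith), add_sub_cancel_left]
  have hfin : HasFinitePayoff ρ U₂ (fun t => if t ≤ r then x t else x' (t - r)) := by
    rw [HasFinitePayoff, ← Ioc_union_Ioi_eq_Ioi hr, integrableOn_union]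
    constructor
    · refine (IntegrableOn.mono_set h.finite Ioc_subset_Ioi_self).congr_fun (fun t ht => ?_)
        measurableSet_Ioc
      simp only
      rw [if_pos ht.2]
    · rw [← integrableOn_shift]
      refine (hfin'.const_mul (Real.exp (-ρ * r))).congr ?_
      filter_upwards [ae_restrict_mem measurableSet_Ioi] with t ht
      rw [e1 t ht, exp_shift]; ring
  have hle := hP.realPayoff_le_realValue hη hη₀ hcon hfin
  rw [← h.realPayoff_eq, realPayoff_split hP hcon hfin hr,
    realPayoff_split hP h.admissible h.finite hr] at hle
  have i1 : ∫ t in Ioc 0 r, Real.exp (-ρ * t) * U₁ (if t ≤ r then c t else c' (t - r)) =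
      ∫ t in Ioc 0 r, Real.exp (-ρ * t) * U₁ (c t) :=
    setIntegral_congr_fun measurableSet_Ioc fun t ht => by rw [if_pos ht.2]
  have i2 : ∫ t in Ioc 0 r, Real.exp (-ρ * t) * U₂ (if t ≤ r then x t else x' (t - r)) =
      ∫ t in Ioc 0 r, Real.exp (-ρ * t) * U₂ (x t) :=
    setIntegral_congr_fun measurableSet_Ioc fun t ht => by rw [if_pos ht.2]
  have i3 : realPayoff ρ U₁ U₂ (fun t => if r + t ≤ r then c (r + t) else c' (r + t - r))
      (fun t => if r + t ≤ r then x (r + t) else x' (r + t - r)) = realPayoff ρ U₁ U₂ c' x' := by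
    simp only [realPayoff]
    congr 1
    · exact setIntegral_congr_fun measurableSet_Ioi fun t ht => by rw [e2 t ht]
    · exact setIntegral_congr_fun measurableSet_Ioi fun t ht => by rw [e1 t ht]
  rw [i1, i2, i3] at hle
  have := Real.exp_pos (-ρ * r)
  exact le_of_mul_le_mul_left (by linarith) this

end DynamicProgramming

/-! ### Almost everywhere convergent near-minimisers in convex sets. -/

section Compactness

lemma norm_toLp_sub_sq {μ : Measure ℝ} {u v : ℝ → ℝ} (hu : MemLp u 2 μ) (hv : MemLp v 2 μ) :
    ‖hu.toLp u - hv.toLp v‖ ^ 2 = ∫ t, (u t - v t) ^ 2 ∂μ := by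
  rw [← MemLp.toLp_sub, ← real_inner_self_eq_norm_sq, L2.inner_def]
  refine integral_congr_ae ?_
  filter_upwards [(hu.sub hv).coeFn_toLp] with t ht
  rw [ht]
  simp [sq]

lemma exists_ae_tendsto_of_cauchy_sq {μ : Measure ℝ} {F : ℕ → ℝ → ℝ} (hF : ∀ n, MemLp (F n) 2 μ)
    {b : ℕ → ℝ} (hb : Tendsto b atTop (𝓝 0))
    (h : ∀ n m, n ≤ m → ∫ t, (F n t - F m t) ^ 2 ∂μ ≤ b n) :
    ∃ φ : ℕ → ℕ, StrictMono φ ∧ ∃ g : ℝ → ℝ,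
      ∀ᵐ t ∂μ, Tendsto (fun i => F (φ i) t) atTop (𝓝 (g t)) := by
  have hc : CauchySeq (fun n => (hF n).toLp (F n)) := by
    refine cauchySeq_of_le_tendsto_0' (fun n => Real.sqrt (b n)) (fun n m hnm => ?_) ?_
    · rw [dist_eq_norm]
      refine Real.le_sqrt_of_sq_le ?_
      rw [norm_toLp_sub_sq]
      exact h n m hnm
    · have := (Real.continuous_sqrt.tendsto 0).comp hb
      simpa [Function.comp_def] using this
  obtain ⟨G, hG⟩ := cauchySeq_tendsto_of_complete hc
  obtain ⟨φ, hφ, hae⟩ := (tendstoInMeasure_of_tendsto_Lp hG).exists_seq_tendsto_ae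
  refine ⟨φ, hφ, G, ?_⟩
  have hall : ∀ᵐ t ∂μ, ∀ n, (hF n).toLp (F n) t = F n t :=
    ae_all_iff.2 fun n => (hF n).coeFn_toLp
  filter_upwards [hae, hall] with t h1 h2
  simpa [h2] using h1

/-- From a decreasing sequence of midpoint convex sets of nonnegative functions one can choose a
sequence that converges almost everywhere, in the sense that `exp (-u n)` converges. -/
theorem exists_ae_convergent_selection {S : ℕ → Set (ℝ → ℝ)} (hne : ∀ n, (S n).Nonempty)
    (hanti : Antitone S)
    (hmid : ∀ n, ∀ u ∈ S n, ∀ v ∈ S n, (fun t => (1 / 2 : ℝ) * u t + (1 / 2 : ℝ) * v t) ∈ S n)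
    (hmeas : ∀ n, ∀ u ∈ S n, AEStronglyMeasurable u (volume.restrict (Ioi 0)))
    (hnn : ∀ n, ∀ u ∈ S n, ∀ t ∈ Ioi (0 : ℝ), 0 ≤ u t) :
    ∃ u : ℕ → ℝ → ℝ, (∀ n, u n ∈ S n) ∧ ∃ g : ℝ → ℝ,
      ∀ᵐ t ∂(volume.restrict (Ioi 0)), Tendsto (fun n => Real.exp (-(u n t))) atTop (𝓝 (g t)) := by
  set μ : Measure ℝ := volume.restrict (Ioi 0) with hμ
  -- A strictly convex functional that is finite for every nonnegative measurable function; no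
  -- integrability of u is required.
  set Φ : (ℝ → ℝ) → ℝ := fun u => ∫ t, Real.exp (-t) * Real.exp (-(u t)) ∂μ with hΦ
  have hbase : Integrable (fun t : ℝ => Real.exp (-t)) μ := integrableOn_exp_neg_Ioi 0
  have hmE : Continuous fun t : ℝ => Real.exp (-t) := by fun_prop
  have hint : ∀ n, ∀ u ∈ S n, Integrable (fun t => Real.exp (-t) * Real.exp (-(u t))) μ := by
    intro n u hu
    refine hbase.mono' (hmE.aestronglyMeasurable.mul
      (hmE.comp_aestronglyMeasurable (hmeas n u hu))) ?_
    filter_upwards [ae_restrict_mem measurableSet_Ioi] with t ht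
    rw [Real.norm_of_nonneg (by positivity)]
    have : Real.exp (-(u t)) ≤ 1 := Real.exp_le_one_iff.2 (by linarith [hnn n u hu t ht])
    have := Real.exp_pos (-t)
    nlinarith
  have hΦ0 : ∀ u, 0 ≤ Φ u := fun u => integral_nonneg fun t => by positivity
  have hΦ1 : ∀ n, ∀ u ∈ S n, Φ u ≤ ∫ t, Real.exp (-t) ∂μ := by
    intro n u hu
    refine integral_mono_ae (hint n u hu) hbase ?_
    filter_upwards [ae_restrict_mem measurableSet_Ioi] with t ht
    have : Real.exp (-(u t)) ≤ 1 := Real.exp_le_one_iff.2 (by linarith [hnn n u hu t ht])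
    have := Real.exp_pos (-t)
    nlinarith
  set I : ℕ → ℝ := fun n => sInf (Φ '' S n) with hI
  have hbdd : ∀ n, BddBelow (Φ '' S n) := fun n => ⟨0, by rintro _ ⟨u, -, rfl⟩; exact hΦ0 u⟩
  have hIle : ∀ n, ∀ u ∈ S n, I n ≤ Φ u := fun n u hu => csInf_le (hbdd n) ⟨u, hu, rfl⟩
  have hImono : Monotone I := fun n m hnm =>
    csInf_le_csInf (hbdd n) ((hne m).image Φ) (image_mono (hanti hnm))
  have hIbdd : BddAbove (range I) := ⟨∫ t, Real.exp (-t) ∂μ, by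
    rintro _ ⟨n, rfl⟩
    obtain ⟨u, hu⟩ := hne n
    exact (hIle n u hu).trans (hΦ1 n u hu)⟩
  have hItend := tendsto_atTop_ciSup hImono hIbdd
  have hIsup : ∀ n, I n ≤ ⨆ i, I i := fun n => le_ciSup hIbdd n
  have hchoose : ∀ n : ℕ, ∃ u ∈ S n, Φ u < I n + 1 / ((n : ℝ) + 1) := by
    intro n
    obtain ⟨_, ⟨u, hu, rfl⟩, hlt⟩ := exists_lt_of_csInf_lt ((hne n).image Φ)
      (show sInf (Φ '' S n) < I n + 1 / ((n : ℝ) + 1) by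
        have : (0 : ℝ) < 1 / ((n : ℝ) + 1) := by positivity
        simp only [hI]; linarith)
    exact ⟨u, hu, hlt⟩
  choose u huS huΦ using hchoose
  -- Square roots of the integrand of Φ: since the product of two of them is the integrand at the
  -- midpoint, the squared L² distance of F n and F m is Φ(u n) + Φ(u m) - 2 Φ(midpoint).
  set F : ℕ → ℝ → ℝ := fun n t => Real.exp (-t / 2) * Real.exp (-(u n t) / 2) with hF
  have hsq : ∀ n t, F n t ^ 2 = Real.exp (-t) * Real.exp (-(u n t)) := by
    intro n t
    simp only [hF]
    rw [mul_pow, ← Real.exp_nat_mul, ← Real.exp_nat_mul]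
    congr 2 <;> · push_cast; ring
  have hFm : ∀ n, MemLp (F n) 2 μ := by
    intro n
    have hmes : AEStronglyMeasurable (F n) μ :=
      (by fun_prop : Continuous fun t : ℝ => Real.exp (-t / 2)).aestronglyMeasurable.mul
        ((by fun_prop : Continuous fun t : ℝ => Real.exp (-t / 2)).comp_aestronglyMeasurable
          (hmeas n _ (huS n)))
    rw [memLp_two_iff_integrable_sq hmes]
    simp_rw [hsq]
    exact hint n _ (huS n)
  have hcross : ∀ n m t, (F n t - F m t) ^ 2 = Real.exp (-t) * Real.exp (-(u n t)) +
      Real.exp (-t) * Real.exp (-(u m t)) -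
      2 * (Real.exp (-t) * Real.exp (-((1 / 2 : ℝ) * u n t + (1 / 2 : ℝ) * u m t))) := by
    intro n m t
    rw [← hsq n t, ← hsq m t]
    have : Real.exp (-t) * Real.exp (-((1 / 2 : ℝ) * u n t + (1 / 2 : ℝ) * u m t)) =
        F n t * F m t := by
      simp only [hF, ← Real.exp_add]
      congr 1; ring
    rw [this]; ring
  obtain ⟨φ, hφ, G, hG⟩ := exists_ae_tendsto_of_cauchy_sq hFm
    -- For n ≤ m the midpoint lies in S n, so Φ there is at least I n, while Φ(u n) and Φ(u m)
    -- exceed I n and I m ≤ sup I by at most 1/(n+1).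
    (b := fun n => ((⨆ i, I i) - I n) + 2 * (1 / ((n : ℝ) + 1))) (by
      have h1 := (tendsto_const_nhds (x := ⨆ i, I i)).sub hItend
      have h2 := (tendsto_one_div_add_atTop_nhds_zero_nat (𝕜 := ℝ)).const_mul 2
      simpa using h1.add h2) (fun n m hnm => by
      have hum := hanti hnm (huS m)
      have hmidS := hmid n _ (huS n) _ hum
      have hi : Integrable (fun t => Real.exp (-t) * Real.exp (-(u n t)) +
        Real.exp (-t) * Real.exp (-(u m t))) μ := (hint n _ (huS n)).add (hint n _ hum)
      simp_rw [hcross]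
      rw [integral_sub hi ((hint n _ hmidS).const_mul 2),
        integral_add (hint n _ (huS n)) (hint n _ hum), integral_const_mul]
      have h1 := huΦ n
      have h2 := huΦ m
      have h3 := hIle n _ hmidS
      have h4 := hIsup m
      have h5 : 1 / ((m : ℝ) + 1) ≤ 1 / ((n : ℝ) + 1) := by
        apply one_div_le_one_div_of_le (by positivity)
        have : (n : ℝ) ≤ m := by exact_mod_cast hnm
        linarith
      simp only [hΦ] at h1 h2 h3
      linarith)
  refine ⟨fun n => u (φ n), fun n => hanti (hφ.id_le n) (huS _), fun t => Real.exp t * G t ^ 2, ?_⟩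
  filter_upwards [hG] with t ht
  have := (ht.pow 2).const_mul (Real.exp t)
  refine this.congr fun n => ?_
  rw [hsq, ← mul_assoc, ← Real.exp_add]
  simp

end Compactness

/-! ### The cost of small states. -/

section Floor

variable {T A C ρ : ℝ} {f : ℝ → ℝ → ℝ} {D : (ℝ → ℝ) → ℝ → ℝ} {U₁ U₂ : ℝ → ℝ}
  {η₀ : ℝ} {η₁ c x : ℝ → ℝ}

/-- A state at level m that changes by at most m in time m / N stays below 2m for that long. The
resulting cost can be made to exceed any K since y U₂(y) → -∞ along y = 2m. -/
lemma exists_singular_floor (hsing : Tendsto (fun x => x * U₂ x) (𝓝[>] 0) atBot) {N r : ℝ}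
    (hN : 0 < N) (hr : 0 < r) (K : ℝ) :
    ∃ m, 0 < m ∧ m / N ≤ r ∧ K < m / N * (-U₂ (2 * m)) := by
  have h1 : Tendsto (fun m : ℝ => 2 * m) (𝓝[>] 0) (𝓝[>] 0) := by
    refine tendsto_nhdsWithin_iff.2 ⟨?_, ?_⟩
    · have : Tendsto (fun m : ℝ => 2 * m) (𝓝 0) (𝓝 (2 * 0)) :=
        (continuous_const.mul continuous_id).tendsto 0
      rw [mul_zero] at this
      exact this.mono_left nhdsWithin_le_nhds
    · filter_upwards [self_mem_nhdsWithin] with m hm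
      have := mem_Ioi.1 hm
      simpa using this
  have h2 := (hsing.comp h1).eventually_lt_atBot (-(2 * N * K))
  have h3 : ∀ᶠ m in 𝓝[>] (0 : ℝ), m < N * r :=
    (eventually_lt_nhds (mul_pos hN hr)).filter_mono nhdsWithin_le_nhds
  obtain ⟨m, hm2, hm3, hm0⟩ := (h2.and (h3.and self_mem_nhdsWithin)).exists
  refine ⟨m, hm0, ?_, ?_⟩
  · rw [div_le_iff₀ hN]; linarith
  · simp only [Function.comp] at hm2
    rw [div_mul_eq_mul_div, lt_div_iff₀ hN]
    linarith

lemma le_integral_of_small (hU : NonposUtility U₂) (hρ : 0 < ρ) (hfin : HasFinitePayoff ρ U₂ x)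
    (hx0 : ∀ t, 0 ≤ t → 0 < x t) {a b R m : ℝ} (ha : 0 ≤ a) (hab : a ≤ b) (hbR : b ≤ R)
    (hxm : ∀ t ∈ Ioc a b, x t ≤ 2 * m) (hm : 0 < m) :
    Real.exp (-ρ * R) * ((b - a) * (-U₂ (2 * m))) ≤
      -∫ t in Ioi 0, Real.exp (-ρ * t) * U₂ (x t) := by
  have hsub : Ioc a b ⊆ Ioi 0 := fun t ht => ha.trans_lt ht.1
  have hneg : IntegrableOn (fun t => -(Real.exp (-ρ * t) * U₂ (x t))) (Ioi 0) := hfin.neg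
  rw [← integral_neg]
  have h1 : ∫ t in Ioc a b, -(Real.exp (-ρ * t) * U₂ (x t)) ≤
      ∫ t in Ioi 0, -(Real.exp (-ρ * t) * U₂ (x t)) := by
    refine setIntegral_mono_set hneg ?_ (LE.le.eventuallyLE hsub)
    filter_upwards [ae_restrict_mem measurableSet_Ioi] with t ht
    have := mul_nonpos_of_nonneg_of_nonpos (Real.exp_pos (-ρ * t)).le
      (hU.nonpos _ (hx0 t (le_of_lt ht)))
    simpa using this
  refine le_trans ?_ h1
  have h2 : ∫ _t in Ioc a b, Real.exp (-ρ * R) * (-U₂ (2 * m)) ≤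
      ∫ t in Ioc a b, -(Real.exp (-ρ * t) * U₂ (x t)) := by
    refine setIntegral_mono_on (integrableOn_const (by simp)) (hneg.mono_set hsub) measurableSet_Ioc fun t ht => ?_
    have ht0 := ha.trans ht.1.le
    have e1 : Real.exp (-ρ * R) ≤ Real.exp (-ρ * t) := by
      apply Real.exp_le_exp.2
      have := ht.2.trans hbR
      nlinarith
    have e2 := hU.mono (mem_Ioi.2 (hx0 t ht0)) (mem_Ioi.2 (by linarith : 0 < 2 * m)) (hxm t ht)
    have e3 := hU.nonpos (2 * m) (by linarith)
    have e4 := mul_le_mul e1 (neg_le_neg e2) (by linarith) (Real.exp_pos _).le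
    linarith
  refine le_trans (le_of_eq ?_) h2
  rw [setIntegral_const]
  simp only [measureReal_def, Real.volume_Ioc, smul_eq_mul]
  rw [ENNReal.toReal_ofReal (sub_nonneg.2 hab)]
  ring

end Floor

/-! ### Existence of optimal controls. -/

section Existence

variable {T A C ρ : ℝ} {f : ℝ → ℝ → ℝ} {D : (ℝ → ℝ) → ℝ → ℝ} {U₁ U₂ : ℝ → ℝ}
  {η₀ : ℝ} {η₁ c x : ℝ → ℝ}

/-- Payoffs bounded below keep trajectories away from zero on compact intervals. -/
lemma IsControlProblem.exists_forward_floor (hP : IsControlProblem T A C ρ f D U₁ U₂)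
    (hη : IsHistory T η₁) (hsing : Tendsto (fun x => x * U₂ x) (𝓝[>] 0) atBot)
    (hbd : ∀ y, IsPath T y → ∀ S, ∃ K, ∀ t ∈ Icc 0 S, D y t ≤ K) (v S : ℝ) :
    ∃ m, 0 < m ∧ ∀ c x, IsAdmissiblePair T f D η₀ η₁ c x → HasFinitePayoff ρ U₂ x →
      v ≤ realPayoff ρ U₁ U₂ c x → ∀ t ∈ Icc 0 S, m ≤ x t := by
  obtain ⟨X, hX⟩ := hP.exists_free hη η₀
  obtain ⟨K, hK⟩ := hbd X (hX.isPath hη) (S + 1)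
  obtain ⟨Y, hY⟩ := isCompact_Icc.bddAbove_image
    ((hX.continuousOn.mono Icc_subset_Ici_self : ContinuousOn X (Icc 0 (S + 1))))
  -- An upper bound for the drift of the trajectory without consumption, which dominates the drift
  -- of every other trajectory. The horizon S + 1 leaves room for the time m / N ≤ 1 after t.
  set N := max (f Y K) 1 with hN
  have hN1 : 0 < N := lt_of_lt_of_le one_pos (le_max_right _ _)
  obtain ⟨B, hB⟩ := hP.consumption.bounded
  obtain ⟨m, hm, hmN, hmK⟩ := exists_singular_floor hsing hN1 one_pos
    (Real.exp (ρ * (S + 1)) * (B / ρ - v))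
  refine ⟨m, hm, fun c x h hfin hv t ht => ?_⟩
  by_contra! hlt
  have hXx := h.solution.le_free hP.production hP.delay hη hX h.control_nonneg
  have hgrow : ∀ s ∈ Ioc t (t + m / N), x s ≤ 2 * m := by
    intro s hs
    have hs0 : 0 ≤ s := ht.1.trans hs.1.le
    have hsS : s ≤ S + 1 := by linarith [hs.2, ht.2]
    have hp := h.solution.isPath hη
    have e1 := h.solution.integral_eq s hs0
    have e2 := h.solution.integral_eq t ht.1
    rw [← intervalIntegral.integral_add_adjacent_intervals
      (hp.drift_integrable hP.production hP.delay ht.1)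
      (hp.drift_integrable' hP.production hP.delay ht.1 hs0),
      ← intervalIntegral.integral_add_adjacent_intervals (a := 0) (b := t) (c := s) (f := c)
      (intervalIntegrable_of_locallyIntegrableOn_Ici h.locallyIntegrable le_rfl ht.1)
      (intervalIntegrable_of_locallyIntegrableOn_Ici h.locallyIntegrable ht.1 hs0)] at e1
    have e3 := integral_nonneg_of_control_nonneg h.control_nonneg ht.1 hs.1.le
    have e4 := h.solution.drift_integral_mono hP.production hP.delay hη hX ht.1 hs.1.le
      (fun r hr => hXx r hr.1)
    have e5 : ∫ r in t..s, f (X r) (D X r) ≤ ∫ _r in t..s, N := by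
      refine intervalIntegral.integral_mono_on hs.1.le
        ((hX.isPath hη).drift_integrable' hP.production hP.delay ht.1 hs0)
        intervalIntegrable_const fun r hr => ?_
      have hr' : r ∈ Icc 0 (S + 1) := ⟨ht.1.trans hr.1, hr.2.trans hsS⟩
      exact (hP.production.mono _ _ _ _ (hY ⟨r, hr', rfl⟩) (hK r hr')).trans (le_max_left _ _)
    simp only [intervalIntegral.integral_const, smul_eq_mul] at e5
    have e6 : (s - t) * N ≤ m := by
      have : s - t ≤ m / N := by linarith [hs.2]
      rwa [le_div_iff₀ hN1] at this
    linarith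
  have h1 := le_integral_of_small hP.state hP.discount_pos hfin h.state_pos (a := t)
    (b := t + m / N) (R := S + 1) ht.1 (by have := div_pos hm hN1; linarith) (by linarith [ht.2])
    hgrow hm
  rw [add_sub_cancel_left] at h1
  have h2 := integral_discount_mul_le hP.discount_pos (hP.integrable_consumption h) (B := B)
    fun t ht => (le_abs_self _).trans (hB _ (h.control_nonneg t (le_of_lt ht)))
  simp only [mul_zero, Real.exp_zero, one_mul] at h2
  rw [realPayoff] at hv
  have h3 := mul_lt_mul_of_pos_left hmK (Real.exp_pos (-ρ * (S + 1)))
  rw [← mul_assoc, ← Real.exp_add] at h3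
  have : -ρ * (S + 1) + ρ * (S + 1) = 0 := by ring
  rw [this, Real.exp_zero, one_mul] at h3
  linarith

lemma ae_Ioi_of_forall_Ioc {p : ℝ → Prop}
    (h : ∀ S : ℕ, ∀ᵐ t ∂(volume.restrict (Ioc (0 : ℝ) S)), p t) :
    ∀ᵐ t ∂(volume.restrict (Ioi (0 : ℝ))), p t := by
  have : Ioi (0 : ℝ) = ⋃ S : ℕ, Ioc (0 : ℝ) S := by
    ext t
    simp only [mem_Ioi, mem_iUnion, mem_Ioc]
    constructor
    · intro ht
      obtain ⟨n, hn⟩ := exists_nat_ge t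
      exact ⟨n, ht, hn⟩
    · rintro ⟨n, h, -⟩; exact h
  rw [this, ae_restrict_iUnion_iff]
  exact h

lemma aemeasurable_liminf_nat {μ : Measure ℝ} {h : ℕ → ℝ → ENNReal}
    (hh : ∀ n, AEMeasurable (h n) μ) : AEMeasurable (fun t => liminf (fun n => h n t) atTop) μ :=
  ⟨fun t => liminf (fun n => (hh n).mk _ t) atTop, Measurable.liminf fun n => (hh n).measurable_mk, by
    filter_upwards [ae_all_iff.2 fun n => (hh n).ae_eq_mk] with t ht
    simp_rw [ht]⟩

/-- Fatou: if `exp (-u n)` converges a.e. and the integrals of the `u n` are locally bounded, then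
the `u n` converge a.e. to a locally integrable function. -/
lemma exists_limit_of_exp_tendsto {u : ℕ → ℝ → ℝ} {g X : ℝ → ℝ}
    (hu : ∀ n, LocallyIntegrableOn (u n) (Ici 0)) (hu0 : ∀ n t, 0 ≤ t → 0 ≤ u n t)
    (hX : ∀ n t, 0 ≤ t → ∫ s in (0 : ℝ)..t, u n s ≤ X t)
    (hg : ∀ᵐ t ∂(volume.restrict (Ioi 0)),
      Tendsto (fun n => Real.exp (-(u n t))) atTop (𝓝 (g t))) :
    ∃ c : ℝ → ℝ, LocallyIntegrableOn c (Ici 0) ∧ (∀ t, 0 ≤ c t) ∧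
      ∀ᵐ t ∂(volume.restrict (Ioi 0)), Tendsto (fun n => u n t) atTop (𝓝 (c t)) := by
  have huI : ∀ n (S : ℝ), 0 ≤ S → IntegrableOn (u n) (Ioc 0 S) := fun n S hS => by
    have := intervalIntegrable_of_locallyIntegrableOn_Ici (hu n) le_rfl hS
    rwa [intervalIntegrable_iff, uIoc_of_le hS] at this
  have hfatou : ∀ S : ℝ, 0 ≤ S → ∫⁻ t in Ioc 0 S,
      liminf (fun n => ENNReal.ofReal (u n t)) atTop ≤ ENNReal.ofReal (X S) := by
    intro S hS
    refine (lintegral_liminf_le' fun n => (huI n S hS).aemeasurable.ennreal_ofReal).trans ?_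
    refine liminf_le_of_frequently_le' (Frequently.of_forall fun n => ?_)
    rw [← ofReal_integral_eq_lintegral_ofReal (huI n S hS)]
    · refine ENNReal.ofReal_le_ofReal ?_
      rw [← intervalIntegral.integral_of_le hS]
      exact hX n S hS
    · filter_upwards [ae_restrict_mem measurableSet_Ioc] with t ht
      exact hu0 n t ht.1.le
  -- Where g vanishes, u n tends to infinity; by Fatou and the bound on the integrals this happens
  -- only on a null set.
  have hpos : ∀ᵐ t ∂(volume.restrict (Ioi 0)), 0 < g t := by
    refine ae_Ioi_of_forall_Ioc fun S => ?_
    have hS : (0 : ℝ) ≤ S := Nat.cast_nonneg S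
    have hlt := ae_lt_top' (aemeasurable_liminf_nat
      fun n => (huI n S hS).aemeasurable.ennreal_ofReal)
      (ne_top_of_le_ne_top ENNReal.ofReal_ne_top (hfatou S hS))
    filter_upwards [hlt, ae_restrict_of_ae_restrict_of_subset Ioc_subset_Ioi_self hg] with t h1 h2
    have hg0 : 0 ≤ g t := ge_of_tendsto' h2 fun n => (Real.exp_pos _).le
    refine lt_of_le_of_ne hg0 fun h0 => ?_
    rw [← h0] at h2
    have h3 : Tendsto (fun n => Real.log (Real.exp (-(u n t)))) atTop atBot :=
      Real.tendsto_log_nhdsGT_zero.comp (tendsto_nhdsWithin_iff.2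
        ⟨h2, Eventually.of_forall fun n => Real.exp_pos _⟩)
    simp only [Real.log_exp] at h3
    have h4 : Tendsto (fun n => u n t) atTop atTop := by
      simpa [Function.comp_def] using tendsto_neg_atBot_atTop.comp h3
    have h5 := (ENNReal.tendsto_ofReal_atTop.comp h4).liminf_eq
    simp only [Function.comp_def] at h5
    rw [h5] at h1
    exact lt_irrefl _ h1
  set c : ℝ → ℝ := fun t => max 0 (-Real.log (g t)) with hc
  have hlim : ∀ᵐ t ∂(volume.restrict (Ioi 0)), Tendsto (fun n => u n t) atTop (𝓝 (c t)) := by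
    filter_upwards [hpos, hg, ae_restrict_mem measurableSet_Ioi] with t h1 h2 h3
    have h4 := (h2.log h1.ne').neg
    simp only [Real.log_exp, neg_neg] at h4
    have h5 : 0 ≤ -Real.log (g t) := ge_of_tendsto' h4 fun n => hu0 n t (le_of_lt h3)
    simp only [hc]
    rwa [max_eq_right h5]
  refine ⟨c, locallyIntegrableOn_Ici_of_integrableOn fun S hS => ?_, fun t => le_max_left _ _, hlim⟩
  rw [integrableOn_Icc_iff_integrableOn_Ioc]
  have hlimS := ae_restrict_of_ae_restrict_of_subset
    (Ioc_subset_Ioi_self : Ioc 0 S ⊆ Ioi 0) hlim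
  refine ⟨aestronglyMeasurable_of_tendsto_ae atTop
    (fun n => (huI n S hS).aestronglyMeasurable) hlimS, ?_⟩
  have hcnn : 0 ≤ᵐ[volume.restrict (Ioc 0 S)] c := ae_of_all _ fun t => le_max_left _ _
  rw [hasFiniteIntegral_iff_ofReal hcnn]
  refine lt_of_le_of_lt (le_trans (lintegral_mono_ae ?_) (hfatou S hS)) ENNReal.ofReal_lt_top
  filter_upwards [hlimS] with t ht
  exact (((ENNReal.continuous_ofReal.tendsto _).comp ht).liminf_eq).ge

/-- The positive part of c - u n is dominated by c itself. The negative part need not tend to zero,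
since mass of u n may escape; the one-sided statement suffices because lower consumption only raises
the state. -/
lemma tendsto_integral_posPart_sub {u : ℕ → ℝ → ℝ} {c : ℝ → ℝ}
    (hu : ∀ n, LocallyIntegrableOn (u n) (Ici 0)) (hu0 : ∀ n t, 0 ≤ t → 0 ≤ u n t)
    (hc : LocallyIntegrableOn c (Ici 0)) (hc0 : ∀ t, 0 ≤ c t)
    (hlim : ∀ᵐ t ∂(volume.restrict (Ioi 0)), Tendsto (fun n => u n t) atTop (𝓝 (c t)))
    {S : ℝ} (hS : 0 ≤ S) :
    Tendsto (fun n => ∫ t in Ioc 0 S, max (c t - u n t) 0) atTop (𝓝 0) := by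
  have hI : ∀ {w : ℝ → ℝ}, LocallyIntegrableOn w (Ici 0) → IntegrableOn w (Ioc 0 S) := fun hw => by
    have := intervalIntegrable_of_locallyIntegrableOn_Ici hw le_rfl hS
    rwa [intervalIntegrable_iff, uIoc_of_le hS] at this
  have := tendsto_integral_of_dominated_convergence (μ := volume.restrict (Ioc 0 S))
    (F := fun n t => max (c t - u n t) 0) (f := fun _ => 0) c
    (fun n => (continuous_id.max continuous_const).comp_aestronglyMeasurable
      ((hI hc).sub (hI (hu n))).aestronglyMeasurable)
    (hI hc) (fun n => by
      filter_upwards [ae_restrict_mem measurableSet_Ioc] with t ht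
      rw [Real.norm_of_nonneg (le_max_right _ _)]
      exact max_le (by linarith [hu0 n t ht.1.le]) (hc0 t)) (by
      filter_upwards [ae_restrict_of_ae_restrict_of_subset (Ioc_subset_Ioi_self : Ioc 0 S ⊆ Ioi 0) hlim]
        with t ht
      have h1 := ((tendsto_const_nhds (x := c t)).sub ht).max (tendsto_const_nhds (x := (0 : ℝ)))
      simpa using h1)
  simpa using this

/-- Direct method: a maximising sequence chosen to converge almost everywhere, with dominated
convergence for consumption and Fatou for the state. The hypotheses `hsing` and `hbd` serve to keep
the maximising trajectories, and hence the limit, away from zero. -/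
theorem IsControlProblem.exists_isOptimalPair (hP : IsControlProblem T A C ρ f D U₁ U₂)
    (hη : IsHistory T η₁) (hη₀ : 0 < η₀)
    (hsing : Tendsto (fun x => x * U₂ x) (𝓝[>] 0) atBot)
    (hbd : ∀ y, IsPath T y → ∀ S, ∃ K, ∀ t ∈ Icc 0 S, D y t ≤ K) :
    ∃ c x, IsOptimalPair T ρ f U₁ U₂ D η₀ η₁ c x := by
  set v := realValue T ρ f U₁ U₂ D η₀ η₁ with hv
  set S : ℕ → Set (ℝ → ℝ) := fun n => {c | ∃ x, IsAdmissiblePair T f D η₀ η₁ c x ∧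
    HasFinitePayoff ρ U₂ x ∧ v - 1 / ((n : ℝ) + 1) < realPayoff ρ U₁ U₂ c x} with hSdef
  have hmid : ∀ n, ∀ u ∈ S n, ∀ w ∈ S n, (fun t => (1 / 2 : ℝ) * u t + (1 / 2 : ℝ) * w t) ∈ S n := by
    rintro n u ⟨x₁, h₁, hf₁, hl₁⟩ w ⟨x₂, h₂, hf₂, hl₂⟩
    obtain ⟨x, h, hfin, hge⟩ := hP.exists_combination hη h₁ h₂ hf₁ hf₂ (l := 1 / 2) (m := 1 / 2)
      (by norm_num) (by norm_num) (by norm_num)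
    have e : (1 / 2 : ℝ) * η₀ + 1 / 2 * η₀ = η₀ := by ring
    rw [e] at h
    exact ⟨x, h, hfin, by linarith⟩
  obtain ⟨u, huS, g, hg⟩ := exists_ae_convergent_selection (S := S) (fun n => by
      obtain ⟨c, x, h, hfin, hlt⟩ := hP.exists_near hη hη₀
        (sub_lt_self v (show (0 : ℝ) < 1 / ((n : ℝ) + 1) by positivity))
      exact ⟨c, x, h, hfin, hlt⟩)
    (fun n m hnm c ⟨x, h, hfin, hlt⟩ => ⟨x, h, hfin, by
      have : 1 / ((m : ℝ) + 1) ≤ 1 / ((n : ℝ) + 1) := by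
        apply one_div_le_one_div_of_le (by positivity)
        have : (n : ℝ) ≤ m := by exact_mod_cast hnm
        linarith
      linarith⟩) hmid
    (fun n c ⟨x, h, _⟩ => aestronglyMeasurable_control h.locallyIntegrable)
    (fun n c ⟨x, h, _⟩ t ht => h.control_nonneg t (le_of_lt ht))
  choose X hX hXfin hXv using huS
  obtain ⟨X₀, hX₀⟩ := hP.exists_free hη η₀
  obtain ⟨c, hc, hc0, hlim⟩ := exists_limit_of_exp_tendsto (fun n => (hX n).locallyIntegrable)
    (fun n => (hX n).control_nonneg) (X := X₀) (fun n t ht =>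
      (hX n).solution.integral_control_le_free hP.production hP.delay hη hX₀
        (hX n).control_nonneg ht ((hX n).state_pos t ht).le) hg
  obtain ⟨x, hx⟩ := exists_solution hP.production hP.delay η₀ hη.integrable hc
  -- The limiting trajectory lies above the approximating ones up to an error that comes from the
  -- positive part of c - u n. There is no estimate in the other direction, and none is needed.
  have hdefect : ∀ t, 0 ≤ t → ∃ e : ℕ → ℝ, Tendsto e atTop (𝓝 0) ∧ (∀ n, 0 ≤ e n) ∧
      ∀ n, X n t ≤ x t + e n := by
    intro t ht
    have h1 := tendsto_integral_posPart_sub (fun n => (hX n).locallyIntegrable)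
      (fun n => (hX n).control_nonneg) hc hc0 hlim ht
    have hnn : ∀ n, 0 ≤ ∫ s in Ioc 0 t, max (c s - u n s) 0 := fun n =>
      integral_nonneg fun s => le_max_right _ _
    refine ⟨fun n => (∫ s in Ioc 0 t, max (c s - u n s) 0) * Real.exp (C * (1 + A) * t), ?_,
      fun n => mul_nonneg (hnn n) (Real.exp_pos _).le, fun n => ?_⟩
    · simpa using h1.mul_const (Real.exp (C * (1 + A) * t))
    · refine (hX n).solution.le_add_of_cost_le hP.production hP.delay hη hx (S := t) (hnn n)
        (fun r hr => ?_) t ⟨ht, le_rfl⟩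
      have hi1 : IntervalIntegrable c volume 0 r :=
        intervalIntegrable_of_locallyIntegrableOn_Ici hc le_rfl hr.1
      have hi2 : IntervalIntegrable (u n) volume 0 r :=
        intervalIntegrable_of_locallyIntegrableOn_Ici (hX n).locallyIntegrable le_rfl hr.1
      have hi3 : IntervalIntegrable c volume 0 t :=
        intervalIntegrable_of_locallyIntegrableOn_Ici hc le_rfl ht
      have hi4 : IntervalIntegrable (u n) volume 0 t :=
        intervalIntegrable_of_locallyIntegrableOn_Ici (hX n).locallyIntegrable le_rfl ht
      have hi5 : IntegrableOn (fun s => max (c s - u n s) 0) (Ioc 0 t) := by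
        have := (hi3.sub hi4)
        rw [intervalIntegrable_iff, uIoc_of_le ht] at this
        exact this.pos_part
      have e1 : (∫ s in (0 : ℝ)..r, c s) - ∫ s in (0 : ℝ)..r, u n s =
          ∫ s in Ioc 0 r, (c s - u n s) := by
        rw [← intervalIntegral.integral_sub hi1 hi2, intervalIntegral.integral_of_le hr.1]
      have e2 : ∫ s in Ioc 0 r, (c s - u n s) ≤ ∫ s in Ioc 0 r, max (c s - u n s) 0 := by
        have hi6 := hi1.sub hi2
        rw [intervalIntegrable_iff, uIoc_of_le hr.1] at hi6
        exact integral_mono hi6 (hi5.mono_set (Ioc_subset_Ioc_right hr.2))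
          fun s => le_max_left _ _
      have e3 : ∫ s in Ioc 0 r, max (c s - u n s) 0 ≤ ∫ s in Ioc 0 t, max (c s - u n s) 0 :=
        setIntegral_mono_set hi5 (ae_of_all _ fun s => le_max_right _ _)
          (LE.le.eventuallyLE (Ioc_subset_Ioc_right hr.2))
      linarith
  have hx0 : ∀ t, 0 ≤ t → 0 < x t := by
    intro t ht
    -- All the payoffs exceed v - 1, so one floor m serves the whole sequence.
    obtain ⟨m, hm, hfl⟩ := hP.exists_forward_floor (η₀ := η₀) hη hsing hbd (v - 1) t
    obtain ⟨e, he, -, hle⟩ := hdefect t ht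
    have h1 : ∀ n, m ≤ x t + e n := fun n =>
      (hfl _ _ (hX n) (hXfin n) (by
        have h2 := hXv n
        have h3 : 1 / ((n : ℝ) + 1) ≤ 1 := by
          rw [div_le_one (by positivity)]
          have : (0 : ℝ) ≤ n := Nat.cast_nonneg n
          linarith
        linarith) t ⟨ht, le_rfl⟩).trans (hle n)
    have h2 := ge_of_tendsto' (he.const_add (x t)) h1
    linarith
  have hadm : IsAdmissiblePair T f D η₀ η₁ c x := ⟨hc, fun t _ => hc0 t, hx, hx0⟩
  obtain ⟨B, hB⟩ := hP.consumption.bounded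
  have hJ₁ : Tendsto (fun n => ∫ t in Ioi (0 : ℝ), Real.exp (-ρ * t) * U₁ (u n t)) atTop
      (𝓝 (∫ t in Ioi (0 : ℝ), Real.exp (-ρ * t) * U₁ (c t))) := by
    refine tendsto_integral_of_dominated_convergence (fun t => Real.exp (-ρ * t) * B)
      (fun n => (hP.integrable_consumption (hX n)).aestronglyMeasurable)
      ((integrableOn_discount hP.discount_pos 0).mul_const B) (fun n => ?_) ?_
    · filter_upwards [ae_restrict_mem measurableSet_Ioi] with t ht
      rw [norm_mul, Real.norm_of_nonneg (Real.exp_pos _).le, Real.norm_eq_abs]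
      exact mul_le_mul_of_nonneg_left (hB _ ((hX n).control_nonneg t (le_of_lt ht)))
        (Real.exp_pos _).le
    · filter_upwards [hlim, ae_restrict_mem measurableSet_Ioi] with t h1 ht
      have h2 := (hP.consumption.continuous_max.tendsto (c t)).comp h1
      simp only [Function.comp_def, max_eq_left (hc0 t)] at h2
      refine Tendsto.const_mul _ (h2.congr fun n => ?_)
      rw [max_eq_left ((hX n).control_nonneg t (le_of_lt ht))]
  set J₁ := ∫ t in Ioi (0 : ℝ), Real.exp (-ρ * t) * U₁ (c t) with hJ₁def
  have hnn : ∀ {y : ℝ → ℝ}, (∀ t, 0 ≤ t → 0 < y t) →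
      0 ≤ᵐ[volume.restrict (Ioi 0)] fun t => -(Real.exp (-ρ * t) * U₂ (y t)) := fun hy => by
    filter_upwards [ae_restrict_mem measurableSet_Ioi] with t ht
    have := mul_nonpos_of_nonneg_of_nonpos (Real.exp_pos (-ρ * t)).le
      (hP.state.nonpos _ (hy t (le_of_lt ht)))
    simpa using this
  -- As U₂ is monotone, U₂ of X n is at most U₂ of x + e n, which converges; this replaces
  -- convergence of the states in Fatou's lemma.
  have hfatou : ∫⁻ t in Ioi (0 : ℝ), ENNReal.ofReal (-(Real.exp (-ρ * t) * U₂ (x t))) ≤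
      ENNReal.ofReal (J₁ - v) := by
    calc ∫⁻ t in Ioi (0 : ℝ), ENNReal.ofReal (-(Real.exp (-ρ * t) * U₂ (x t)))
        ≤ ∫⁻ t in Ioi (0 : ℝ), liminf (fun n =>
            ENNReal.ofReal (-(Real.exp (-ρ * t) * U₂ (X n t)))) atTop := by
          refine setLIntegral_mono_ae' measurableSet_Ioi (ae_of_all _ fun t ht => ?_)
          have ht0 := le_of_lt (mem_Ioi.1 ht)
          obtain ⟨e, he, he0, hle⟩ := hdefect t ht0
          have h1 : Tendsto (fun n => U₂ (x t + e n)) atTop (𝓝 (U₂ (x t))) := by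
            refine ((hP.state.continuousOn.continuousAt (Ioi_mem_nhds (hx0 t ht0))).tendsto).comp ?_
            simpa using he.const_add (x t)
          have h2 := ((ENNReal.continuous_ofReal.tendsto _).comp
            ((h1.const_mul (Real.exp (-ρ * t))).neg)).liminf_eq
          rw [← h2]
          refine liminf_le_liminf (Eventually.of_forall fun n => ?_)
          refine ENNReal.ofReal_le_ofReal (neg_le_neg (mul_le_mul_of_nonneg_left ?_
            (Real.exp_pos _).le))
          exact hP.state.mono (mem_Ioi.2 ((hX n).state_pos t ht0))
            (mem_Ioi.2 (add_pos_of_pos_of_nonneg (hx0 t ht0) (he0 n))) (hle n)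
      _ ≤ liminf (fun n => ∫⁻ t in Ioi (0 : ℝ),
            ENNReal.ofReal (-(Real.exp (-ρ * t) * U₂ (X n t)))) atTop :=
          lintegral_liminf_le' fun n => (Integrable.neg (hXfin n)).aemeasurable.ennreal_ofReal
      _ ≤ liminf (fun n => ENNReal.ofReal ((∫ t in Ioi (0 : ℝ), Real.exp (-ρ * t) * U₁ (u n t))
            - (v - 1 / ((n : ℝ) + 1)))) atTop := by
          refine liminf_le_liminf (Eventually.of_forall fun n => ?_)
          have hi : IntegrableOn (fun t => -(Real.exp (-ρ * t) * U₂ (X n t))) (Ioi 0) :=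
            Integrable.neg (hXfin n)
          rw [← ofReal_integral_eq_lintegral_ofReal hi (hnn (hX n).state_pos), integral_neg]
          refine ENNReal.ofReal_le_ofReal ?_
          have := hXv n
          rw [realPayoff] at this
          linarith
      _ = ENNReal.ofReal (J₁ - v) := by
          have h3 := hJ₁.sub ((tendsto_const_nhds (x := v)).sub
            (tendsto_one_div_add_atTop_nhds_zero_nat (𝕜 := ℝ)))
          rw [sub_zero] at h3
          exact ((ENNReal.continuous_ofReal.tendsto _).comp h3).liminf_eq
  have hfin : HasFinitePayoff ρ U₂ x := by
    have h1 : Integrable (fun t => -(Real.exp (-ρ * t) * U₂ (x t))) (volume.restrict (Ioi 0)) := by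
      refine ⟨(hP.state.aestronglyMeasurable hx.continuousOn hx0).neg, ?_⟩
      rw [hasFiniteIntegral_iff_ofReal (hnn hx0)]
      exact hfatou.trans_lt ENNReal.ofReal_lt_top
    exact h1.neg.congr (ae_of_all _ fun t => by simp)
  refine ⟨c, x, hadm, hfin, le_antisymm (hP.realPayoff_le_realValue hη hη₀ hadm hfin) ?_⟩
  have hi : IntegrableOn (fun t => -(Real.exp (-ρ * t) * U₂ (x t))) (Ioi 0) := Integrable.neg hfin
  rw [← ofReal_integral_eq_lintegral_ofReal hi (hnn hx0), integral_neg] at hfatou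
  have hJv : 0 ≤ J₁ - v := by
    have h3 := hJ₁.sub ((tendsto_const_nhds (x := v)).sub
      (tendsto_one_div_add_atTop_nhds_zero_nat (𝕜 := ℝ)))
    rw [sub_zero] at h3
    refine ge_of_tendsto' h3 fun n => ?_
    have h4 := hXv n
    have h5 := hP.state_integral_nonpos (hX n).state_pos Subset.rfl measurableSet_Ioi
    rw [realPayoff] at h4
    linarith
  have := (ENNReal.ofReal_le_ofReal_iff hJv).1 hfatou
  rw [realPayoff]
  linarith

end Existence

/-- Perturbations of a path of size `d` on `[0,δ]` influence the delay term later on with a weight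
of order `d * δ` that decays in time. -/
structure HasFadingMemory (T A B : ℝ) (D : (ℝ → ℝ) → ℝ → ℝ) : Prop where
  const_nonneg : 0 ≤ B
  le_add : ∀ x x', IsPath T x → IsPath T x' → (∀ s ∈ Ico (-T) 0, x s = x' s) →
    ∀ δ t d e, 0 ≤ δ → δ ≤ t → 0 ≤ d → 0 ≤ e → (∀ s ∈ Icc 0 δ, x s ≤ x' s + d) →
    (∀ s ∈ Icc δ t, x s ≤ x' s + e) →
    D x t ≤ D x' t + A * e + B * d * δ * Real.exp (-(t - δ))

/-! ### Perturbing the initial capital of an optimal pair. -/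

section Perturbation

variable {T A B C ρ : ℝ} {f : ℝ → ℝ → ℝ} {D : (ℝ → ℝ) → ℝ → ℝ} {U₁ U₂ : ℝ → ℝ}
  {η₀ : ℝ} {η₁ c c' x x' : ℝ → ℝ}

lemma integral_exp_decay_le {δ t : ℝ} : ∫ s in δ..t, Real.exp (-(s - δ)) ≤ 1 := by
  have : ∀ s ∈ uIcc δ t, HasDerivAt (fun s => -Real.exp (-(s - δ))) (Real.exp (-(s - δ))) s := by
    intro s _
    have h1 : HasDerivAt (fun s => -(s - δ)) (-1) s := ((hasDerivAt_id s).sub_const δ).neg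
    exact h1.exp.neg.congr_deriv (by ring)
  rw [intervalIntegral.integral_eq_sub_of_hasDerivAt this
    (by apply Continuous.intervalIntegrable; fun_prop)]
  have := Real.exp_pos (-(t - δ))
  simp only [sub_self, neg_zero, Real.exp_zero]
  linarith

/-- Starting from a slightly smaller capital, saving slightly more than the deficit on `[0,δ]` is
enough to stay above the original trajectory from time `δ` on. -/
lemma IsSolution.overtake (hf : RegularProduction f C) (hD : IsDelayOp T A D)
    (hm : HasFadingMemory T A B D) (hη : IsHistory T η₁) {h δ κ : ℝ} (hh : 0 ≤ h) (hδ : 0 ≤ δ)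
    (hκ : (C * (1 + A) + C * B) * Real.exp (C * (1 + A) * δ) * δ ≤ κ)
    (hx : IsSolution T f D η₀ η₁ c x) (hx' : IsSolution T f D (η₀ - h) η₁ c' x')
    (hle : ∀ t, 0 ≤ t → ∫ s in (0 : ℝ)..t, c' s ≤ ∫ s in (0 : ℝ)..t, c s)
    (hge : ∀ t, δ ≤ t → ∫ s in (0 : ℝ)..t, c' s = (∫ s in (0 : ℝ)..t, c s) - (1 + κ) * h) :
    (∀ t ∈ Icc 0 δ, x t ≤ x' t + h * Real.exp (C * (1 + A) * δ)) ∧ ∀ t, δ ≤ t → x t ≤ x' t := by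
  set L := C * (1 + A) with hL
  have hC0 := hf.const_nonneg
  have hL0 : 0 ≤ L := mul_nonneg hC0 (by linarith [hD.const_nonneg])
  have hp := hx.isPath hη
  have hp' := hx'.isPath hη
  have hhist : ∀ s ∈ Ico (-T) 0, x s = x' s := fun s hs =>
    (hx.history s hs).trans (hx'.history s hs).symm
  have h1 : ∀ t ∈ Icc 0 δ, x t ≤ x' t + h * Real.exp (L * δ) := by
    intro t ht
    refine (hx.le_add_of_cost_le hf hD hη hx' (S := δ) hh (fun r hr => ?_) t ht).trans ?_
    · have := hle r hr.1; linarith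
    · have : Real.exp (L * t) ≤ Real.exp (L * δ) :=
        Real.exp_le_exp.2 (mul_le_mul_of_nonneg_left ht.2 hL0)
      have := mul_le_mul_of_nonneg_left this hh
      linarith
  refine ⟨h1, fun S hS => ?_⟩
  set d := h * Real.exp (L * δ) with hd
  have hd0 : 0 ≤ d := mul_nonneg hh (Real.exp_pos _).le
  -- After time δ the deficit acts in two ways: through the drift accumulated on [0,δ], at most δ L
  -- d, and through the memory of the delay, at most C B d δ in total since the weight exp(-(s-δ))
  -- has integral at most 1. The additional saving κ h covers both.
  have key : ∀ e, 0 < e → ∀ t ∈ Icc δ S, x t - x' t < e * Real.exp (L * t) := by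
    intro e he
    have hsub : Icc δ S ⊆ Ici 0 := fun s hs => hδ.trans hs.1
    refine lt_of_bootstrap ((hp.continuousOn.mono hsub).sub (hp'.continuousOn.mono hsub))
      (by fun_prop) fun t ht hb => ?_
    have ht0 : 0 ≤ t := hδ.trans ht.1
    have i1 := hp.drift_integrable hf hD hδ
    have i1' := hp'.drift_integrable hf hD hδ
    have i2 := hp.drift_integrable' hf hD hδ ht0
    have i2' := hp'.drift_integrable' hf hD hδ ht0
    have b1 : (∫ s in (0 : ℝ)..δ, f (x s) (D x s)) - ∫ s in (0 : ℝ)..δ, f (x' s) (D x' s) ≤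
        δ * (L * d) := by
      rw [← intervalIntegral.integral_sub i1 i1']
      have := intervalIntegral.integral_mono_on hδ (i1.sub i1')
        (intervalIntegrable_const (c := L * d)) fun s hs =>
        drift_sub_le hf hD hp hp' hhist hs.1 hd0 fun r hr => h1 r ⟨hr.1, hr.2.trans hs.2⟩
      simpa only [intervalIntegral.integral_const, sub_zero, smul_eq_mul] using this
    have b2 : (∫ s in δ..t, f (x s) (D x s)) - ∫ s in δ..t, f (x' s) (D x' s) ≤
        e * (Real.exp (L * t) - Real.exp (L * δ)) + C * (B * d * δ) := by
      rw [← intervalIntegral.integral_sub i2 i2']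
      have j1 : IntervalIntegrable (fun s => L * (e * Real.exp (L * s))) volume δ t := by
        apply Continuous.intervalIntegrable; fun_prop
      have j2 : IntervalIntegrable (fun s => C * (B * d * δ) * Real.exp (-(s - δ))) volume δ t := by
        apply Continuous.intervalIntegrable; fun_prop
      have := intervalIntegral.integral_mono_on_of_le_Ioo ht.1 (i2.sub i2') (j1.add j2) fun s hs => by
        have hs0 : δ ≤ s := hs.1.le
        have hes : 0 ≤ e * Real.exp (L * s) := by positivity
        have hpt : ∀ r ∈ Icc δ s, x r ≤ x' r + e * Real.exp (L * s) := fun r hr => by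
          have e1 := hb r ⟨hr.1, hr.2.trans_lt hs.2⟩
          have e2 : e * Real.exp (L * r) ≤ e * Real.exp (L * s) := by
            gcongr; exact hr.2
          linarith
        have hDle := hm.le_add x x' hp hp' hhist δ s d _ hδ hs0 hd0 hes h1 hpt
        have hmono := hf.mono _ _ _ _ (hpt s ⟨hs0, le_rfl⟩) hDle
        have hlip := hf.lipschitz (x' s + e * Real.exp (L * s)) (x' s)
          (D x' s + A * (e * Real.exp (L * s)) + B * d * δ * Real.exp (-(s - δ))) (D x' s)
        have hB := hm.const_nonneg
        have hA := hD.const_nonneg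
        have e3 : D x' s + A * (e * Real.exp (L * s)) + B * d * δ * Real.exp (-(s - δ)) - D x' s =
          A * (e * Real.exp (L * s)) + B * d * δ * Real.exp (-(s - δ)) := by ring
        have e4 : 0 ≤ A * (e * Real.exp (L * s)) + B * d * δ * Real.exp (-(s - δ)) := by positivity
        rw [add_sub_cancel_left, e3, abs_of_nonneg hes, abs_of_nonneg e4] at hlip
        have := (le_abs_self _).trans hlip
        calc f (x s) (D x s) - f (x' s) (D x' s) ≤ C * (e * Real.exp (L * s) +
              (A * (e * Real.exp (L * s)) + B * d * δ * Real.exp (-(s - δ)))) := by linarith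
          _ = _ := by rw [hL]; ring
      rw [intervalIntegral.integral_add j1 j2, integral_exp_mul_const,
        intervalIntegral.integral_const_mul] at this
      have hk := mul_le_mul_of_nonneg_left (integral_exp_decay_le (δ := δ) (t := t))
        (show 0 ≤ C * (B * d * δ) by have := hm.const_nonneg; positivity)
      linarith
    have q1 := hx.integral_eq t ht0
    have q2 := hx'.integral_eq t ht0
    rw [← intervalIntegral.integral_add_adjacent_intervals i1 i2] at q1
    rw [← intervalIntegral.integral_add_adjacent_intervals i1' i2', hge t ht.1] at q2
    have q3 : δ * (L * d) + C * (B * d * δ) ≤ κ * h := by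
      have := mul_le_mul_of_nonneg_right hκ hh
      calc δ * (L * d) + C * (B * d * δ) = (L + C * B) * Real.exp (L * δ) * δ * h := by
            rw [hd]; ring
        _ ≤ _ := this
    have q4 : 0 < e * Real.exp (L * δ) := by positivity
    linarith
  refine le_of_forall_pos_le_add fun ε hε => ?_
  have := key (ε * Real.exp (-(L * S))) (by positivity) S ⟨hS, le_rfl⟩
  have h2 : Real.exp (-(L * S)) * Real.exp (L * S) = 1 := by
    rw [← Real.exp_add, neg_add_cancel, Real.exp_zero]
  rw [mul_assoc, h2] at this
  linarith

/-- By concavity every chord to the right of μ has slope at most that of the chord over [μ/2, μ],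
which is taken as K. -/
lemma NonposUtility.exists_lipschitz (hU : NonposUtility U₂) {μ : ℝ} (hμ : 0 < μ) :
    ∃ K, 0 ≤ K ∧ ∀ y z d, μ ≤ y → 0 < z → 0 ≤ d → z ≤ y + d → U₂ z - U₂ y ≤ K * d := by
  set K := (U₂ μ - U₂ (μ / 2)) / (μ / 2) with hK
  have hK0 : 0 ≤ K := by
    refine div_nonneg (sub_nonneg.2 (hU.mono (mem_Ioi.2 (by linarith)) (mem_Ioi.2 hμ)
      (by linarith))) (by linarith)
  refine ⟨K, hK0, fun y z d hy hz hd hle => ?_⟩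
  have hy0 : 0 < y := hμ.trans_le hy
  have h1 := hU.mono (mem_Ioi.2 hz) (mem_Ioi.2 (by linarith : 0 < y + d)) hle
  rcases hd.eq_or_lt with rfl | hd'
  · rw [add_zero] at h1; linarith
  · have h2 := hU.concave.slope_anti_adjacent (mem_Ioi.2 (show 0 < μ / 2 by linarith))
      (mem_Ioi.2 (by linarith : 0 < y + d)) (show μ / 2 < y by linarith) (show y < y + d by linarith)
    have h3 : (U₂ y - U₂ (μ / 2)) / (y - μ / 2) ≤ K := by
      rcases hy.eq_or_lt with rfl | hy'
      · rw [hK]; apply le_of_eq; congr 1; ring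
      · have h4 := hU.concave.slope_anti_adjacent (mem_Ioi.2 (show 0 < μ / 2 by linarith))
          (mem_Ioi.2 hy0) (show μ / 2 < μ by linarith) hy'
        have e1 : μ - μ / 2 = μ / 2 := by ring
        rw [e1, ← hK, div_le_iff₀ (by linarith)] at h4
        rw [div_le_iff₀ (by linarith)]
        have h5 : K * (μ / 2) = U₂ μ - U₂ (μ / 2) := by rw [hK]; field_simp
        linarith
    rw [add_sub_cancel_left] at h2
    have h6 := h2.trans h3
    rw [div_le_iff₀ hd'] at h6
    linarith

variable {E : Set ℝ}

lemma integrable_indicator_const (hE : MeasurableSet E) {δ : ℝ} (hEδ : E ⊆ Ioc 0 δ) (k : ℝ) :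
    Integrable (E.indicator fun _ => k) (volume : Measure ℝ) := by
  rw [integrable_indicator_iff hE]
  exact integrableOn_const ((measure_mono hEδ).trans_lt (by simp)).ne

lemma locallyIntegrableOn_add_indicator (hc : LocallyIntegrableOn c (Ici 0))
    (hE : MeasurableSet E) {δ : ℝ} (hEδ : E ⊆ Ioc 0 δ) (k : ℝ) :
    LocallyIntegrableOn (fun t => c t + E.indicator (fun _ => k) t) (Ici 0) :=
  locallyIntegrableOn_Ici_of_integrableOn fun _ _ =>
    (hc.integrableOn_compact_subset Icc_subset_Ici_self isCompact_Icc).add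
      (integrable_indicator_const hE hEδ k).integrableOn

lemma integral_add_indicator (hc : LocallyIntegrableOn c (Ici 0))
    (hE : MeasurableSet E) {δ : ℝ} (hEδ : E ⊆ Ioc 0 δ) (k : ℝ) {t : ℝ} (ht : 0 ≤ t) :
    ∫ s in (0 : ℝ)..t, (c s + E.indicator (fun _ => k) s) =
      (∫ s in (0 : ℝ)..t, c s) + volume.real (E ∩ Ioc 0 t) * k := by
  rw [intervalIntegral.integral_add
    (intervalIntegrable_of_locallyIntegrableOn_Ici hc le_rfl ht)
    (integrable_indicator_const hE hEδ k).intervalIntegrable, intervalIntegral.integral_of_le ht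
    (f := E.indicator fun _ => k), setIntegral_indicator hE, setIntegral_const, inter_comm]
  rfl

lemma measureReal_inter_le (hEδ : E ⊆ Ioc 0 (δ : ℝ)) (s : Set ℝ) :
    volume.real (E ∩ s) ≤ volume.real E :=
  measureReal_mono inter_subset_left ((measure_mono hEδ).trans_lt (by simp)).ne

lemma integral_Ioi_indicator_const (hE : MeasurableSet E) {δ : ℝ} (hEδ : E ⊆ Ioc 0 δ) (k : ℝ) :
    ∫ t in Ioi 0, E.indicator (fun _ => k) t = volume.real E * k := by
  rw [setIntegral_indicator hE, inter_eq_right.2 (hEδ.trans Ioc_subset_Ioi_self),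
    setIntegral_const]
  rfl

/-- Extra initial capital `h` can be consumed on `E`. -/
lemma IsOptimalPair.realValue_add_ge (hP : IsControlProblem T A C ρ f D U₁ U₂)
    (hη : IsHistory T η₁) (hη₀ : 0 < η₀) (hopt : IsOptimalPair T ρ f U₁ U₂ D η₀ η₁ c x)
    {δ b h : ℝ} (hE : MeasurableSet E) (hEδ : E ⊆ Ioc 0 δ) (hE0 : 0 < volume.real E)
    (hcb : ∀ t ∈ E, c t ≤ b) (hh : 0 < h) :
    realValue T ρ f U₁ U₂ D η₀ η₁ +
      h * (Real.exp (-ρ * δ) * deriv U₁ (b + h / volume.real E)) ≤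
      realValue T ρ f U₁ U₂ D (η₀ + h) η₁ := by
  set m := volume.real E with hm
  -- Consuming k more on E spends h in total, and never more than h before any given time, so the
  -- new trajectory stays above the old one.
  set k := h / m with hk
  have hk0 : 0 < k := div_pos hh hE0
  have hadm := hopt.admissible
  set c' : ℝ → ℝ := fun t => c t + E.indicator (fun _ => k) t with hc'
  have hind : ∀ t, 0 ≤ E.indicator (fun _ => k) t := fun t => indicator_nonneg (fun _ _ => hk0.le) t
  have hcl' := locallyIntegrableOn_add_indicator hadm.locallyIntegrable hE hEδ k
  have hc0' : ∀ t, 0 ≤ t → 0 ≤ c' t := fun t ht => add_nonneg (hadm.control_nonneg t ht) (hind t)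
  obtain ⟨x', hx'⟩ := exists_solution hP.production hP.delay (η₀ + h) hη.integrable hcl'
  have hxx' : ∀ t, 0 ≤ t → x t ≤ x' t := fun t ht =>
    hadm.solution.le_of_cost_le hP.production hP.delay hη hx' (S := t) (fun r hr => by
      rw [integral_add_indicator hadm.locallyIntegrable hE hEδ k hr.1]
      have e1 := mul_le_mul_of_nonneg_right (measureReal_inter_le hEδ (Ioc 0 r)) hk0.le
      have e2 : m * k = h := by rw [hk]; field_simp
      rw [← hm, e2] at e1
      linarith) t ⟨ht, le_rfl⟩
  have hx0' : ∀ t, 0 ≤ t → 0 < x' t := fun t ht => (hadm.state_pos t ht).trans_le (hxx' t ht)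
  have hadm' : IsAdmissiblePair T f D (η₀ + h) η₁ c' x' := ⟨hcl', hc0', hx', hx0'⟩
  have hfin' : HasFinitePayoff ρ U₂ x' := hopt.finite.of_ge hP.state hadm.state_pos
    hx'.continuousOn (fun t ht => hxx' t ht.le) hx0'
  have hval := hP.realPayoff_le_realValue hη (by linarith) hadm' hfin'
  rw [← hopt.realPayoff_eq]
  refine le_trans ?_ hval
  have j2 : ∫ t in Ioi 0, Real.exp (-ρ * t) * U₂ (x t) ≤
      ∫ t in Ioi 0, Real.exp (-ρ * t) * U₂ (x' t) :=
    setIntegral_mono_on hopt.finite hfin' measurableSet_Ioi fun t ht => by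
      have ht0 := le_of_lt (mem_Ioi.1 ht)
      have := hP.state.mono (mem_Ioi.2 (hadm.state_pos t ht0)) (mem_Ioi.2 (hx0' t ht0)) (hxx' t ht0)
      gcongr
  set g := k * (Real.exp (-ρ * δ) * deriv U₁ (b + k)) with hg
  have j1 : (∫ t in Ioi 0, Real.exp (-ρ * t) * U₁ (c t)) + m * g ≤
      ∫ t in Ioi 0, Real.exp (-ρ * t) * U₁ (c' t) := by
    rw [← integral_Ioi_indicator_const hE hEδ g, ← integral_add (hP.integrable_consumption hadm)
      (integrable_indicator_const hE hEδ g).integrableOn]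
    refine setIntegral_mono_on ((hP.integrable_consumption hadm).add
      (integrable_indicator_const hE hEδ g).integrableOn) (hP.integrable_consumption hadm')
      measurableSet_Ioi fun t ht => ?_
    have ht0 := le_of_lt (mem_Ioi.1 ht)
    by_cases htE : t ∈ E
    · simp only [hc', indicator_of_mem htE]
      have hct := hadm.control_nonneg t ht0
      have e1 := hP.consumption.le_tangent (u := c t + k) (v := c t) (by linarith) hct
      have e2 : deriv U₁ (b + k) ≤ deriv U₁ (c t + k) :=
        hP.consumption.strictAntiOn_deriv.antitoneOn (mem_Ioi.2 (by linarith))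
          (mem_Ioi.2 (by linarith [hcb t htE])) (by linarith [hcb t htE])
      have e3 := hP.consumption.deriv_pos (b + k) (by linarith [hcb t htE])
      have e4 : Real.exp (-ρ * δ) ≤ Real.exp (-ρ * t) := by
        apply Real.exp_le_exp.2
        have := hP.discount_pos
        nlinarith [(hEδ htE).2]
      have e5 : k * (Real.exp (-ρ * δ) * deriv U₁ (b + k)) ≤
          k * (Real.exp (-ρ * t) * deriv U₁ (c t + k)) := by gcongr
      have e6 := mul_le_mul_of_nonneg_left e1 (Real.exp_pos (-ρ * t)).le
      rw [hg]
      nlinarith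
    · simp [hc', indicator_of_notMem htE]
  have e7 : m * g = h * (Real.exp (-ρ * δ) * deriv U₁ (b + k)) := by
    rw [hg, hk]; field_simp
  rw [realPayoff, realPayoff]
  linarith

/-- A deficit `h` of initial capital can be compensated by consuming less on `E`. -/
lemma IsOptimalPair.realValue_sub_ge (hP : IsControlProblem T A C ρ f D U₁ U₂)
    (hm : HasFadingMemory T A B D)
    (hη : IsHistory T η₁) (hopt : IsOptimalPair T ρ f U₁ U₂ D η₀ η₁ c x)
    {δ b h κ μ K : ℝ} (hδ : 0 ≤ δ)
    (hκ : (C * (1 + A) + C * B) * Real.exp (C * (1 + A) * δ) * δ ≤ κ)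
    (hE : MeasurableSet E) (hEδ : E ⊆ Ioc 0 δ) (hE0 : 0 < volume.real E)
    (hcb : ∀ t ∈ E, b ≤ c t) (hh : 0 < h) (hhη : h < η₀) (hhb : (1 + κ) * h / volume.real E < b)
    (hμ : 0 < μ) (hxμ : ∀ t ∈ Icc 0 δ, 2 * μ ≤ x t) (hhμ : h * Real.exp (C * (1 + A) * δ) ≤ μ)
    (hK0 : 0 ≤ K)
    (hK : ∀ y z d, μ ≤ y → 0 < z → 0 ≤ d → z ≤ y + d → U₂ z - U₂ y ≤ K * d) :
    realValue T ρ f U₁ U₂ D η₀ η₁ - h * ((1 + κ) * deriv U₁ (b - (1 + κ) * h / volume.real E) +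
      K * Real.exp (C * (1 + A) * δ) * δ) ≤
      realValue T ρ f U₁ U₂ D (η₀ - h) η₁ := by
  set m := volume.real E with hmE
  have hκ0 : 0 ≤ κ := by
    refine le_trans ?_ hκ
    have h1 := hP.production.const_nonneg
    have h2 := hP.delay.const_nonneg
    have h3 := hm.const_nonneg
    positivity
  -- Consuming k less on E saves (1 + κ) h by time δ, the amount that `IsSolution.overtake`
  -- requires.
  set k := (1 + κ) * h / m with hk
  have hk0 : 0 < k := by positivity
  have hadm := hopt.admissible
  set c' : ℝ → ℝ := fun t => c t + E.indicator (fun _ => -k) t with hc'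
  have hcl' := locallyIntegrableOn_add_indicator hadm.locallyIntegrable hE hEδ (-k)
  have hc0' : ∀ t, 0 ≤ t → 0 ≤ c' t := fun t ht => by
    by_cases htE : t ∈ E
    · simp only [hc', indicator_of_mem htE]
      linarith [hcb t htE]
    · simp only [hc', indicator_of_notMem htE, add_zero]
      exact hadm.control_nonneg t ht
  obtain ⟨x', hx'⟩ := exists_solution hP.production hP.delay (η₀ - h) hη.integrable hcl'
  set d := h * Real.exp (C * (1 + A) * δ) with hd
  obtain ⟨hearly, hlate⟩ := hadm.solution.overtake hP.production hP.delay hm hη hh.le hδ hκ hx'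
    (fun t ht => by
      rw [integral_add_indicator hadm.locallyIntegrable hE hEδ _ ht]
      have := mul_nonneg (measureReal_nonneg (μ := volume) (s := E ∩ Ioc 0 t)) hk0.le
      linarith)
    (fun t ht => by
      rw [integral_add_indicator hadm.locallyIntegrable hE hEδ _ (hδ.trans ht),
        inter_eq_left.2 (hEδ.trans (Ioc_subset_Ioc_right ht)), ← hmE]
      have : m * k = (1 + κ) * h := by rw [hk]; field_simp
      linarith)
  rw [← hd] at hearly
  have hx0' : ∀ t, 0 ≤ t → 0 < x' t := fun t ht => by
    rcases le_total t δ with htδ | htδ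
    · have := hearly t ⟨ht, htδ⟩
      have := hxμ t ⟨ht, htδ⟩
      linarith
    · exact (hadm.state_pos t ht).trans_le (hlate t htδ)
  have hd0 : 0 ≤ d := mul_nonneg hh.le (Real.exp_pos _).le
  have hadm' : IsAdmissiblePair T f D (η₀ - h) η₁ c' x' := ⟨hcl', hc0', hx', hx0'⟩
  have hρ := hP.discount_pos
  have hUle : ∀ t ∈ Ioi (0 : ℝ), Real.exp (-ρ * t) * U₂ (x t) -
      (Ioc 0 δ).indicator (fun _ => K * d) t ≤ Real.exp (-ρ * t) * U₂ (x' t) := by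
    intro t ht
    have ht0 := le_of_lt (mem_Ioi.1 ht)
    have he := Real.exp_pos (-ρ * t)
    by_cases htδ : t ≤ δ
    · rw [indicator_of_mem (show t ∈ Ioc 0 δ from ⟨ht, htδ⟩)]
      have h1 := hearly t ⟨ht0, htδ⟩
      have h2 := hxμ t ⟨ht0, htδ⟩
      have h3 := hK (x' t) (x t) d (by linarith) (hadm.state_pos t ht0) hd0 h1
      have h4 : Real.exp (-ρ * t) ≤ 1 := Real.exp_le_one_iff.2 (by nlinarith)
      have h5 : 0 ≤ K * d := mul_nonneg hK0 hd0
      have h6 := mul_le_mul_of_nonneg_left h3 he.le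
      have h7 := mul_le_mul_of_nonneg_right h4 h5
      linarith
    · rw [indicator_of_notMem (fun h => htδ h.2), sub_zero]
      have h1 := hP.state.mono (mem_Ioi.2 (hadm.state_pos t ht0)) (mem_Ioi.2 (hx0' t ht0))
        (hlate t (not_le.1 htδ).le)
      gcongr
  have hi2 : IntegrableOn (fun t => Real.exp (-ρ * t) * U₂ (x t) -
      (Ioc 0 δ).indicator (fun _ => K * d) t) (Ioi 0) :=
    Integrable.sub hopt.finite
      (integrable_indicator_const measurableSet_Ioc Subset.rfl (K * d)).integrableOn
  have hfin' : HasFinitePayoff ρ U₂ x' := hP.state.finite_of_le hi2 hx'.continuousOn hx0' hUle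
  have hval := hP.realPayoff_le_realValue hη (by linarith) hadm' hfin'
  rw [← hopt.realPayoff_eq]
  refine le_trans ?_ hval
  have j2 : (∫ t in Ioi 0, Real.exp (-ρ * t) * U₂ (x t)) - δ * (K * d) ≤
      ∫ t in Ioi 0, Real.exp (-ρ * t) * U₂ (x' t) := by
    have := setIntegral_mono_on hi2 hfin' measurableSet_Ioi hUle
    rw [integral_sub hopt.finite
      (integrable_indicator_const measurableSet_Ioc Subset.rfl (K * d)).integrableOn,
      integral_Ioi_indicator_const measurableSet_Ioc Subset.rfl] at this
    simpa [measureReal_def, hδ] using this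
  set g := k * deriv U₁ (b - k) with hg
  have j1 : (∫ t in Ioi 0, Real.exp (-ρ * t) * U₁ (c t)) - m * g ≤
      ∫ t in Ioi 0, Real.exp (-ρ * t) * U₁ (c' t) := by
    have hi1 := (integrable_indicator_const hE hEδ g).integrableOn (s := Ioi 0)
    rw [← integral_Ioi_indicator_const hE hEδ g, ← integral_sub (hP.integrable_consumption hadm)
      hi1]
    refine setIntegral_mono_on ((hP.integrable_consumption hadm).sub hi1)
      (hP.integrable_consumption hadm') measurableSet_Ioi fun t ht => ?_
    have ht0 := le_of_lt (mem_Ioi.1 ht)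
    by_cases htE : t ∈ E
    · simp only [hc', indicator_of_mem htE]
      have hct := hcb t htE
      have e1 := hP.consumption.le_tangent (u := c t + -k) (v := c t) (by linarith)
        (hadm.control_nonneg t ht0)
      have e2 : deriv U₁ (c t + -k) ≤ deriv U₁ (b - k) :=
        hP.consumption.strictAntiOn_deriv.antitoneOn (mem_Ioi.2 (by linarith))
          (mem_Ioi.2 (by linarith)) (by linarith)
      have e3 := hP.consumption.deriv_pos (b - k) (by linarith)
      have he := Real.exp_pos (-ρ * t)
      have h4 : Real.exp (-ρ * t) ≤ 1 := Real.exp_le_one_iff.2 (by nlinarith)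
      have e5 : U₁ (c t) - k * deriv U₁ (b - k) ≤ U₁ (c t + -k) := by nlinarith
      have e6 := mul_le_mul_of_nonneg_left e5 he.le
      have e7 : Real.exp (-ρ * t) * (k * deriv U₁ (b - k)) ≤ k * deriv U₁ (b - k) := by
        have : 0 ≤ k * deriv U₁ (b - k) := by positivity
        nlinarith
      rw [hg]
      linarith
    · simp [hc', indicator_of_notMem htE]
  have e7 : m * g = h * ((1 + κ) * deriv U₁ (b - k)) := by
    rw [hg, hk]; field_simp
  have e8 : δ * (K * d) = h * (K * Real.exp (C * (1 + A) * δ) * δ) := by rw [hd]; ring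
  rw [realPayoff, realPayoff]
  linarith

end Perturbation

/-! ### Essential values from the right. -/

section RightDensity

/-- An elementary substitute for Lebesgue density that needs no measurability of E: for each
rational b, the points t < b of E with E ∩ (t,b] null form a null set. -/
lemma ae_right_accumulation (E : Set ℝ) :
    ∀ᵐ t, t ∈ E → ∀ δ, 0 < δ → 0 < volume (Ioc t (t + δ) ∩ E) := by
  have hb : ∀ b : ℚ, volume {t | t ∈ E ∧ t < b ∧ volume (Ioc t (b : ℝ) ∩ E) = 0} = 0 := by
    intro b
    set B : Set ℝ := {t | t ∈ E ∧ t < b ∧ volume (Ioc t (b : ℝ) ∩ E) = 0} with hB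
    -- If r < t are both in B, then near t the set B is contained in E ∩ (r,b], which is null. Only
    -- a least element of B can escape this argument.
    have h1 : volume {t | t ∈ B ∧ ∃ r ∈ B, r < t} = 0 := by
      refine measure_null_of_locally_null _ ?_
      rintro t ⟨ht, r, hr, hrt⟩
      refine ⟨Ioi r ∩ {t | t ∈ B ∧ ∃ r ∈ B, r < t},
        inter_mem (mem_nhdsWithin_of_mem_nhds (Ioi_mem_nhds hrt)) self_mem_nhdsWithin, ?_⟩
      refine measure_mono_null (t := Ioc r (b : ℝ) ∩ E) ?_ hr.2.2
      rintro s ⟨hs1, ⟨hs2, hs3, -⟩, -⟩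
      exact ⟨⟨hs1, hs3.le⟩, hs2⟩
    have h2 : (B \ {t | t ∈ B ∧ ∃ r ∈ B, r < t}).Subsingleton := by
      intro s hs t ht
      by_contra hne
      rcases lt_or_gt_of_ne hne with h | h
      · exact ht.2 ⟨ht.1, s, hs.1, h⟩
      · exact hs.2 ⟨hs.1, t, ht.1, h⟩
    have h3 := h2.measure_zero (volume : Measure ℝ)
    refine measure_mono_null (t := {t | t ∈ B ∧ ∃ r ∈ B, r < t} ∪
      (B \ {t | t ∈ B ∧ ∃ r ∈ B, r < t})) (fun t ht => ?_) (measure_union_null h1 h3)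
    by_cases h : t ∈ {t | t ∈ B ∧ ∃ r ∈ B, r < t}
    · exact Or.inl h
    · exact Or.inr ⟨ht, h⟩
  have hall : ∀ᵐ t, ∀ b : ℚ, ¬ (t ∈ E ∧ t < b ∧ volume (Ioc t (b : ℝ) ∩ E) = 0) :=
    ae_all_iff.2 fun b => by
      rw [ae_iff]
      simpa only [not_not] using hb b
  filter_upwards [hall] with t ht htE δ hδ
  obtain ⟨b, hb1, hb2⟩ := exists_rat_btwn (show t < t + δ by linarith)
  refine pos_iff_ne_zero.2 fun h0 => ht b ⟨htE, hb1, measure_mono_null ?_ h0⟩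
  exact inter_subset_inter_left _ (Ioc_subset_Ioc_right hb2.le)

/-- Almost every value of a function is attained approximately, on a set of positive measure,
immediately to the right. -/
lemma ae_right_essential (c : ℝ → ℝ) :
    ∀ᵐ t, ∀ δ, 0 < δ → ∀ ζ, 0 < ζ → 0 < volume (Ioc t (t + δ) ∩ {s | |c s - c t| < ζ}) := by
  have hall : ∀ᵐ t, ∀ q r : ℚ, t ∈ c ⁻¹' Ioo (q : ℝ) r → ∀ δ, 0 < δ →
      0 < volume (Ioc t (t + δ) ∩ c ⁻¹' Ioo (q : ℝ) r) :=
    ae_all_iff.2 fun q => ae_all_iff.2 fun r => ae_right_accumulation _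
  filter_upwards [hall] with t ht δ hδ ζ hζ
  obtain ⟨q, hq1, hq2⟩ := exists_rat_btwn (show c t - ζ < c t by linarith)
  obtain ⟨r, hr1, hr2⟩ := exists_rat_btwn (show c t < c t + ζ by linarith)
  refine (ht q r ⟨hq2, hr1⟩ δ hδ).trans_le (measure_mono (inter_subset_inter_right _ ?_))
  intro s hs
  have hs' : (q : ℝ) < c s ∧ c s < r := hs
  change |c s - c t| < ζ
  exact abs_lt.2 ⟨by linarith [hs'.1], by linarith [hs'.2]⟩

end RightDensity

/-! ### One-sided derivatives of concave functions. -/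

section OneSided

variable {v : ℝ → ℝ} {a : ℝ}

lemma ConcaveOn.exists_oneSided_derivatives (hv : ConcaveOn ℝ (Ioi 0) v) (ha : 0 < a) :
    ∃ pl pr, pr ≤ pl ∧ HasDerivWithinAt v pr (Ioi a) a ∧ HasDerivWithinAt v pl (Iio a) a := by
  have hint : a ∈ interior (Ioi (0 : ℝ)) := by rw [interior_Ioi]; exact ha
  have h1 := hv.neg.hasDerivWithinAt_rightDeriv_of_mem_interior hint
  have h2 := hv.neg.hasDerivWithinAt_leftDeriv_of_mem_interior hint
  have h3 := hv.neg.leftDeriv_le_rightDeriv_of_mem_interior hint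
  refine ⟨_, _, neg_le_neg h3, ?_, ?_⟩
  · simpa using h1.neg
  · simpa using h2.neg

/-- The gain φ h per unit of capital may vary with h, because marginal utility is evaluated at a
consumption level displaced by a multiple of h. -/
lemma le_rightDeriv {pr l : ℝ} (h : HasDerivWithinAt v pr (Ioi a) a) {φ : ℝ → ℝ}
    (hφ : Tendsto φ (𝓝[>] 0) (𝓝 l)) (hle : ∀ᶠ h in 𝓝[>] (0 : ℝ), v a + h * φ h ≤ v (a + h)) :
    l ≤ pr := by
  rw [hasDerivWithinAt_iff_tendsto_slope' (by simp)] at h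
  have hsh : Tendsto (fun h : ℝ => a + h) (𝓝[>] 0) (𝓝[>] a) := by
    refine tendsto_nhdsWithin_iff.2 ⟨?_, ?_⟩
    · have : Tendsto (fun h : ℝ => a + h) (𝓝 0) (𝓝 (a + 0)) :=
        (continuous_const.add continuous_id).tendsto 0
      rw [add_zero] at this
      exact this.mono_left nhdsWithin_le_nhds
    · filter_upwards [self_mem_nhdsWithin] with h hh
      have := mem_Ioi.1 hh
      simpa using this
  refine le_of_tendsto_of_tendsto hφ (h.comp hsh) ?_
  filter_upwards [hle, self_mem_nhdsWithin] with h h1 h2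
  simp only [Function.comp, slope_def_field, add_sub_cancel_left]
  rw [le_div_iff₀ h2]
  linarith

lemma leftDeriv_le {pl l : ℝ} (h : HasDerivWithinAt v pl (Iio a) a) {φ : ℝ → ℝ}
    (hφ : Tendsto φ (𝓝[>] 0) (𝓝 l)) (hle : ∀ᶠ h in 𝓝[>] (0 : ℝ), v a - h * φ h ≤ v (a - h)) :
    pl ≤ l := by
  rw [hasDerivWithinAt_iff_tendsto_slope' (by simp)] at h
  have hsh : Tendsto (fun h : ℝ => a - h) (𝓝[>] 0) (𝓝[<] a) := by
    refine tendsto_nhdsWithin_iff.2 ⟨?_, ?_⟩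
    · have : Tendsto (fun h : ℝ => a - h) (𝓝 0) (𝓝 (a - 0)) :=
        (continuous_const.sub continuous_id).tendsto 0
      rw [sub_zero] at this
      exact this.mono_left nhdsWithin_le_nhds
    · filter_upwards [self_mem_nhdsWithin] with h hh
      have := mem_Ioi.1 hh
      simpa using this
  refine le_of_tendsto_of_tendsto (h.comp hsh) hφ ?_
  filter_upwards [hle, self_mem_nhdsWithin] with h h1 h2
  have h2' : 0 < h := h2
  simp only [Function.comp, slope_def_field, sub_sub_cancel_left]
  rw [div_le_iff_of_neg (by linarith)]
  linarith

lemma hasDerivAt_of_oneSided {p : ℝ} (h1 : HasDerivWithinAt v p (Ioi a) a)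
    (h2 : HasDerivWithinAt v p (Iio a) a) : HasDerivAt v p a := by
  have := h2.union h1
  rw [Iio_union_Ioi] at this
  rw [hasDerivAt_iff_tendsto_slope]
  exact (hasDerivWithinAt_iff_tendsto_slope' (by simp)).1 this

end OneSided

/-! ### Differentiability of the value and the feedback form of optimal controls. -/

section Feedback

variable {T A B C ρ : ℝ} {f : ℝ → ℝ → ℝ} {D : (ℝ → ℝ) → ℝ → ℝ} {U₁ U₂ : ℝ → ℝ}
  {η₀ : ℝ} {η₁ c x : ℝ → ℝ}

/-- The control is only almost everywhere measurable, so the level set is merely null measurable;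
perturbations need a genuinely measurable set inside it. -/
lemma exists_measurable_essential (hc : LocallyIntegrableOn c (Ici 0)) {δ c₀ ζ : ℝ}
    (h : 0 < volume (Ioc 0 δ ∩ {s | |c s - c₀| < ζ})) :
    ∃ E, MeasurableSet E ∧ E ⊆ Ioc 0 δ ∧ 0 < volume.real E ∧ ∀ s ∈ E, |c s - c₀| < ζ := by
  have hm := aestronglyMeasurable_control hc
  have hn : NullMeasurableSet {s | |c s - c₀| < ζ} (volume.restrict (Ioi 0)) :=
    nullMeasurableSet_lt ((hm.sub aestronglyMeasurable_const).norm.aemeasurable) aemeasurable_const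
  have hn' : NullMeasurableSet (Ioc 0 δ ∩ {s | |c s - c₀| < ζ}) volume := by
    have h1 := (nullMeasurableSet_restrict measurableSet_Ioi.nullMeasurableSet).1 hn
    have h2 := h1.inter (measurableSet_Ioc (a := (0 : ℝ)) (b := δ)).nullMeasurableSet
    convert h2 using 1
    ext s; simp only [mem_inter_iff, mem_Ioc, mem_Ioi]; tauto
  obtain ⟨E, hE, hEm, hEe⟩ := hn'.exists_measurable_subset_ae_eq
  refine ⟨E, hEm, fun s hs => (hE hs).1, ?_, fun s hs => (hE hs).2⟩
  rw [← measure_congr hEe] at h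
  refine ENNReal.toReal_pos h.ne' ?_
  exact ((measure_mono fun s hs => (hE hs).1).trans_lt (by simp : volume (Ioc 0 δ) < ⊤)).ne

lemma ConsumptionUtility.tendsto_deriv (hU : ConsumptionUtility U₁) {b : ℝ} (hb : 0 < b)
    {l : Filter ℝ} {g : ℝ → ℝ} (hg : Tendsto g l (𝓝 b)) :
    Tendsto (fun h => deriv U₁ (g h)) l (𝓝 (deriv U₁ b)) :=
  (hU.continuousOn_deriv.continuousAt (Ioi_mem_nhds hb)).tendsto.comp hg

lemma _root_.Continuous.tendsto_nhdsGT_zero {g : ℝ → ℝ} (hg : Continuous g) {l : ℝ} (hl : g 0 = l) :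
    Tendsto g (𝓝[>] 0) (𝓝 l) := by
  rw [← hl]; exact (hg.tendsto 0).mono_left nhdsWithin_le_nhds

/-- The value function is differentiable along optimal pairs, and the derivative is the marginal
utility of the essential values of the optimal control. -/
theorem IsOptimalPair.exists_hasDerivAt (hP : IsControlProblem T A C ρ f D U₁ U₂)
    (hm : HasFadingMemory T A B D) (hη : IsHistory T η₁) (hη₀ : 0 < η₀)
    (hopt : IsOptimalPair T ρ f U₁ U₂ D η₀ η₁ c x) :
    ∃ p, 0 < p ∧ HasDerivAt (fun s => realValue T ρ f U₁ U₂ D s η₁) p η₀ ∧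
      ∀ c₀, 0 ≤ c₀ → (∀ δ, 0 < δ → ∀ ζ, 0 < ζ → 0 < volume (Ioc 0 δ ∩ {s | |c s - c₀| < ζ})) →
        0 < c₀ ∧ deriv U₁ c₀ = p := by
  have hadm := hopt.admissible
  have hU := hP.consumption
  obtain ⟨pl, pr, hle, hpr, hpl⟩ := ConcaveOn.exists_oneSided_derivatives (hP.concaveOn_realValue hη) hη₀
  -- Consuming the extra capital where c is below b bounds the right derivative from below.
  have hR : ∀ δ c₀ : ℝ, 0 < δ → 0 ≤ c₀ →
      (∀ ζ, 0 < ζ → 0 < volume (Ioc 0 δ ∩ {s | |c s - c₀| < ζ})) →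
      ∀ b, c₀ < b → Real.exp (-ρ * δ) * deriv U₁ b ≤ pr := by
    intro δ c₀ hδ hc₀ hess b hb
    obtain ⟨E, hE, hEδ, hE0, hEc⟩ := exists_measurable_essential hadm.locallyIntegrable
      (hess (b - c₀) (by linarith))
    refine le_rightDeriv hpr (φ := fun h => Real.exp (-ρ * δ) * deriv U₁ (b + h / volume.real E))
      (Tendsto.const_mul _ (hU.tendsto_deriv (by linarith) ?_)) ?_
    · exact (by fun_prop : Continuous fun h : ℝ => b + h / volume.real E).tendsto_nhdsGT_zero
        (by simp)
    · filter_upwards [self_mem_nhdsWithin] with h hh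
      exact hopt.realValue_add_ge hP hη hη₀ hE hEδ hE0
        (fun t ht => by linarith [(abs_lt.1 (hEc t ht)).2]) hh
  have hRpos : ∀ δ c₀ : ℝ, 0 < δ → 0 ≤ c₀ →
      (∀ ζ, 0 < ζ → 0 < volume (Ioc 0 δ ∩ {s | |c s - c₀| < ζ})) →
      0 < c₀ ∧ Real.exp (-ρ * δ) * deriv U₁ c₀ ≤ pr := by
    intro δ c₀ hδ hc₀ hess
    -- If c₀ were 0, the marginal utility near 0 would be bounded by a multiple of the right
    -- derivative, contrary to U₁'(0⁺) = +∞.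
    have hpos : 0 < c₀ := by
      refine lt_of_le_of_ne hc₀ fun h0 => ?_
      subst h0
      have h1 : ∀ᶠ b in 𝓝[>] (0 : ℝ), Real.exp (ρ * δ) * pr < deriv U₁ b ∧ 0 < b :=
        (hU.deriv_zero.eventually_gt_atTop _).and self_mem_nhdsWithin
      obtain ⟨b, hb1, hb2⟩ := h1.exists
      have h2 := hR δ 0 hδ le_rfl hess b hb2
      have h3 := mul_lt_mul_of_pos_left hb1 (Real.exp_pos (-ρ * δ))
      rw [← mul_assoc, ← Real.exp_add] at h3
      have : -ρ * δ + ρ * δ = 0 := by ring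
      rw [this, Real.exp_zero, one_mul] at h3
      linarith
    refine ⟨hpos, le_of_tendsto (x := 𝓝[>] (0 : ℝ))
      (Tendsto.const_mul _ (hU.tendsto_deriv (g := fun h => c₀ + h) hpos ?_)) ?_⟩
    · exact (by fun_prop : Continuous fun h : ℝ => c₀ + h).tendsto_nhdsGT_zero (by simp)
    · filter_upwards [self_mem_nhdsWithin] with h hh
      exact hR δ c₀ hδ hc₀ hess _ (by have := mem_Ioi.1 hh; linarith)
  obtain ⟨t₀, ht₀, hmin⟩ := isCompact_Icc.exists_isMinOn (nonempty_Icc.2 zero_le_one)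
    (hadm.solution.continuousOn.mono (Icc_subset_Ici_self : Icc (0 : ℝ) 1 ⊆ Ici 0))
  -- Half the minimum of the state on [0,1], so that the trajectory with a small deficit remains
  -- above μ, where U₂ is one-sidedly Lipschitz.
  set μ := x t₀ / 2 with hμ
  have hμ0 : 0 < μ := half_pos (hadm.state_pos t₀ ht₀.1)
  obtain ⟨K, hK0, hK⟩ := hP.state.exists_lipschitz hμ0
  set L := C * (1 + A) with hL
  set κ : ℝ → ℝ := fun δ => (L + C * B) * Real.exp (L * δ) * δ with hκ
  set r : ℝ → ℝ := fun δ => K * Real.exp (L * δ) * δ with hr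
  have hκc : Continuous κ := by fun_prop
  have hrc : Continuous r := by fun_prop
  have hκ0 : ∀ δ, 0 ≤ δ → 0 ≤ κ δ := fun δ hδ => by
    have h1 := hP.production.const_nonneg
    have h2 := hP.delay.const_nonneg
    have h3 := hm.const_nonneg
    simp only [hκ, hL]
    positivity
  -- Saving where c is near c₀ bounds the left derivative from above; both errors, κ for the
  -- additional saving and r for the loss of state utility, are O(δ).
  have hLft : ∀ δ c₀ : ℝ, 0 < δ → δ ≤ 1 → 0 < c₀ →
      (∀ ζ, 0 < ζ → 0 < volume (Ioc 0 δ ∩ {s | |c s - c₀| < ζ})) →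
      pl ≤ (1 + κ δ) * deriv U₁ c₀ + r δ := by
    intro δ c₀ hδ hδ1 hc₀ hess
    have hstep : ∀ b, 0 < b → b < c₀ → pl ≤ (1 + κ δ) * deriv U₁ b + r δ := by
      intro b hb0 hb
      obtain ⟨E, hE, hEδ, hE0, hEc⟩ := exists_measurable_essential hadm.locallyIntegrable
        (hess (c₀ - b) (by linarith))
      refine leftDeriv_le hpl (φ := fun h =>
        (1 + κ δ) * deriv U₁ (b - (1 + κ δ) * h / volume.real E) + r δ)
        ((Tendsto.const_mul _ (hU.tendsto_deriv hb0 ?_)).add_const _) ?_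
      · exact (by fun_prop : Continuous fun h : ℝ =>
          b - (1 + κ δ) * h / volume.real E).tendsto_nhdsGT_zero (by simp)
      · have e1 : ∀ᶠ h in 𝓝[>] (0 : ℝ), (1 + κ δ) * h / volume.real E < b :=
          ((by fun_prop : Continuous fun h : ℝ =>
            (1 + κ δ) * h / volume.real E).tendsto_nhdsGT_zero (l := 0) (by simp)).eventually_lt_const
              hb0
        have e2 : ∀ᶠ h in 𝓝[>] (0 : ℝ), h * Real.exp (L * δ) < μ :=
          ((by fun_prop : Continuous fun h : ℝ =>
            h * Real.exp (L * δ)).tendsto_nhdsGT_zero (l := 0) (by simp)).eventually_lt_const hμ0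
        have e3 : ∀ᶠ h in 𝓝[>] (0 : ℝ), h < η₀ :=
          (continuous_id.tendsto_nhdsGT_zero (l := 0) rfl).eventually_lt_const hη₀
        filter_upwards [e1, e2, e3, self_mem_nhdsWithin] with h h1 h2 h3 hh
        exact hopt.realValue_sub_ge hP hm hη hδ.le le_rfl hE hEδ hE0
          (fun t ht => by linarith [(abs_lt.1 (hEc t ht)).1]) hh h3 h1 hμ0
          (fun t ht => by
            have := hmin (show t ∈ Icc (0 : ℝ) 1 from ⟨ht.1, ht.2.trans hδ1⟩)
            simp only [mem_ofPred_eq] at this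
            rw [hμ]; linarith) h2.le hK0 hK
    refine ge_of_tendsto (x := 𝓝[>] (0 : ℝ)) (f := fun h => (1 + κ δ) * deriv U₁ (c₀ - h) + r δ)
      ((Tendsto.const_mul _ (hU.tendsto_deriv hc₀ ?_)).add_const _) ?_
    · exact (by fun_prop : Continuous fun h : ℝ => c₀ - h).tendsto_nhdsGT_zero (by simp)
    · have e3 : ∀ᶠ h in 𝓝[>] (0 : ℝ), h < c₀ :=
        (continuous_id.tendsto_nhdsGT_zero (l := 0) rfl).eventually_lt_const hc₀
      filter_upwards [e3, self_mem_nhdsWithin] with h h1 h2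
      have := mem_Ioi.1 h2
      exact hstep _ (by linarith) (by linarith)
  -- The control need not have an essential value at time 0, but on each (0,δ] it has one, possibly
  -- depending on δ.
  have hexess : ∀ δ : ℝ, 0 < δ → ∃ c₀, 0 ≤ c₀ ∧
      ∀ ζ, 0 < ζ → 0 < volume (Ioc 0 δ ∩ {s | |c s - c₀| < ζ}) := by
    intro δ hδ
    have hne : volume (Ioo 0 (δ / 2)) ≠ 0 := by simp [hδ]
    obtain ⟨t, ht, hess⟩ :=
      ((frequently_ae_mem_iff.2 hne).and_eventually (ae_right_essential c)).exists
    refine ⟨c t, hadm.control_nonneg t ht.1.le, fun ζ hζ => ?_⟩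
    refine (hess (δ / 2) (by linarith) ζ hζ).trans_le (measure_mono (inter_subset_inter_left _ ?_))
    exact Ioc_subset_Ioc ht.1.le (by linarith [ht.2])
  have hsmall : ∀ᶠ δ in 𝓝[>] (0 : ℝ), 0 < δ ∧ δ ≤ 1 := by
    filter_upwards [self_mem_nhdsWithin,
      (continuous_id.tendsto_nhdsGT_zero (l := 0) rfl).eventually_le_const one_pos] with δ h1 h2
    exact ⟨h1, h2⟩
  -- The marginal utility at the value c₀ belonging to δ is eliminated between the two bounds before
  -- δ tends to 0.
  have hplpr : pl ≤ pr := by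
    refine ge_of_tendsto (x := 𝓝[>] (0 : ℝ))
      (f := fun δ => (1 + κ δ) * (Real.exp (ρ * δ) * pr) + r δ)
      ((by fun_prop : Continuous fun δ =>
        (1 + κ δ) * (Real.exp (ρ * δ) * pr) + r δ).tendsto_nhdsGT_zero (by simp [hκ, hr])) ?_
    filter_upwards [hsmall] with δ hδ
    obtain ⟨c₀, hc₀, hess⟩ := hexess δ hδ.1
    obtain ⟨hpos, h1⟩ := hRpos δ c₀ hδ.1 hc₀ hess
    refine (hLft δ c₀ hδ.1 hδ.2 hpos hess).trans ?_
    have h2 : deriv U₁ c₀ ≤ Real.exp (ρ * δ) * pr := by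
      have h3 := mul_le_mul_of_nonneg_left h1 (Real.exp_pos (ρ * δ)).le
      rw [← mul_assoc, ← Real.exp_add] at h3
      have : ρ * δ + -ρ * δ = 0 := by ring
      rwa [this, Real.exp_zero, one_mul] at h3
    have h4 := hκ0 δ hδ.1.le
    gcongr
  have heq : pl = pr := le_antisymm hplpr hle
  rw [heq] at hpl
  refine ⟨pr, ?_, hasDerivAt_of_oneSided hpr hpl, fun c₀ hc₀ hess => ?_⟩
  · obtain ⟨c₀, hc₀, hess⟩ := hexess 1 one_pos
    obtain ⟨hpos, h1⟩ := hRpos 1 c₀ one_pos hc₀ hess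
    exact (mul_pos (Real.exp_pos _) (hU.deriv_pos c₀ hpos)).trans_le h1
  · obtain ⟨hpos, -⟩ := hRpos 1 c₀ one_pos hc₀ (hess 1 one_pos)
    refine ⟨hpos, le_antisymm ?_ ?_⟩
    · refine le_of_tendsto (x := 𝓝[>] (0 : ℝ)) (f := fun δ => Real.exp (-ρ * δ) * deriv U₁ c₀)
        ((by fun_prop : Continuous fun δ => Real.exp (-ρ * δ) * deriv U₁ c₀).tendsto_nhdsGT_zero
          (by simp)) ?_
      filter_upwards [hsmall] with δ hδ
      exact (hRpos δ c₀ hδ.1 hc₀ (hess δ hδ.1)).2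
    · refine ge_of_tendsto (x := 𝓝[>] (0 : ℝ)) (f := fun δ => (1 + κ δ) * deriv U₁ c₀ + r δ)
        ((by fun_prop : Continuous fun δ => (1 + κ δ) * deriv U₁ c₀ + r δ).tendsto_nhdsGT_zero
          (by simp [hκ, hr])) ?_
      filter_upwards [hsmall] with δ hδ
      rw [← heq]
      exact hLft δ c₀ hδ.1 hδ.2 hpos (hess δ hδ.1)

/-- An optimal control can be modified on a null set to an optimal feedback control. -/
theorem IsOptimalPair.exists_feedback (hP : IsControlProblem T A C ρ f D U₁ U₂) (hT : 0 < T)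
    (hm : HasFadingMemory T A B D) (hη : IsHistory T η₁) (hη₀ : 0 < η₀)
    (hopt : IsOptimalPair T ρ f U₁ U₂ D η₀ η₁ c x) :
    ∃ c', IsOptimal T ρ f U₁ U₂ D η₀ η₁ c' ∧ IsFeedback T ρ f U₁ U₂ D η₀ η₁ c' := by
  have hadm := hopt.admissible
  -- By dynamic programming the derivative p exists at every time; u is the consumption with
  -- marginal utility p. Negative times get irrelevant values.
  have hp : ∀ t : ℝ, ∃ p u : ℝ, 0 ≤ t → 0 < p ∧ 0 < u ∧ deriv U₁ u = p ∧
      HasDerivAt (fun s => realValue T ρ f U₁ U₂ D s (fun ξ => x (t + ξ))) p (x t) ∧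
      ∀ c₀, 0 ≤ c₀ → (∀ δ, 0 < δ → ∀ ζ, 0 < ζ →
        0 < volume (Ioc 0 δ ∩ {s | |c (t + s) - c₀| < ζ})) → 0 < c₀ ∧ deriv U₁ c₀ = p := by
    intro t
    rcases lt_or_ge t 0 with ht | ht
    · exact ⟨0, 0, fun h => absurd h (not_le.2 ht)⟩
    · obtain ⟨p, h1, h2, h3⟩ := (hopt.shift hP hT hη hη₀ ht).exists_hasDerivAt hP hm
        (hadm.history_shift hT hη ht) (hadm.state_pos t ht)
      obtain ⟨u, hu, hup⟩ := hP.consumption.exists_deriv_eq h1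
      exact ⟨p, u, fun _ => ⟨h1, hu, hup, h2, h3⟩⟩
  choose p u hpu using hp
  -- For almost every t the number c t is an essential value from the right, so its marginal utility
  -- is p t, and U₁' is injective.
  have hae : ∀ᵐ t, 0 ≤ t → u t = c t := by
    filter_upwards [ae_right_essential c] with t hess ht
    obtain ⟨h1, hu, hup, -, h3⟩ := hpu t ht
    obtain ⟨hc0, hcp⟩ := h3 (c t) (hadm.control_nonneg t ht) (fun δ hδ ζ hζ => by
      have h4 := hess δ hδ ζ hζ
      rw [← measure_preimage_add volume t] at h4
      convert h4 using 2
      ext s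
      simp only [mem_inter_iff, mem_Ioc, mem_ofPred_eq, mem_preimage]
      constructor
      · rintro ⟨⟨a1, a2⟩, a3⟩; exact ⟨⟨by linarith, by linarith⟩, a3⟩
      · rintro ⟨⟨a1, a2⟩, a3⟩; exact ⟨⟨by linarith, by linarith⟩, a3⟩)
    exact hP.consumption.strictAntiOn_deriv.injOn (mem_Ioi.2 hu) (mem_Ioi.2 hc0) (hup.trans hcp.symm)
  have hadm' : IsAdmissiblePair T f D η₀ η₁ u x := by
    refine ⟨locallyIntegrableOn_Ici_of_integrableOn fun S _ => ?_, fun t ht => (hpu t ht).2.1.le,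
      ⟨hadm.solution.history, hadm.solution.continuousOn, fun t ht => ?_⟩, hadm.state_pos⟩
    · refine (hadm.locallyIntegrable.integrableOn_compact_subset Icc_subset_Ici_self
        isCompact_Icc).congr ?_
      filter_upwards [ae_restrict_of_ae hae, ae_restrict_mem measurableSet_Icc] with t h1 h2
      exact (h1 h2.1).symm
    · rw [hadm.solution.integral_eq t ht]
      congr 1
      refine intervalIntegral.integral_congr_ae ?_
      filter_upwards [hae] with s hs hs'
      rw [uIoc_of_le ht] at hs'
      exact (hs hs'.1.le).symm
  have hpay : realPayoff ρ U₁ U₂ u x = realPayoff ρ U₁ U₂ c x := by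
    rw [realPayoff, realPayoff]
    congr 1
    refine setIntegral_congr_ae measurableSet_Ioi ?_
    filter_upwards [hae] with t h1 h2
    rw [h1 (le_of_lt h2)]
  refine ⟨u, (hP.isOptimal_iff hη hη₀).2 ⟨x, hadm', hopt.finite, hpay.trans hopt.realPayoff_eq⟩,
    x, hadm', fun t ht => ?_⟩
  obtain ⟨h1, hu, hup, h2, -⟩ := hpu t ht
  refine ⟨p t, h1, h2, ?_⟩
  have := hP.consumption.isMaxOn hu
  rwa [hup] at this

end Feedback

/-! ### Distributed and pointwise delays as abstract delay operators. -/

section DelayOperators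

variable {T A : ℝ} {a x x' : ℝ → ℝ}

lemma IsPath.integrableOn (hx : IsPath T x) (S : ℝ) : IntegrableOn x (Ioc (-T) S) := by
  have h1 : IntegrableOn x (Icc 0 S) :=
    (hx.continuousOn.mono Icc_subset_Ici_self).integrableOn_Icc
  refine (hx.history.union h1).mono_set fun s hs => ?_
  rcases lt_or_ge s 0 with h | h
  · exact Or.inl ⟨hs.1.le, h⟩
  · exact Or.inr ⟨h, hs.2⟩

lemma MemW12.continuousOn (hT : 0 ≤ T) (h : MemW12 T a) : ContinuousOn a (Icc (-T) 0) := by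
  obtain ⟨g, hg, hag⟩ := h
  have hgi : IntegrableOn g (Icc (-T) 0) := hg.integrable (by norm_num)
  have := intervalIntegral.continuousOn_primitive_interval (f := g) (μ := volume) (a := -T) (b := 0)
    (by rwa [uIcc_of_le (by linarith)])
  rw [uIcc_of_le (by linarith)] at this
  exact (continuousOn_const.add this).congr hag

lemma integrableOn_shift_add {z : ℝ → ℝ} {p q : ℝ} (t : ℝ) :
    IntegrableOn (fun ξ => z (t + ξ)) (Ioc p q) ↔ IntegrableOn z (Ioc (t + p) (t + q)) := by
  have h := (measurePreserving_add_left volume t).integrableOn_comp_preimage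
    (measurableEmbedding_addLeft t) (f := z) (s := Ioc (t + p) (t + q))
  rw [← h]
  have : (fun ξ => t + ξ) ⁻¹' Ioc (t + p) (t + q) = Ioc p q := by
    ext s; simp
  rw [this]; rfl

lemma IsPath.integrableOn_shift (hx : IsPath T x) {t : ℝ} (ht : 0 ≤ t) :
    IntegrableOn (fun ξ => x (t + ξ)) (Ioc (-T) 0) := by
  rw [integrableOn_shift_add]
  exact (hx.integrableOn t).mono_set (Ioc_subset_Ioc (by linarith) (by linarith))

lemma IsPath.integrableOn_mul (ha : ContinuousOn a (Icc (-T) 0)) (hx : IsPath T x) {t : ℝ}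
    (ht : 0 ≤ t) : IntegrableOn (fun ξ => a ξ * x (t + ξ)) (Ioc (-T) 0) := by
  obtain ⟨b, hb⟩ := isCompact_Icc.exists_bound_of_continuousOn ha
  refine (hx.integrableOn_shift ht).bdd_mul (c := b)
    ((ha.mono Ioc_subset_Icc_self).aestronglyMeasurable measurableSet_Ioc) ?_
  filter_upwards [ae_restrict_mem measurableSet_Ioc] with ξ hξ
  exact hb ξ (Ioc_subset_Icc_self hξ)

lemma distributedDelay_eq (hT : 0 < T) (a x : ℝ → ℝ) (t : ℝ) :
    distributedDelay T a x t = ∫ ξ in Ioc (-T) 0, a ξ * x (t + ξ) := by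
  rw [distributedDelay, intervalIntegral.integral_of_le (by linarith)]

lemma integrableOn_kernel (ha : ContinuousOn a (Icc (-T) 0)) : IntegrableOn a (Ioc (-T) 0) :=
  (ha.integrableOn_Icc).mono_set Ioc_subset_Icc_self

/-- The integrand of the convolution of two integrable functions is integrable. -/
lemma integrable_mul_comp_add {α z : ℝ → ℝ} (hα : Integrable α) (hz : Integrable z) :
    Integrable (fun p : ℝ × ℝ => α p.1 * z (p.1 + p.2)) (volume.prod volume) :=
  (measurePreserving_prod_add (volume : Measure ℝ) volume).integrable_comp_of_integrable
    (hα.mul_prod hz)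

lemma integral_indicator_mul_indicator {S t : ℝ} (ht : t ∈ Icc 0 S) :
    ∫ ξ, (Ioc (-T) 0).indicator a ξ * (Ioc (-T) S).indicator x (ξ + t) =
      ∫ ξ in Ioc (-T) 0, a ξ * x (t + ξ) := by
  rw [← integral_indicator measurableSet_Ioc]
  congr 1
  ext ξ
  by_cases h : ξ ∈ Ioc (-T) 0
  · have h2 : ξ + t ∈ Ioc (-T) S := ⟨by linarith [h.1, ht.1], by linarith [h.2, ht.2]⟩
    rw [indicator_of_mem h, indicator_of_mem h, indicator_of_mem h2, add_comm]
  · rw [indicator_of_notMem h, indicator_of_notMem h, zero_mul]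

/-- The delay term agrees on [0,S] with an integral over one variable of an integrable function on
the plane, so Fubini applies; the history is only integrable. -/
lemma intervalIntegrable_distributedDelay (hT : 0 < T) (ha : ContinuousOn a (Icc (-T) 0))
    (hx : IsPath T x) {S : ℝ} (hS : 0 ≤ S) :
    IntervalIntegrable (distributedDelay T a x) volume 0 S := by
  rw [intervalIntegrable_iff_integrableOn_Icc_of_le hS]
  have h1 := (integrable_mul_comp_add
    ((integrable_indicator_iff measurableSet_Ioc).2 (integrableOn_kernel ha))
    ((integrable_indicator_iff measurableSet_Ioc).2 (hx.integrableOn S))).integral_prod_right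
  refine (h1.integrableOn (s := Icc 0 S)).congr_fun (fun t ht => ?_) measurableSet_Icc
  rw [distributedDelay_eq hT]
  exact integral_indicator_mul_indicator ht

lemma ae_comp_add {p : ℝ → Prop} (h : ∀ᵐ s ∂(volume : Measure ℝ), p s) (t : ℝ) :
    ∀ᵐ s ∂(volume : Measure ℝ), p (t + s) :=
  (measurePreserving_add_left volume t).quasiMeasurePreserving.ae h

lemma IsHistory.ae_nonneg (h : IsHistory T x) :
    ∀ᵐ s, s ∈ Ico (-T) 0 → 0 ≤ x s :=
  (ae_restrict_iff' measurableSet_Ico).1 h.nonneg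

/-- The disturbance d on [0,δ] is seen through a window of length δ with weight at most the bound b
of the kernel, and not at all once t - δ ≥ T. A pointwise delay has no such estimate: the
disturbance returns at full size. -/
lemma distributedDelay_le_add (hT : 0 < T) (ha : ContinuousOn a (Icc (-T) 0))
    (ha0 : ∀ ξ ∈ Icc (-T) 0, 0 ≤ a ξ) {b : ℝ} (hb : ∀ ξ ∈ Icc (-T) 0, a ξ ≤ b)
    (hA : ∫ ξ in (-T)..0, a ξ ≤ A) (hx : IsPath T x) (hx' : IsPath T x')
    (hh : ∀ s ∈ Ico (-T) 0, x s = x' s) {δ t d e : ℝ} (hδ : 0 ≤ δ) (hδt : δ ≤ t) (hd : 0 ≤ d)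
    (he : 0 ≤ e) (h1 : ∀ s ∈ Icc 0 δ, x s ≤ x' s + d) (h2 : ∀ s ∈ Icc δ t, x s ≤ x' s + e) :
    distributedDelay T a x t ≤ distributedDelay T a x' t + A * e +
      (b * Real.exp T) * d * δ * Real.exp (-(t - δ)) := by
  have ht : 0 ≤ t := hδ.trans hδt
  set k := (b * Real.exp T) * d * Real.exp (-(t - δ)) with hk
  have hb0 : 0 ≤ b := (ha0 0 ⟨by linarith, le_rfl⟩).trans (hb 0 ⟨by linarith, le_rfl⟩)
  have hk0 : 0 ≤ k := by positivity
  have hki : Integrable ((Icc (-t) (δ - t)).indicator fun _ => k) (volume : Measure ℝ) :=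
    (integrable_indicator_iff measurableSet_Icc).2 (by simp)
  have key : ∀ ξ ∈ Ioc (-T) 0, a ξ * x (t + ξ) ≤
      (a ξ * x' (t + ξ) + a ξ * e) + (Icc (-t) (δ - t)).indicator (fun _ => k) ξ := by
    intro ξ hξ
    have hξ' := Ioc_subset_Icc_self hξ
    have ha0' := ha0 ξ hξ'
    have hae : 0 ≤ a ξ * e := mul_nonneg ha0' he
    rcases lt_or_ge (t + ξ) 0 with h | h
    · rw [hh (t + ξ) ⟨by linarith [hξ.1], h⟩, indicator_of_notMem (by
        rintro ⟨h3, -⟩; linarith)]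
      linarith
    · by_cases h3 : t + ξ ≤ δ
      · rw [indicator_of_mem (show ξ ∈ Icc (-t) (δ - t) from ⟨by linarith, by linarith⟩)]
        have h4 : a ξ * x (t + ξ) ≤ a ξ * (x' (t + ξ) + d) :=
          mul_le_mul_of_nonneg_left (h1 _ ⟨h, h3⟩) ha0'
        have h5 : a ξ * d ≤ k := by
          -- The window is active only if t - δ < T; the factor exp T makes the decaying exponential
          -- at least 1 there.
          have h6 : (1 : ℝ) ≤ Real.exp T * Real.exp (-(t - δ)) := by
            rw [← Real.exp_add]
            exact Real.one_le_exp (by linarith [hξ.1])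
          calc a ξ * d ≤ b * d := mul_le_mul_of_nonneg_right (hb ξ hξ') hd
            _ ≤ b * d * (Real.exp T * Real.exp (-(t - δ))) :=
              le_mul_of_one_le_right (mul_nonneg hb0 hd) h6
            _ = k := by rw [hk]; ring
        linarith
      · have h4 : a ξ * x (t + ξ) ≤ a ξ * (x' (t + ξ) + e) :=
          mul_le_mul_of_nonneg_left (h2 _ ⟨by linarith, by linarith [hξ.2]⟩) ha0'
        have h5 : 0 ≤ (Icc (-t) (δ - t)).indicator (fun _ => k) ξ :=
          indicator_nonneg (fun _ _ => hk0) ξ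
        linarith
  have hi := hx'.integrableOn_mul ha ht
  have hi2 : IntegrableOn (fun ξ => a ξ * e) (Ioc (-T) 0) := (integrableOn_kernel ha).mul_const e
  have h7 := setIntegral_mono_on (hx.integrableOn_mul ha ht)
    ((hi.add hi2).add (hki.integrableOn (s := Ioc (-T) 0))) measurableSet_Ioc key
  rw [integral_add' (hi.add hi2) hki.integrableOn, integral_add' hi hi2, integral_mul_const,
    ← intervalIntegral.integral_of_le (by linarith : -T ≤ 0) (f := a)] at h7
  have h8 : ∫ ξ in Ioc (-T) 0, (Icc (-t) (δ - t)).indicator (fun _ => k) ξ ≤ k * δ := by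
    refine (setIntegral_le_integral hki (ae_of_all _ fun ξ =>
      indicator_nonneg (fun _ _ => hk0) ξ)).trans_eq ?_
    rw [integral_indicator measurableSet_Icc, setIntegral_const, Real.volume_real_Icc_of_le
      (by linarith), smul_eq_mul]
    ring
  have h9 := mul_le_mul_of_nonneg_right hA he
  rw [distributedDelay_eq hT, distributedDelay_eq hT]
  have : (b * Real.exp T) * d * δ * Real.exp (-(t - δ)) = k * δ := by rw [hk]; ring
  linarith

lemma isDelayOp_distributedDelay (hT : 0 < T) (ha : ContinuousOn a (Icc (-T) 0))
    (ha0 : ∀ ξ ∈ Icc (-T) 0, 0 ≤ a ξ) (hA : ∫ ξ in (-T)..0, a ξ ≤ A) :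
    IsDelayOp T A (distributedDelay T a) where
  const_nonneg := (intervalIntegral.integral_nonneg (by linarith) ha0).trans hA
  le_add x x' hx hx' hh t ht d hd hle := by
    obtain ⟨b, hb⟩ := isCompact_Icc.exists_bound_of_continuousOn ha
    have := distributedDelay_le_add hT ha ha0 (fun ξ hξ => (le_abs_self _).trans (hb ξ hξ)) hA
      hx hx' hh le_rfl ht hd hd (fun s hs => hle s ⟨hs.1, hs.2.trans ht⟩) hle
    simpa using this
  combo x x' hx hx' l m t ht := by
    rw [distributedDelay_eq hT, distributedDelay_eq hT, distributedDelay_eq hT,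
      ← integral_const_mul, ← integral_const_mul, ← integral_add
        ((hx.integrableOn_mul ha ht).const_mul l) ((hx'.integrableOn_mul ha ht).const_mul m)]
    congr 1
    ext ξ
    ring
  nonneg x hx hh := by
    filter_upwards [ae_restrict_mem measurableSet_Ioi] with t ht hle
    have ht' : 0 < t := ht
    rw [distributedDelay_eq hT]
    refine setIntegral_nonneg_of_ae_restrict ?_
    filter_upwards [ae_restrict_of_ae (ae_comp_add hh.ae_nonneg t),
      ae_restrict_mem measurableSet_Ioc] with ξ h1 h2
    refine mul_nonneg (ha0 ξ (Ioc_subset_Icc_self h2)) ?_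
    rcases lt_or_ge (t + ξ) 0 with h | h
    · exact h1 ⟨by linarith [h2.1], h⟩
    · exact hle _ ⟨h, by linarith [h2.2]⟩
  integrable x hx S hS := intervalIntegrable_distributedDelay hT ha hx hS
  congr x x' t h := by
    refine intervalIntegral.integral_congr fun ξ hξ => ?_
    rw [uIcc_of_le (by linarith)] at hξ
    rw [h (t + ξ) ⟨by linarith [hξ.1], by linarith [hξ.2]⟩]
  shift x r t := by
    simp only [distributedDelay, add_assoc]

lemma hasFadingMemory_distributedDelay (hT : 0 < T) (ha : ContinuousOn a (Icc (-T) 0))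
    (ha0 : ∀ ξ ∈ Icc (-T) 0, 0 ≤ a ξ) (hA : ∫ ξ in (-T)..0, a ξ ≤ A) :
    ∃ B, HasFadingMemory T A B (distributedDelay T a) := by
  obtain ⟨b, hb⟩ := isCompact_Icc.exists_bound_of_continuousOn ha
  have hb0 : 0 ≤ b := (norm_nonneg _).trans (hb 0 ⟨by linarith, le_rfl⟩)
  exact ⟨b * Real.exp T, by positivity, fun x x' hx hx' hh δ t d e hδ hδt hd he h1 h2 =>
    distributedDelay_le_add hT ha ha0 (fun ξ hξ => (le_abs_self _).trans (hb ξ hξ)) hA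
      hx hx' hh hδ hδt hd he h1 h2⟩

/-- A bounded kernel turns an integrable history into a bounded delay term. The bound involves the
supremum of the kernel, so it is not uniform along kernels approaching a Dirac mass. -/
lemma distributedDelay_bddAbove (hT : 0 < T) (ha : ContinuousOn a (Icc (-T) 0))
    (hx : IsPath T x) (S : ℝ) : ∃ K, ∀ t ∈ Icc 0 S, distributedDelay T a x t ≤ K := by
  obtain ⟨b, hb⟩ := isCompact_Icc.exists_bound_of_continuousOn ha
  have hb0 : 0 ≤ b := (norm_nonneg _).trans (hb 0 ⟨by linarith, le_rfl⟩)
  refine ⟨b * ∫ s in Ioc (-T) S, |x s|, fun t ht => ?_⟩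
  rw [distributedDelay_eq hT]
  have h1 : ∫ ξ in Ioc (-T) 0, |x (t + ξ)| ≤ ∫ s in Ioc (-T) S, |x s| := by
    rw [← intervalIntegral.integral_of_le (by linarith),
      intervalIntegral.integral_comp_add_left (fun s => |x s|), intervalIntegral.integral_of_le
        (by linarith)]
    exact setIntegral_mono_set (hx.integrableOn S).abs (ae_of_all _ fun s => abs_nonneg _)
      (Ioc_subset_Ioc (by linarith [ht.1]) (by linarith [ht.2])).eventuallyLE
  have h2 := setIntegral_mono_on (hx.integrableOn_mul ha ht.1)
    ((hx.integrableOn_shift ht.1).abs.const_mul b) measurableSet_Ioc (fun ξ hξ => by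
      refine (le_abs_self _).trans ?_
      rw [abs_mul]
      exact mul_le_mul_of_nonneg_right (hb ξ (Ioc_subset_Icc_self hξ)) (abs_nonneg _))
  rw [integral_const_mul] at h2
  exact h2.trans (mul_le_mul_of_nonneg_left h1 hb0)

lemma isDelayOp_pointwiseDelay (hT : 0 < T) (hA : 1 ≤ A) : IsDelayOp T A (pointwiseDelay T) where
  const_nonneg := zero_le_one.trans hA
  le_add x x' hx hx' hh t ht d hd hle := by
    rw [pointwiseDelay, pointwiseDelay]
    have h1 : d ≤ A * d := le_mul_of_one_le_left hd hA
    rcases lt_or_ge (t - T / 2) 0 with h | h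
    · rw [hh (t - T / 2) ⟨by linarith, h⟩]; linarith
    · linarith [hle (t - T / 2) ⟨h, by linarith⟩]
  combo x x' hx hx' l m t ht := rfl
  nonneg x hx hh := by
    -- A pointwise delay reads off single values of the history, which are nonnegative only almost
    -- everywhere.
    have := ae_comp_add hh.ae_nonneg (-(T / 2))
    filter_upwards [ae_restrict_of_ae this, ae_restrict_mem measurableSet_Ioi] with t h1 h2 hle
    have h2' : 0 < t := h2
    rw [pointwiseDelay, sub_eq_neg_add]
    rcases lt_or_ge (-(T / 2) + t) 0 with h | h
    · exact h1 ⟨by linarith, h⟩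
    · exact hle _ ⟨h, by linarith⟩
  integrable x hx S hS := by
    rw [intervalIntegrable_iff_integrableOn_Ioc_of_le hS]
    have := (integrableOn_shift_add (z := x) (p := 0) (q := S) (-(T / 2))).2
      ((hx.integrableOn S).mono_set (Ioc_subset_Ioc (by linarith) (by linarith)))
    refine this.congr_fun (fun t _ => ?_) measurableSet_Ioc
    rw [pointwiseDelay, sub_eq_neg_add]
  congr x x' t h := h _ ⟨by linarith, by linarith⟩
  shift x r t := by simp only [pointwiseDelay, add_sub_assoc]

end DelayOperators

/-! ### Convergence of distributed delays to the pointwise delay. -/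

section DelayConvergence

variable {T : ℝ}

/-- Uniform convergence of delay operators on differences of monotone functions with
prescribed history. -/
def DelayConverges (T : ℝ) (η₁ : ℝ → ℝ) (D : ℕ → (ℝ → ℝ) → ℝ → ℝ) (D₀ : (ℝ → ℝ) → ℝ → ℝ) :
    Prop :=
  ∀ R K ε : ℝ, 0 ≤ R → 0 ≤ K → 0 < ε → ∀ᶠ k in atTop, ∀ z G₁ G₂ : ℝ → ℝ, IsPath T z →
    (∀ s ∈ Ico (-T) 0, z s = η₁ s) → (∀ t ∈ Icc 0 R, z t = G₁ t - G₂ t) →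
    MonotoneOn G₁ (Icc 0 R) → MonotoneOn G₂ (Icc 0 R) → MapsTo G₁ (Icc 0 R) (Icc 0 K) →
    MapsTo G₂ (Icc 0 R) (Icc 0 K) → ∫ t in (0 : ℝ)..R, |D k z t - D₀ z t| ≤ ε

lemma integrable_comp_const_add {h : ℝ → ℝ} (hh : Integrable h) (ξ : ℝ) :
    Integrable (fun t => h (ξ + t)) :=
  (measurePreserving_add_left volume ξ).integrable_comp_of_integrable hh

/-- Translations act continuously on L¹. -/
lemma continuous_integral_translate {h : ℝ → ℝ} (hh : Integrable h) (ζ : ℝ) :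
    Continuous fun ξ : ℝ => ∫ t, |h (ξ + t) - h (ζ + t)| := by
  have hL : MemLp h 1 := memLp_one_iff_integrable.2 hh
  have hc : Continuous fun ξ : ℝ =>
      ‖(DomAddAct.mk ξ +ᵥ hL.toLp h) - (DomAddAct.mk ζ +ᵥ hL.toLp h)‖ := by
    have : Fact ((1 : ENNReal) ≠ ⊤) := ⟨by simp⟩
    have h1 : Continuous fun ξ : ℝ => (DomAddAct.mk ξ : ℝᵈᵃᵃ) := DomAddAct.continuous_mk
    exact ((h1.vadd continuous_const).sub continuous_const).norm
  refine hc.congr fun ξ => ?_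
  rw [DomAddAct.mk_vadd_toLp, DomAddAct.mk_vadd_toLp, ← MemLp.toLp_sub, L1.norm_eq_integral_norm]
  refine integral_congr_ae ?_
  filter_upwards [MemLp.coeFn_toLp
    ((hL.comp_measurePreserving (measurePreserving_vadd ξ volume)).sub
      (hL.comp_measurePreserving (measurePreserving_vadd ζ volume)))] with t ht
  exact congrArg norm ht

/-- By monotonicity the absolute value has a constant sign, and the difference of the integrals over
two translated intervals reduces to end pieces of length |α - β|. No continuity of g enters, which
is what makes the estimate uniform in the control. -/
lemma integral_abs_shift_sub_le {g : ℝ → ℝ} (hg : Monotone g) {K : ℝ} (hK : ∀ t, g t ∈ Icc 0 K)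
    (R α β : ℝ) (hR : 0 ≤ R) :
    ∫ t in Ioc 0 R, |g (α + t) - g (β + t)| ≤ K * |α - β| := by
  wlog hle : α ≤ β generalizing α β
  · have := this β α (not_le.1 hle).le
    rw [abs_sub_comm α β]
    refine (le_of_eq ?_).trans this
    congr 1
    ext t
    exact abs_sub_comm _ _
  have hi : ∀ a b, IntervalIntegrable g volume a b := fun a b => hg.intervalIntegrable
  have hi' : ∀ γ a b, IntervalIntegrable (fun t => g (γ + t)) volume a b := fun γ a b =>
    (hg.comp (monotone_id.const_add γ)).intervalIntegrable
  rw [← intervalIntegral.integral_of_le hR]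
  have h1 : ∫ t in (0 : ℝ)..R, |g (α + t) - g (β + t)| =
      (∫ t in (0 : ℝ)..R, g (β + t)) - ∫ t in (0 : ℝ)..R, g (α + t) := by
    rw [← intervalIntegral.integral_sub (hi' _ _ _) (hi' _ _ _)]
    refine intervalIntegral.integral_congr fun t _ => ?_
    rw [abs_sub_comm, abs_of_nonneg]
    exact sub_nonneg.2 (hg (by linarith))
  rw [h1, intervalIntegral.integral_comp_add_left, intervalIntegral.integral_comp_add_left,
    intervalIntegral.integral_interval_sub_interval_comm' (hi _ _) (hi _ _) (hi _ _), add_zero,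
    add_zero, abs_sub_comm, abs_of_nonneg (sub_nonneg.2 hle)]
  have h2 : ∫ t in (α + R)..(β + R), g t ≤ K * (β - α) := by
    have := intervalIntegral.integral_mono_on (by linarith : α + R ≤ β + R) (hi _ _)
      (intervalIntegrable_const (c := K)) fun t _ => (hK t).2
    rw [intervalIntegral.integral_const, smul_eq_mul] at this
    linarith
  have h3 : 0 ≤ ∫ t in α..β, g t := intervalIntegral.integral_nonneg hle fun t _ => (hK t).1
  linarith

/-- A monotone function on `[0,R]` with values in `[0,K]`, extended by `0` to the left and by `K`
to the right. -/
noncomputable def extendMonotone (R K : ℝ) (G : ℝ → ℝ) (t : ℝ) : ℝ :=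
  if t < 0 then 0 else if t ≤ R then G t else K

lemma monotone_extendMonotone {R K : ℝ} {G : ℝ → ℝ} (hK : 0 ≤ K) (hG : MonotoneOn G (Icc 0 R))
    (hGK : MapsTo G (Icc 0 R) (Icc 0 K)) : Monotone (extendMonotone R K G) := by
  intro s t hst
  simp only [extendMonotone]
  split_ifs with h1 h2 h3 h4 h5 h6 h7 h8
  all_goals first | exact le_rfl | exact hK | skip
  · exact (hGK ⟨not_lt.1 h2, h3⟩).1
  · linarith
  · exact hG ⟨not_lt.1 h1, h4⟩ ⟨not_lt.1 h5, h6⟩ hst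
  · exact (hGK ⟨not_lt.1 h1, h4⟩).2
  · linarith
  · linarith

lemma extendMonotone_mem {R K : ℝ} {G : ℝ → ℝ} (hK : 0 ≤ K)
    (hGK : MapsTo G (Icc 0 R) (Icc 0 K)) (t : ℝ) : extendMonotone R K G t ∈ Icc 0 K := by
  simp only [extendMonotone]
  split_ifs with h1 h2
  · exact ⟨le_rfl, hK⟩
  · exact hGK ⟨not_lt.1 h1, h2⟩
  · exact ⟨hK, le_rfl⟩

/-- The modulus controlling the difference between a distributed and a pointwise delay. -/
noncomputable def delayModulus (T K : ℝ) (h : ℝ → ℝ) (ξ : ℝ) : ℝ :=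
  (∫ t, |h (ξ + t) - h (-(T / 2) + t)|) + 2 * K * |ξ - -(T / 2)|

lemma continuous_delayModulus (T K : ℝ) {h : ℝ → ℝ} (hh : Integrable h) :
    Continuous (delayModulus T K h) :=
  (continuous_integral_translate hh _).add (by fun_prop)

lemma delayModulus_apply (T K : ℝ) (h : ℝ → ℝ) : delayModulus T K h (-(T / 2)) = 0 := by
  simp [delayModulus]

/-- The delay error is the kernel average of z(t+ξ) - z(t-T/2) plus the mass defect times z(t-T/2).
Integrated over t, the translation differences are estimated separately for the history and for the
two monotone parts. -/
lemma integral_delay_sub_le (hT : 0 < T) {a η₁ : ℝ → ℝ} (ha : ContinuousOn a (Icc (-T) 0))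
    (ha0 : ∀ ξ ∈ Icc (-T) 0, 0 ≤ a ξ) (hη : IntegrableOn η₁ (Ico (-T) 0)) {R K : ℝ} (hR : 0 ≤ R)
    (hK : 0 ≤ K) {z G₁ G₂ : ℝ → ℝ} (hz : IsPath T z) (hzη : ∀ s ∈ Ico (-T) 0, z s = η₁ s)
    (hzG : ∀ t ∈ Icc 0 R, z t = G₁ t - G₂ t) (hG₁ : MonotoneOn G₁ (Icc 0 R))
    (hG₂ : MonotoneOn G₂ (Icc 0 R)) (hK₁ : MapsTo G₁ (Icc 0 R) (Icc 0 K))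
    (hK₂ : MapsTo G₂ (Icc 0 R) (Icc 0 K)) :
    ∫ t in (0 : ℝ)..R, |distributedDelay T a z t - pointwiseDelay T z t| ≤
      (∫ ξ in (-T)..0, a ξ * delayModulus T K ((Ico (-T) 0).indicator η₁) ξ) +
      |(∫ ξ in (-T)..0, a ξ) - 1| * ((∫ t, |(Ico (-T) 0).indicator η₁ t|) + 2 * K * R) := by
  set h := (Ico (-T) 0).indicator η₁ with hh
  have hhi : Integrable h := (integrable_indicator_iff measurableSet_Ico).2 hη
  set g₁ := extendMonotone R K G₁ with hg₁
  set g₂ := extendMonotone R K G₂ with hg₂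
  have hm₁ : Monotone g₁ := monotone_extendMonotone hK hG₁ hK₁
  have hm₂ : Monotone g₂ := monotone_extendMonotone hK hG₂ hK₂
  have hr₁ : ∀ t, g₁ t ∈ Icc 0 K := extendMonotone_mem hK hK₁
  have hr₂ : ∀ t, g₂ t ∈ Icc 0 K := extendMonotone_mem hK hK₂
  set w := (Ioc (-T) R).indicator z with hw
  have hwi : Integrable w := (integrable_indicator_iff measurableSet_Ioc).2 (hz.integrableOn R)
  set α := (Ioc (-T) 0).indicator a with hα
  have hαi : Integrable α := (integrable_indicator_iff measurableSet_Ioc).2 (integrableOn_kernel ha)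
  have hα0 : ∀ ξ, 0 ≤ α ξ := fun ξ =>
    indicator_nonneg (fun ξ hξ => ha0 ξ (Ioc_subset_Icc_self hξ)) ξ
  -- The history part vanishes at nonnegative times and the monotone parts vanish at negative times,
  -- so the jump of z at 0 is absorbed into the monotone functions.
  have hwdec : ∀ s ∈ Ioc (-T) R, w s = h s + g₁ s - g₂ s := by
    intro s hs
    rw [hw, indicator_of_mem hs, hh, hg₁, hg₂]
    rcases lt_or_ge s 0 with h0 | h0
    · rw [indicator_of_mem (show s ∈ Ico (-T) 0 from ⟨hs.1.le, h0⟩), hzη s ⟨hs.1.le, h0⟩]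
      simp [extendMonotone, h0]
    · rw [indicator_of_notMem (fun hm => absurd hm.2 (not_lt.2 h0)), hzG s ⟨h0, hs.2⟩]
      simp [extendMonotone, not_lt.2 h0, hs.2]
  have hmass : ∫ ξ, α ξ = ∫ ξ in (-T)..0, a ξ := by
    rw [hα, integral_indicator measurableSet_Ioc, intervalIntegral.integral_of_le (by linarith)]
  have hF1 := integrable_mul_comp_add hαi hwi
  have hF2 : Integrable (fun p : ℝ × ℝ => α p.1 * w (-(T / 2) + p.2)) (volume.prod volume) :=
    hαi.mul_prod (integrable_comp_const_add hwi _)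
  set F : ℝ → ℝ → ℝ := fun ξ t => α ξ * |w (ξ + t) - w (-(T / 2) + t)| with hF
  have hFi0 : Integrable (Function.uncurry F) (volume.prod volume) := by
    refine (hF1.sub hF2).abs.congr (ae_of_all _ fun p => ?_)
    simp only [Pi.sub_apply, Function.uncurry, hF]
    rw [← mul_sub, abs_mul, abs_of_nonneg (hα0 _)]
  have hFi : Integrable (Function.uncurry F) (volume.prod (volume.restrict (Ioc 0 R))) := by
    have := hFi0.restrict (s := univ ×ˢ Ioc 0 R)
    rwa [← Measure.prod_restrict, Measure.restrict_univ] at this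
  have hws := integrable_comp_const_add hwi (-(T / 2))
  have hpt : ∀ᵐ t ∂(volume.restrict (Ioc 0 R)),
      |distributedDelay T a z t - pointwiseDelay T z t| ≤
        (∫ ξ, F ξ t) + |(∫ ξ in (-T)..0, a ξ) - 1| * |w (-(T / 2) + t)| := by
    filter_upwards [ae_restrict_of_ae hF1.prod_left_ae, ae_restrict_mem measurableSet_Ioc]
      with t h1 ht
    rw [distributedDelay_eq hT, ← integral_indicator_mul_indicator (S := R) ⟨ht.1.le, ht.2⟩]
    have h2 : pointwiseDelay T z t = w (-(T / 2) + t) := by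
      rw [hw, indicator_of_mem (show -(T / 2) + t ∈ Ioc (-T) R from
        ⟨by linarith [ht.1], by linarith [ht.2]⟩), pointwiseDelay, sub_eq_neg_add]
    rw [h2]
    have h3 : (∫ ξ, α ξ * w (ξ + t)) - w (-(T / 2) + t) =
        (∫ ξ, (α ξ * w (ξ + t) - α ξ * w (-(T / 2) + t))) +
          ((∫ ξ in (-T)..0, a ξ) - 1) * w (-(T / 2) + t) := by
      rw [integral_sub h1 (hαi.mul_const _), integral_mul_const, hmass]
      ring
    change |(∫ ξ, α ξ * w (ξ + t)) - w (-(T / 2) + t)| ≤ _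
    rw [h3]
    refine (abs_add_le _ _).trans ?_
    rw [abs_mul]
    refine add_le_add (abs_integral_le_integral_abs.trans_eq ?_) le_rfl
    congr 1
    ext ξ
    rw [← mul_sub, abs_mul, abs_of_nonneg (hα0 _)]
  have hinner : ∀ ξ ∈ Ioc (-T) 0, ∫ t in Ioc 0 R, |w (ξ + t) - w (-(T / 2) + t)| ≤
      delayModulus T K h ξ := by
    intro ξ hξ
    have i1 : IntegrableOn (fun t => |h (ξ + t) - h (-(T / 2) + t)|) (Ioc 0 R) :=
      ((integrable_comp_const_add hhi ξ).sub (integrable_comp_const_add hhi _)).abs.integrableOn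
    have i2 : ∀ g : ℝ → ℝ, Monotone g →
        IntegrableOn (fun t => |g (ξ + t) - g (-(T / 2) + t)|) (Ioc 0 R) := fun g hg => by
      have j : ∀ γ : ℝ, IntegrableOn (fun t => g (γ + t)) (Ioc 0 R) := fun γ =>
        ((hg.comp (monotone_id.const_add γ)).intervalIntegrable (a := 0) (b := R)).1
      exact ((j ξ).sub (j _)).abs
    have h1 : ∫ t in Ioc 0 R, |w (ξ + t) - w (-(T / 2) + t)| ≤
        ∫ t in Ioc 0 R, (|h (ξ + t) - h (-(T / 2) + t)| + |g₁ (ξ + t) - g₁ (-(T / 2) + t)|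
          + |g₂ (ξ + t) - g₂ (-(T / 2) + t)|) := by
      refine setIntegral_mono_on ((integrable_comp_const_add hwi ξ).sub hws).abs.integrableOn
        ((i1.add (i2 _ hm₁)).add (i2 _ hm₂)) measurableSet_Ioc fun t ht => ?_
      rw [hwdec (ξ + t) ⟨by linarith [ht.1, hξ.1], by linarith [ht.2, hξ.2]⟩,
        hwdec (-(T / 2) + t) ⟨by linarith [ht.1], by linarith [ht.2]⟩]
      have e : h (ξ + t) + g₁ (ξ + t) - g₂ (ξ + t) -
          (h (-(T / 2) + t) + g₁ (-(T / 2) + t) - g₂ (-(T / 2) + t)) =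
          (h (ξ + t) - h (-(T / 2) + t)) + (g₁ (ξ + t) - g₁ (-(T / 2) + t)) -
          (g₂ (ξ + t) - g₂ (-(T / 2) + t)) := by ring
      rw [e]
      refine (abs_sub _ _).trans (add_le_add (abs_add_le _ _) le_rfl)
    have i3 : IntegrableOn (fun t => |h (ξ + t) - h (-(T / 2) + t)| +
      |g₁ (ξ + t) - g₁ (-(T / 2) + t)|) (Ioc 0 R) := i1.add (i2 _ hm₁)
    refine h1.trans ?_
    rw [integral_add i3 (i2 _ hm₂), integral_add i1 (i2 _ hm₁), delayModulus]
    have h2 := integral_abs_shift_sub_le hm₁ hr₁ R ξ (-(T / 2)) hR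
    have h3 := integral_abs_shift_sub_le hm₂ hr₂ R ξ (-(T / 2)) hR
    have h4 : ∫ t in Ioc 0 R, |h (ξ + t) - h (-(T / 2) + t)| ≤
        ∫ t, |h (ξ + t) - h (-(T / 2) + t)| :=
      setIntegral_le_integral ((integrable_comp_const_add hhi ξ).sub
        (integrable_comp_const_add hhi _)).abs (ae_of_all _ fun _ => abs_nonneg _)
    linarith
  have htail : ∫ t in Ioc 0 R, |w (-(T / 2) + t)| ≤ (∫ t, |h t|) + 2 * K * R := by
    have i1 := (integrable_comp_const_add hhi (-(T / 2))).abs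
    have h1 : ∫ t in Ioc 0 R, |w (-(T / 2) + t)| ≤
        ∫ t in Ioc 0 R, (|h (-(T / 2) + t)| + 2 * K) := by
      refine setIntegral_mono_on hws.abs.integrableOn
        (i1.integrableOn.add (integrableOn_const (by simp))) measurableSet_Ioc fun t ht => ?_
      rw [hwdec (-(T / 2) + t) ⟨by linarith [ht.1], by linarith [ht.2]⟩]
      have e1 := hr₁ (-(T / 2) + t)
      have e2 := hr₂ (-(T / 2) + t)
      have e3 : |g₁ (-(T / 2) + t) - g₂ (-(T / 2) + t)| ≤ 2 * K :=
        abs_le.2 ⟨by linarith [e1.1, e2.2], by linarith [e1.2, e2.1]⟩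
      rw [add_sub_assoc]
      exact (abs_add_le _ _).trans (add_le_add le_rfl e3)
    refine h1.trans ?_
    rw [integral_add i1.integrableOn (integrableOn_const (by simp)), setIntegral_const,
      Real.volume_real_Ioc_of_le hR, smul_eq_mul]
    have h2 : ∫ t in Ioc 0 R, |h (-(T / 2) + t)| ≤ ∫ t, |h t| := by
      rw [← integral_add_left_eq_self (fun t => |h t|) (-(T / 2))]
      exact setIntegral_le_integral i1 (ae_of_all _ fun _ => abs_nonneg _)
    linarith
  have hiD := (intervalIntegrable_distributedDelay hT ha hz hR).sub
    ((isDelayOp_pointwiseDelay hT le_rfl).integrable z hz R hR)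
  rw [intervalIntegral.integral_of_le hR]
  refine (integral_mono_ae hiD.abs.1 (hFi.integral_prod_right.add
    (hws.abs.integrableOn.const_mul _)) hpt).trans ?_
  rw [integral_add' hFi.integral_prod_right (hws.abs.integrableOn.const_mul _), integral_const_mul]
  refine add_le_add ?_ (mul_le_mul_of_nonneg_left htail (abs_nonneg _))
  -- After the exchange the inner integral is a translation difference in L¹ for fixed ξ, bounded by
  -- the modulus.
  have hswap : ∫ t in Ioc 0 R, ∫ ξ, F ξ t = ∫ ξ, ∫ t in Ioc 0 R, F ξ t :=
    (integral_integral_swap hFi).symm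
  rw [intervalIntegral.integral_of_le (by linarith : -T ≤ 0)]
  change ∫ t in Ioc 0 R, ∫ ξ, F ξ t ≤ _
  rw [hswap, ← integral_indicator measurableSet_Ioc]
  have hmi : IntegrableOn (fun ξ => a ξ * delayModulus T K h ξ) (Ioc (-T) 0) :=
    (ha.mul (continuous_delayModulus T K hhi).continuousOn).integrableOn_Icc.mono_set
      Ioc_subset_Icc_self
  refine integral_mono hFi.integral_prod_left
    ((integrable_indicator_iff measurableSet_Ioc).2 hmi) fun ξ => ?_
  simp only [hF]
  rw [integral_const_mul]
  by_cases hξ : ξ ∈ Ioc (-T) 0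
  · rw [hα, indicator_of_mem hξ, indicator_of_mem hξ]
    exact mul_le_mul_of_nonneg_left (hinner ξ hξ) (ha0 ξ (Ioc_subset_Icc_self hξ))
  · rw [hα, indicator_of_notMem hξ, indicator_of_notMem hξ, zero_mul]

/-- The modulus is continuous, vanishes at -T/2 and depends only on T, K and the history. Testing
the weak convergence with it and with the constant 1 makes both error terms small, uniformly in z.
-/
theorem delayConverges_distributedDelay (hT : 0 < T) {a : ℕ → ℝ → ℝ} {η₁ : ℝ → ℝ}
    (ha : ∀ k, ContinuousOn (a k) (Icc (-T) 0)) (ha0 : ∀ k, ∀ ξ ∈ Icc (-T) 0, 0 ≤ a k ξ)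
    (haδ : ∀ φ : ℝ → ℝ, ContinuousOn φ (Icc (-T) 0) →
      Tendsto (fun k => ∫ ξ in (-T)..0, a k ξ * φ ξ) atTop (𝓝 (φ (-(T / 2)))))
    (hη : IntegrableOn η₁ (Ico (-T) 0)) :
    DelayConverges T η₁ (fun k => distributedDelay T (a k)) (pointwiseDelay T) := by
  intro R K ε hR hK hε
  set h := (Ico (-T) 0).indicator η₁ with hh
  have hhi : Integrable h := (integrable_indicator_iff measurableSet_Ico).2 hη
  have h1 := haδ _ (continuous_delayModulus T K hhi).continuousOn
  rw [delayModulus_apply] at h1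
  have h2 := haδ (fun _ => 1) continuousOn_const
  simp only [mul_one] at h2
  have h3 := h1.add ((h2.sub_const 1).abs.mul_const ((∫ t, |h t|) + 2 * K * R))
  rw [sub_self, abs_zero, zero_mul, add_zero] at h3
  filter_upwards [h3.eventually_le_const hε] with k hk z G₁ G₂ hz hzη hzG hG₁ hG₂ hK₁ hK₂
  exact (integral_delay_sub_le hT (ha k) (ha0 k) hη hR hK hz hzη hzG hG₁ hG₂ hK₁ hK₂).trans hk

end DelayConvergence

/-! ### Bounds for optimal controls and states that are uniform in the kernel. -/

section UniformFloor

variable {T A B C ρ : ℝ} {f : ℝ → ℝ → ℝ} {D : (ℝ → ℝ) → ℝ → ℝ} {U₁ U₂ : ℝ → ℝ}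
  {η₀ : ℝ} {η₁ c x : ℝ → ℝ}

/-- If c were at least 2K almost everywhere, its integral over an interval of length at least 1
would exceed K. -/
lemma exists_set_control_le (hc : LocallyIntegrableOn c (Ici 0)) (hc0 : ∀ t, 0 ≤ t → 0 ≤ c t)
    {δ K : ℝ} (hδ : 1 ≤ δ) (hK : 0 < K) (h : ∫ s in (0 : ℝ)..δ, c s ≤ K) :
    ∃ E, MeasurableSet E ∧ E ⊆ Ioc 0 δ ∧ 0 < volume.real E ∧ ∀ s ∈ E, c s ≤ 2 * K := by
  have hpos : 0 < volume (Ioc 0 δ ∩ {s | |c s - 0| < 2 * K}) := by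
    by_contra h0
    have h0' : volume (Ioc 0 δ ∩ {s | |c s - 0| < 2 * K}) = 0 := by simpa using h0
    have hae : ∀ᵐ s ∂(volume.restrict (Ioc 0 δ)), 2 * K ≤ c s := by
      have h1 : ∀ᵐ s, s ∉ Ioc 0 δ ∩ {s | |c s - 0| < 2 * K} := measure_eq_zero_iff_ae_notMem.1 h0'
      filter_upwards [ae_restrict_of_ae h1, ae_restrict_mem measurableSet_Ioc] with s h2 h3
      by_contra! h4
      refine h2 ⟨h3, ?_⟩
      change |c s - 0| < 2 * K
      rwa [sub_zero, abs_of_nonneg (hc0 s h3.1.le)]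
    have hci := intervalIntegrable_of_locallyIntegrableOn_Ici hc le_rfl (zero_le_one.trans hδ)
    have h2 := integral_mono_ae (integrable_const _) hci.1 hae
    rw [setIntegral_const, Real.volume_real_Ioc_of_le (by linarith), smul_eq_mul,
      ← intervalIntegral.integral_of_le (by linarith)] at h2
    nlinarith
  obtain ⟨E, hE, hEδ, hE0, hEc⟩ := exists_measurable_essential hc hpos
  refine ⟨E, hE, hEδ, hE0, fun s hs => ?_⟩
  have := (abs_lt.1 (hEc s hs)).2
  linarith

/-- Optimal controls are bounded in terms of their total consumption. -/
lemma IsOptimalPair.control_le (hP : IsControlProblem T A C ρ f D U₁ U₂) (hT : 0 < T)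
    (hm : HasFadingMemory T A B D) (hη : IsHistory T η₁) (hη₀ : 0 < η₀)
    (hopt : IsOptimalPair T ρ f U₁ U₂ D η₀ η₁ c x) {S K N : ℝ} (hK : 0 < K) (hN : 0 < N)
    (hcK : ∫ s in (0 : ℝ)..(S + 1), c s ≤ K)
    (hNK : deriv U₁ N < Real.exp (-ρ * (S + 1)) * deriv U₁ (2 * K)) :
    ∀ᵐ t, t ∈ Icc 0 S → c t ≤ N := by
  have hadm := hopt.admissible
  have hU := hP.consumption
  filter_upwards [ae_right_essential c] with t hess ht
  have hsh := hopt.shift hP hT hη hη₀ ht.1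
  have hη' := hadm.history_shift hT hη ht.1
  obtain ⟨p, -, hder, h3⟩ := hsh.exists_hasDerivAt hP hm hη' (hadm.state_pos t ht.1)
  obtain ⟨hc0, hcp⟩ := h3 (c t) (hadm.control_nonneg t ht.1) (fun δ hδ ζ hζ => by
    have h4 := hess δ hδ ζ hζ
    rw [← measure_preimage_add volume t] at h4
    convert h4 using 2
    ext s
    simp only [mem_inter_iff, mem_Ioc, mem_ofPred_eq, mem_preimage]
    constructor
    · rintro ⟨⟨a1, a2⟩, a3⟩; exact ⟨⟨by linarith, by linarith⟩, a3⟩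
    · rintro ⟨⟨a1, a2⟩, a3⟩; exact ⟨⟨by linarith, by linarith⟩, a3⟩)
  have hadm' := hsh.admissible
  -- The extra unit of time guarantees a window of length at least 1 after every t in [0,S].
  have hδ : 1 ≤ S + 1 - t := by linarith [ht.2]
  have hint : ∫ s in (0 : ℝ)..(S + 1 - t), c (t + s) ≤ K := by
    rw [intervalIntegral.integral_comp_add_left, add_zero, add_sub_cancel]
    refine le_trans ?_ hcK
    have hi := fun {p q : ℝ} (hp : 0 ≤ p) (hq : 0 ≤ q) =>
      intervalIntegrable_of_locallyIntegrableOn_Ici hadm.locallyIntegrable hp hq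
    rw [← intervalIntegral.integral_add_adjacent_intervals (hi le_rfl ht.1)
      (hi ht.1 (by linarith [ht.1, ht.2]))]
    linarith [integral_nonneg_of_control_nonneg hadm.control_nonneg le_rfl ht.1]
  obtain ⟨E, hE, hEδ, hE0, hEc⟩ := exists_set_control_le hadm'.locallyIntegrable
    hadm'.control_nonneg hδ hK hint
  -- Spending extra capital where c ≤ 2K bounds the derivative below. It equals U₁'(c t), so c t
  -- cannot exceed N. The estimate involves the kernel only through K.
  have hle : Real.exp (-ρ * (S + 1 - t)) * deriv U₁ (2 * K) ≤ p := by
    refine le_rightDeriv hder.hasDerivWithinAt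
      (φ := fun h => Real.exp (-ρ * (S + 1 - t)) * deriv U₁ (2 * K + h / volume.real E))
      (Tendsto.const_mul _ (hU.tendsto_deriv (by linarith) ?_)) ?_
    · exact (by fun_prop : Continuous fun h : ℝ =>
        2 * K + h / volume.real E).tendsto_nhdsGT_zero (by simp)
    · filter_upwards [self_mem_nhdsWithin] with h hh
      exact hsh.realValue_add_ge hP hη' (hadm.state_pos t ht.1) hE hEδ hE0 hEc hh
  have hexp : Real.exp (-ρ * (S + 1)) ≤ Real.exp (-ρ * (S + 1 - t)) :=
    Real.exp_le_exp.2 (by nlinarith [hP.discount_pos, ht.1])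
  have h5 := mul_le_mul_of_nonneg_right hexp (hU.deriv_pos (2 * K) (by linarith)).le
  by_contra! hlt
  have h6 := hU.strictAntiOn_deriv (mem_Ioi.2 hN) (mem_Ioi.2 hc0) hlt
  linarith

/-- Nonnegative drift means that a state can fall no faster than it is consumed. -/
lemma IsSolution.drift_integral_nonneg (hf : RegularProduction f C)
    (hD : IsDelayOp T A D) (hη : IsHistory T η₁) (h : IsSolution T f D η₀ η₁ c x) {R : ℝ}
    (hx : ∀ t ∈ Icc 0 R, 0 ≤ x t) {s t : ℝ} (hs : 0 ≤ s) (hst : s ≤ t) (ht : t ≤ R) :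
    0 ≤ ∫ r in s..t, f (x r) (D x r) := by
  refine intervalIntegral.integral_nonneg_of_ae_restrict hst ?_
  have h1 := hD.nonneg x (h.isPath hη) (h.isHistory hη)
  have h2 : ∀ᵐ r, r ∈ Ioi (0 : ℝ) → (∀ q ∈ Icc 0 r, 0 ≤ x q) → 0 ≤ D x r :=
    (ae_restrict_iff' measurableSet_Ioi).1 h1
  have h3 : ∀ᵐ r : ℝ, r ≠ 0 := by simp [ae_iff]
  filter_upwards [ae_restrict_of_ae h2, ae_restrict_of_ae h3, ae_restrict_mem measurableSet_Icc]
    with r hr hr0 hrm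
  have hr' : 0 < r := lt_of_le_of_ne (hs.trans hrm.1) (Ne.symm hr0)
  exact hf.nonneg _ _ (hr hr' fun q hq => hx q ⟨hq.1, hq.2.trans (hrm.2.trans ht)⟩)

/-- Trajectories with bounded control and not too small payoff stay away from zero. -/
lemma exists_backward_floor (hU : NonposUtility U₂) (hρ : 0 < ρ)
    (hsing : Tendsto (fun x => x * U₂ x) (𝓝[>] 0) atBot) {N : ℝ} (hN : 0 < N) (hη₀ : 0 < η₀)
    (S J : ℝ) : ∃ m, 0 < m ∧ ∀ (A C : ℝ) (f : ℝ → ℝ → ℝ) (D : (ℝ → ℝ) → ℝ → ℝ) (η₁ c x : ℝ → ℝ),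
      RegularProduction f C → IsDelayOp T A D → IsHistory T η₁ →
      IsAdmissiblePair T f D η₀ η₁ c x → HasFinitePayoff ρ U₂ x →
      (∀ᵐ t, t ∈ Icc 0 S → c t ≤ N) →
      (-∫ t in Ioi 0, Real.exp (-ρ * t) * U₂ (x t)) ≤ J → ∀ t ∈ Icc 0 S, m ≤ x t := by
  -- The restriction m / N ≤ η₀ / (2N) forces m ≤ η₀ / 2: the state starts at η₀, so it needs a time
  -- of at least m / N to come down below m, and the interval of smallness fits into [0,S].
  obtain ⟨m, hm, hmr, hmK⟩ := exists_singular_floor hsing hN (r := η₀ / (2 * N)) (by positivity)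
    (Real.exp (ρ * S) * J)
  refine ⟨m, hm, fun A C f D η₁ c x hf hD hη hadm hfin hcN hJ t₀ ht₀ => ?_⟩
  by_contra! hlt
  have hsol := hadm.solution
  have hci := fun {p q : ℝ} (hp : 0 ≤ p) (hq : 0 ≤ q) =>
    intervalIntegrable_of_locallyIntegrableOn_Ici hadm.locallyIntegrable hp hq
  have hdi := fun {p q : ℝ} (hp : 0 ≤ p) (hq : 0 ≤ q) =>
    (hsol.isPath hη).drift_integrable' hf hD hp hq
  -- Going backwards only the bound on the control matters, not the size of the drift; this makes m
  -- independent of the delay operator.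
  have hback : ∀ t ∈ Icc 0 t₀, x t ≤ x t₀ + N * (t₀ - t) := by
    intro t ht
    have h1 := IsSolution.drift_integral_nonneg hf hD hη hsol (R := t₀)
      (fun s hs => (hadm.state_pos s hs.1).le) ht.1 ht.2 le_rfl
    have h2 : ∫ s in t..t₀, c s ≤ N * (t₀ - t) := by
      have := intervalIntegral.integral_mono_ae_restrict ht.2 (hci ht.1 ht₀.1)
        (intervalIntegrable_const (c := N)) (by
          filter_upwards [ae_restrict_of_ae hcN, ae_restrict_mem measurableSet_Icc] with s h1 h2
          exact h1 ⟨ht.1.trans h2.1, h2.2.trans ht₀.2⟩)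
      rw [intervalIntegral.integral_const, smul_eq_mul] at this
      linarith
    have h3 := intervalIntegral.integral_add_adjacent_intervals (hdi le_rfl ht.1)
      (hdi ht.1 ht₀.1)
    have h4 := intervalIntegral.integral_add_adjacent_intervals (hci le_rfl ht.1)
      (hci ht.1 ht₀.1)
    rw [hsol.integral_eq t ht.1, hsol.integral_eq t₀ ht₀.1]
    linarith
  have h0 := hback 0 ⟨le_rfl, ht₀.1⟩
  rw [hsol.apply_zero, sub_zero] at h0
  have hmN : N * (m / N) = m := by field_simp
  have hη2 : N * (η₀ / (2 * N)) = η₀ / 2 := by field_simp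
  have hm2 : m ≤ η₀ / 2 := by
    have := mul_le_mul_of_nonneg_left hmr hN.le
    linarith
  have ht0 : 0 ≤ t₀ - m / N := by
    by_contra! hneg
    have := mul_lt_mul_of_pos_left hneg hN
    linarith
  have h5 := le_integral_of_small hU hρ hfin hadm.state_pos ht0
    (by have := div_pos hm hN; linarith) ht₀.2 (m := m) (fun t ht => by
      have h6 := hback t ⟨ht0.trans ht.1.le, ht.2⟩
      have h7 := mul_le_mul_of_nonneg_left (show t₀ - t ≤ m / N by linarith [ht.1]) hN.le
      linarith) hm
  rw [sub_sub_cancel] at h5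
  have h8 := mul_lt_mul_of_pos_left hmK (Real.exp_pos (-ρ * S))
  rw [← mul_assoc, ← Real.exp_add] at h8
  have : -ρ * S + ρ * S = 0 := by ring
  rw [this, Real.exp_zero, one_mul] at h8
  linarith

end UniformFloor

/-! ### Transferring controls between delay operators. -/

section Transfer

variable {T A A' C ρ : ℝ} {f : ℝ → ℝ → ℝ} {D D' : (ℝ → ℝ) → ℝ → ℝ} {U₁ U₂ : ℝ → ℝ}
  {η₀ : ℝ} {η₁ c x x' : ℝ → ℝ}

/-- Payoffs of controls that vanish eventually depend continuously on the trajectory. -/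
lemma exists_transfer (hU : NonposUtility U₂) (hρ : 0 < ρ) {m M ε : ℝ} (hm : 0 < m)
    (hM : 0 ≤ M) (hε : 0 < ε) :
    ∃ R σ, M ≤ R ∧ 0 < σ ∧ ∀ (A C : ℝ) (f : ℝ → ℝ → ℝ) (D D' : (ℝ → ℝ) → ℝ → ℝ) (U₁ : ℝ → ℝ)
      (η₀ : ℝ) (η₁ c x x' : ℝ → ℝ), RegularProduction f C → IsDelayOp T A D' → IsHistory T η₁ →
      IsAdmissiblePair T f D η₀ η₁ c x → HasFinitePayoff ρ U₂ x → (∀ t, M < t → c t = 0) →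
      (∀ t, 0 ≤ t → m ≤ x t) → IsSolution T f D' η₀ η₁ c x' →
      (∀ t ∈ Icc 0 R, |x t - x' t| ≤ σ) →
      IsAdmissiblePair T f D' η₀ η₁ c x' ∧ HasFinitePayoff ρ U₂ x' ∧
        realPayoff ρ U₁ U₂ c x - ε ≤ realPayoff ρ U₁ U₂ c x' := by
  obtain ⟨K, hK0, hK⟩ := hU.exists_lipschitz (half_pos hm)
  have hlim : Tendsto (fun R => Real.exp (-ρ * R) * (-U₂ (m / 2)) / ρ) atTop (𝓝 0) := by
    have h1 : Tendsto (fun R : ℝ => Real.exp (-(ρ * R))) atTop (𝓝 0) :=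
      Real.tendsto_exp_neg_atTop_nhds_zero.comp (tendsto_id.const_mul_atTop hρ)
    have h2 := (h1.mul_const (-U₂ (m / 2))).div_const ρ
    simpa [neg_mul] using h2
  -- Beyond R both states exceed m / 2 and the discounted utility lost there is at most ε/2; up to R
  -- closeness within σ costs at most K σ / ρ. In the choice of σ, K + 1 avoids division by zero.
  obtain ⟨R, hR, hMR⟩ := ((hlim.eventually_le_const (half_pos hε)).and
    (eventually_ge_atTop M)).exists
  refine ⟨R, min (m / 2) (ρ * ε / (2 * (K + 1))), hMR, lt_min (half_pos hm) (by positivity), ?_⟩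
  intro A C f D D' U₁ η₀ η₁ c x x' hf hD' hη hadm hfin hc0 hxm hsol' hclose
  set σ := min (m / 2) (ρ * ε / (2 * (K + 1))) with hσ
  have hR0 : 0 ≤ R := hM.trans hMR
  have hlow1 : ∀ t ∈ Icc 0 R, m / 2 ≤ x' t := fun t ht => by
    have h1 := (abs_le.1 (hclose t ht)).2
    have h2 := hxm t ht.1
    have h3 : σ ≤ m / 2 := min_le_left _ _
    linarith
  have hlow : ∀ t, 0 ≤ t → m / 2 ≤ x' t := fun t ht => by
    rcases le_total t R with h | h
    · exact hlow1 t ⟨ht, h⟩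
    · exact (hlow1 R ⟨hR0, le_rfl⟩).trans (hsol'.ge_after hf hD' hη hadm.locallyIntegrable hR0
        (fun s hs => (half_pos hm).le.trans (hlow1 s hs))
        (fun s hs => hc0 s (hMR.trans_lt hs)) t h)
  have hpos' : ∀ t, 0 ≤ t → 0 < x' t := fun t ht => (half_pos hm).trans_le (hlow t ht)
  have hfin' : HasFinitePayoff ρ U₂ x' :=
    hU.finite_of_bounded_below hρ (half_pos hm) hsol'.continuousOn hlow
  refine ⟨⟨hadm.locallyIntegrable, hadm.control_nonneg, hsol', hpos'⟩, hfin', ?_⟩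
  have hpt : ∀ t ∈ Ioi (0 : ℝ), Real.exp (-ρ * t) * U₂ (x t) ≤
      Real.exp (-ρ * t) * U₂ (x' t) + (Real.exp (-ρ * t) * (K * σ) +
        (Ioi R).indicator (fun t => Real.exp (-ρ * t) * (-U₂ (m / 2))) t) := by
    intro t ht
    have ht0 : (0 : ℝ) < t := ht
    have hσ0 : 0 ≤ σ := (abs_nonneg _).trans (hclose 0 ⟨le_rfl, hR0⟩)
    rcases le_or_gt t R with h | h
    · rw [indicator_of_notMem (show t ∉ Ioi R from not_lt.2 h), add_zero, ← mul_add]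
      refine mul_le_mul_of_nonneg_left ?_ (Real.exp_pos _).le
      have := hK (x' t) (x t) σ (hlow t ht0.le) (hadm.state_pos t ht0.le) hσ0
        (by linarith [(abs_le.1 (hclose t ⟨ht0.le, h⟩)).2])
      linarith
    · rw [indicator_of_mem (mem_Ioi.2 h), ← mul_add, ← mul_add]
      refine mul_le_mul_of_nonneg_left ?_ (Real.exp_pos _).le
      have h1 := hU.nonpos (x t) (hadm.state_pos t ht0.le)
      have h2 := hU.mono (mem_Ioi.2 (half_pos hm)) (mem_Ioi.2 (hpos' t ht0.le)) (hlow t ht0.le)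
      have h3 := mul_nonneg hK0 hσ0
      linarith
  have i1 : IntegrableOn (fun t => Real.exp (-ρ * t) * (K * σ)) (Ioi 0) :=
    (integrableOn_discount hρ 0).mul_const _
  have i2 : Integrable ((Ioi R).indicator fun t => Real.exp (-ρ * t) * (-U₂ (m / 2))) :=
    (integrable_indicator_iff measurableSet_Ioi).2 ((integrableOn_discount hρ R).mul_const _)
  have i3 : IntegrableOn (fun t => Real.exp (-ρ * t) * (K * σ) +
        (Ioi R).indicator (fun t => Real.exp (-ρ * t) * (-U₂ (m / 2))) t) (Ioi 0) :=
    i1.add i2.integrableOn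
  have hle := setIntegral_mono_on hfin (Integrable.add hfin' i3) measurableSet_Ioi hpt
  rw [integral_add' hfin' i3, integral_add i1 i2.integrableOn, integral_mul_const,
    integral_discount hρ, setIntegral_indicator measurableSet_Ioi,
    inter_eq_right.2 (Ioi_subset_Ioi hR0), integral_mul_const, integral_discount hρ, mul_zero,
    Real.exp_zero] at hle
  have h4 : 1 / ρ * (K * σ) ≤ ε / 2 := by
    have h5 : σ ≤ ρ * ε / (2 * (K + 1)) := min_le_right _ _
    have h6 : (K + 1) * σ ≤ ρ * ε / 2 := by
      rw [le_div_iff₀ (by positivity)] at h5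
      linarith
    have hσ0 : 0 ≤ σ := (abs_nonneg _).trans (hclose 0 ⟨le_rfl, hR0⟩)
    rw [one_div, inv_mul_le_iff₀ hρ]
    linarith
  have h7 : Real.exp (-ρ * R) / ρ * (-U₂ (m / 2)) ≤ ε / 2 := by
    rw [div_mul_eq_mul_div]; exact hR
  rw [realPayoff, realPayoff]
  linarith

/-- The trajectory of D solves the equation for D' up to the defect caused by D - D' along itself,
so the two operators need to be compared on one of the two trajectories only. -/
lemma IsSolution.abs_sub_le_of_delay (hf : RegularProduction f C) (hD : IsDelayOp T A D)
    (hD' : IsDelayOp T A' D') (hη : IsHistory T η₁) (h : IsSolution T f D η₀ η₁ c x)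
    (h' : IsSolution T f D' η₀ η₁ c x') {R e : ℝ}
    (he : ∫ t in (0 : ℝ)..R, |D x t - D' x t| ≤ e) (he0 : 0 ≤ e) :
    ∀ t ∈ Icc 0 R, |x t - x' t| ≤ C * e * Real.exp (C * (1 + A') * t) := by
  have hC := hf.const_nonneg
  have hp := h.isPath hη
  have hp' := h'.isPath hη
  refine abs_sub_le_of_defect hf hD' hp hp'
    (fun s hs => (h.history s hs).trans (h'.history s hs).symm) (mul_nonneg hC he0) fun t ht => ?_
  have i1 := hp.drift_integrable hf hD ht.1
  have i2 := hp.drift_integrable hf hD' ht.1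
  have i3 := hp'.drift_integrable hf hD' ht.1
  have id := ((hD.integrable x hp t ht.1).sub (hD'.integrable x hp t ht.1)).abs
  have idR := ((hD.integrable x hp R (ht.1.trans ht.2)).sub
    (hD'.integrable x hp R (ht.1.trans ht.2))).abs
  have e1 : x t - x' t - ∫ s in (0 : ℝ)..t, (f (x s) (D' x s) - f (x' s) (D' x' s)) =
      ∫ s in (0 : ℝ)..t, (f (x s) (D x s) - f (x s) (D' x s)) := by
    rw [intervalIntegral.integral_sub i2 i3, intervalIntegral.integral_sub i1 i2,
      h.integral_eq t ht.1, h'.integral_eq t ht.1]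
    ring
  rw [e1]
  calc _ ≤ ∫ s in (0 : ℝ)..t, |f (x s) (D x s) - f (x s) (D' x s)| :=
        intervalIntegral.abs_integral_le_integral_abs ht.1
    _ ≤ ∫ s in (0 : ℝ)..t, C * |D x s - D' x s| := by
        refine intervalIntegral.integral_mono_on ht.1 (i1.sub i2).abs (id.const_mul C)
          fun s _ => ?_
        simpa using hf.lipschitz (x s) (x s) (D x s) (D' x s)
    _ = C * ∫ s in (0 : ℝ)..t, |D x s - D' x s| := intervalIntegral.integral_const_mul _ _
    _ ≤ C * e := by
        refine mul_le_mul_of_nonneg_left (le_trans ?_ he) hC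
        exact intervalIntegral.integral_mono_interval le_rfl ht.1 ht.2
          (ae_of_all _ fun s => abs_nonneg _) idR

/-- Closeness of the trajectories of a control under two delay operators, uniformly over
controls and trajectories bounded on `[0,R]`. -/
lemma DelayConverges.trajectory {Dn : ℕ → (ℝ → ℝ) → ℝ → ℝ} (hconv : DelayConverges T η₁ Dn D)
    (hf : RegularProduction f C) (hD : IsDelayOp T A D)
    (hDn : ∀ᶠ k in atTop, IsDelayOp T A (Dn k)) (hη : IsHistory T η₁) {R K σ : ℝ} (hR : 0 ≤ R)
    (hK : 0 ≤ K) (hη₀ : 0 ≤ η₀) (hσ : 0 < σ) :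
    ∀ᶠ k in atTop, ∀ c x x' z : ℝ → ℝ, LocallyIntegrableOn c (Ici 0) →
      (∀ t, 0 ≤ t → 0 ≤ c t) → IsSolution T f (Dn k) η₀ η₁ c x → IsSolution T f D η₀ η₁ c x' →
      (z = x ∨ z = x') → MapsTo z (Icc 0 R) (Icc 0 K) → ∫ s in (0 : ℝ)..R, c s ≤ K →
      ∀ t ∈ Icc 0 R, |x t - x' t| ≤ σ := by
  have hC := hf.const_nonneg
  have hA := hD.const_nonneg
  set L := Real.exp (C * (1 + A) * R) with hL
  have hL0 : 0 < L := Real.exp_pos _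
  set e := σ / ((C + 1) * L) with he
  have he0 : 0 < e := by positivity
  have hbound : ∀ t ∈ Icc 0 R, C * e * Real.exp (C * (1 + A) * t) ≤ σ := by
    intro t ht
    have h1 : Real.exp (C * (1 + A) * t) ≤ L :=
      Real.exp_le_exp.2 (mul_le_mul_of_nonneg_left ht.2 (by positivity))
    calc C * e * Real.exp (C * (1 + A) * t) ≤ (C + 1) * e * L := by gcongr; linarith
      _ = σ := by rw [he]; field_simp
  filter_upwards [hDn, hconv R (2 * K) e hR (by linarith) he0]
    with k hDk hk c x x' z hc hc0 hx hx' hz hzK hcK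
  have hgen : ∀ (D₁ : (ℝ → ℝ) → ℝ → ℝ), IsDelayOp T A D₁ → IsSolution T f D₁ η₀ η₁ c z →
      ∫ t in (0 : ℝ)..R, |Dn k z t - D z t| ≤ e := by
    intro D₁ hD₁ hsol
    have hci := fun {p q : ℝ} (hp : 0 ≤ p) (hq : 0 ≤ q) =>
      intervalIntegrable_of_locallyIntegrableOn_Ici hc hp hq
    have hdi := fun {p q : ℝ} (hp : 0 ≤ p) (hq : 0 ≤ q) =>
      (hsol.isPath hη).drift_integrable' hf hD₁ hp hq
    have hdn := fun {s t : ℝ} => IsSolution.drift_integral_nonneg hf hD₁ hη hsol (R := R)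
      (fun t ht => (hzK ht).1) (s := s) (t := t)
    have hG2 : MapsTo (fun t => ∫ s in (0 : ℝ)..t, c s) (Icc 0 R) (Icc 0 K) := fun t ht => by
      refine ⟨integral_nonneg_of_control_nonneg hc0 le_rfl ht.1, le_trans ?_ hcK⟩
      rw [← intervalIntegral.integral_add_adjacent_intervals (hci le_rfl ht.1) (hci ht.1 hR)]
      linarith [integral_nonneg_of_control_nonneg hc0 ht.1 ht.2]
    -- Capital plus accumulated drift minus accumulated consumption. The former is z plus the
    -- latter, hence at most 2K.
    refine hk z (fun t => η₀ + ∫ s in (0 : ℝ)..t, f (z s) (D₁ z s))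
      (fun t => ∫ s in (0 : ℝ)..t, c s) (hsol.isPath hη) hsol.history
      (fun t ht => hsol.integral_eq t ht.1) ?_ ?_ ?_ ?_
    · intro s hs t ht hst
      have := hdn hs.1 hst ht.2
      simp only
      rw [← intervalIntegral.integral_add_adjacent_intervals (hdi le_rfl hs.1) (hdi hs.1 ht.1)]
      linarith
    · intro s hs t ht hst
      simp only
      rw [← intervalIntegral.integral_add_adjacent_intervals (hci le_rfl hs.1) (hci hs.1 ht.1)]
      linarith [integral_nonneg_of_control_nonneg hc0 hs.1 hst]
    · intro t ht
      have h1 := hsol.integral_eq t ht.1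
      have h2 := (hzK ht).2
      have h3 := (hG2 ht).2
      have h4 := hdn le_rfl ht.1 ht.2
      exact ⟨by linarith, by simp only at h3; linarith⟩
    · exact fun t ht => ⟨(hG2 ht).1, (hG2 ht).2.trans (by linarith)⟩
  rcases hz with rfl | rfl
  · intro t ht
    exact (hx.abs_sub_le_of_delay hf hDk hD hη hx' (hgen _ hDk hx) he0.le t ht).trans (hbound t ht)
  · intro t ht
    have h1 := hgen _ hD hx'
    simp_rw [abs_sub_comm (Dn k z _)] at h1
    rw [abs_sub_comm]
    exact (hx'.abs_sub_le_of_delay hf hD hDk hη hx h1 he0.le t ht).trans (hbound t ht)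

end Transfer

/-! ### Stability of the values and of truncated controls. -/

section Approximation

variable {T A C ρ : ℝ} {f : ℝ → ℝ → ℝ} {D : (ℝ → ℝ) → ℝ → ℝ} {Dn : ℕ → (ℝ → ℝ) → ℝ → ℝ}
  {U₁ U₂ : ℝ → ℝ} {η₀ : ℝ} {η₁ c x : ℝ → ℝ}

lemma locallyIntegrableOn_truncate (hc : LocallyIntegrableOn c (Ici 0)) (M : ℝ) :
    LocallyIntegrableOn (truncate M c) (Ici 0) := by
  have h : truncate M c = (Iic M).indicator c := by
    ext t
    by_cases h : t ≤ M <;> simp [truncate, h]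
  rw [h]
  exact locallyIntegrableOn_Ici_of_integrableOn fun S _ =>
    (hc.integrableOn_compact_subset Icc_subset_Ici_self isCompact_Icc).indicator measurableSet_Iic

/-- Stopping consumption at M only raises the state and loses at most 2B of consumption utility per
unit of discounted time after M. Since the state then never falls below its value at M, a floor on
[0,M] becomes a floor for all times. -/
lemma IsControlProblem.exists_truncation (hP : IsControlProblem T A C ρ f D U₁ U₂)
    (hη : IsHistory T η₁) (h : IsAdmissiblePair T f D η₀ η₁ c x) (hfin : HasFinitePayoff ρ U₂ x)
    {B M : ℝ} (hB : ∀ u, 0 ≤ u → |U₁ u| ≤ B) (hM : 0 ≤ M) :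
    ∃ y, IsAdmissiblePair T f D η₀ η₁ (truncate M c) y ∧ HasFinitePayoff ρ U₂ y ∧
      (∀ m, 0 ≤ m → (∀ t ∈ Icc 0 M, m ≤ x t) → ∀ t, 0 ≤ t → m ≤ y t) ∧
      realPayoff ρ U₁ U₂ c x - Real.exp (-ρ * M) * (2 * B) / ρ ≤
        realPayoff ρ U₁ U₂ (truncate M c) y := by
  have hρ := hP.discount_pos
  have hc := h.locallyIntegrable
  have hc' := locallyIntegrableOn_truncate hc M
  have hc0' : ∀ t, 0 ≤ t → 0 ≤ truncate M c t := fun t ht => by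
    rw [truncate]
    split_ifs
    exacts [h.control_nonneg t ht, le_rfl]
  have hcle : ∀ t, 0 ≤ t → truncate M c t ≤ c t := fun t ht => by
    rw [truncate]
    split_ifs
    exacts [le_rfl, h.control_nonneg t ht]
  have hzero : ∀ t, M < t → truncate M c t = 0 := fun t ht => if_neg (not_le.2 ht)
  obtain ⟨y, hy⟩ := exists_solution hP.production hP.delay η₀ hη.integrable hc'
  have hxy : ∀ t, 0 ≤ t → x t ≤ y t := fun t ht =>
    h.solution.le_of_cost_le hP.production hP.delay hη hy (S := t) (fun s hs => by
      have := intervalIntegral.integral_mono_on hs.1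
        (intervalIntegrable_of_locallyIntegrableOn_Ici hc' le_rfl hs.1)
        (intervalIntegrable_of_locallyIntegrableOn_Ici hc le_rfl hs.1) fun r hr => hcle r hr.1
      linarith) t ⟨ht, le_rfl⟩
  have hy0 : ∀ t, 0 ≤ t → 0 < y t := fun t ht => (h.state_pos t ht).trans_le (hxy t ht)
  have hadm : IsAdmissiblePair T f D η₀ η₁ (truncate M c) y := ⟨hc', hc0', hy, hy0⟩
  have hfin' : HasFinitePayoff ρ U₂ y :=
    hfin.of_ge hP.state h.state_pos hy.continuousOn (fun t ht => hxy t ht.le) hy0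
  refine ⟨y, hadm, hfin', fun m hm hxm => ?_, ?_⟩
  · have h1 : ∀ t ∈ Icc 0 M, m ≤ y t := fun t ht => (hxm t ht).trans (hxy t ht.1)
    intro t ht
    rcases le_total t M with htM | htM
    · exact h1 t ⟨ht, htM⟩
    · exact (h1 M ⟨hM, le_rfl⟩).trans (hy.ge_after hP.production hP.delay hη hc' hM
        (fun s hs => hm.trans (h1 s hs)) hzero t htM)
  · have i1 := hP.integrable_consumption h
    have i2 := hP.integrable_consumption hadm
    have i3 : Integrable ((Ioi M).indicator fun t => Real.exp (-ρ * t) * (2 * B)) :=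
      (integrable_indicator_iff measurableSet_Ioi).2 ((integrableOn_discount hρ M).mul_const _)
    have h1 := setIntegral_mono_on i1 (Integrable.add i2 i3.integrableOn) measurableSet_Ioi
      fun t (ht : 0 < t) => by
        simp only [Pi.add_apply]
        rcases le_or_gt t M with htM | htM
        · rw [indicator_of_notMem (show t ∉ Ioi M from not_lt.2 htM), add_zero, truncate,
            if_pos htM]
        · rw [indicator_of_mem (mem_Ioi.2 htM), hzero t htM, ← mul_add]
          refine mul_le_mul_of_nonneg_left ?_ (Real.exp_pos _).le
          have e1 := (abs_le.1 (hB (c t) (h.control_nonneg t ht.le))).2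
          have e2 := (abs_le.1 (hB 0 le_rfl)).1
          linarith
    rw [integral_add' i2 i3.integrableOn, setIntegral_indicator measurableSet_Ioi,
      inter_eq_right.2 (Ioi_subset_Ioi hM), integral_mul_const, integral_discount hρ] at h1
    have h2 := setIntegral_mono_on hfin hfin' measurableSet_Ioi fun t (ht : 0 < t) =>
      mul_le_mul_of_nonneg_left (hP.state.mono (mem_Ioi.2 (h.state_pos t ht.le))
        (mem_Ioi.2 (hy0 t ht.le)) (hxy t ht.le)) (Real.exp_pos (-ρ * t)).le
    have h3 : Real.exp (-ρ * M) / ρ * (2 * B) = Real.exp (-ρ * M) * (2 * B) / ρ := by ring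
    rw [realPayoff, realPayoff]
    linarith

lemma exists_discount_small (hρ : 0 < ρ) (B : ℝ) {ε : ℝ} (hε : 0 < ε) :
    ∃ M₀, 0 ≤ M₀ ∧ ∀ M, M₀ ≤ M → Real.exp (-ρ * M) * (2 * B) / ρ ≤ ε := by
  have hlim : Tendsto (fun R => Real.exp (-ρ * R) * (2 * B) / ρ) atTop (𝓝 0) := by
    have h1 : Tendsto (fun R : ℝ => Real.exp (-(ρ * R))) atTop (𝓝 0) :=
      Real.tendsto_exp_neg_atTop_nhds_zero.comp (tendsto_id.const_mul_atTop hρ)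
    have h2 := (h1.mul_const (2 * B)).div_const ρ
    simpa [neg_mul] using h2
  obtain ⟨M₀, hM₀⟩ := eventually_atTop.1 (hlim.eventually_le_const hε)
  exact ⟨max M₀ 0, le_max_right _ _, fun M hM => hM₀ M ((le_max_left _ _).trans hM)⟩

lemma IsAdmissiblePair.exists_floor (h : IsAdmissiblePair T f D η₀ η₁ c x) {M : ℝ} (hM : 0 ≤ M) :
    ∃ m, 0 < m ∧ ∀ t ∈ Icc 0 M, m ≤ x t := by
  obtain ⟨t₀, ht₀, hmin⟩ := isCompact_Icc.exists_isMinOn (nonempty_Icc.2 hM)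
    (h.solution.continuousOn.mono (Icc_subset_Ici_self : Icc (0 : ℝ) M ⊆ Ici 0))
  exact ⟨x t₀, h.state_pos t₀ ht₀.1, fun t ht => hmin ht⟩

lemma exists_bound_Icc (hx : ContinuousOn x (Ici 0)) (R : ℝ) :
    ∃ K, 0 ≤ K ∧ ∀ t ∈ Icc 0 R, x t ≤ K := by
  obtain ⟨K, hK⟩ := isCompact_Icc.exists_bound_of_continuousOn
    (hx.mono (Icc_subset_Ici_self : Icc (0 : ℝ) R ⊆ Ici 0))
  exact ⟨max K 0, le_max_right _ _, fun t ht =>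
    ((le_abs_self _).trans (hK t ht)).trans (le_max_left _ _)⟩

/-- The limit value is not larger than the limit of the values. -/
theorem DelayConverges.eventually_realValue_ge (hconv : DelayConverges T η₁ Dn D)
    (hP : IsControlProblem T A C ρ f D U₁ U₂) (hDn : ∀ᶠ k in atTop, IsDelayOp T A (Dn k))
    (hη : IsHistory T η₁) (hη₀ : 0 < η₀) {ε : ℝ} (hε : 0 < ε) :
    ∀ᶠ k in atTop, realValue T ρ f U₁ U₂ D η₀ η₁ - ε ≤ realValue T ρ f U₁ U₂ (Dn k) η₀ η₁ := by
  obtain ⟨B, hB⟩ := hP.consumption.bounded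
  obtain ⟨c, x, hadm, hfin, hlt⟩ := hP.exists_near hη hη₀
    (show realValue T ρ f U₁ U₂ D η₀ η₁ - ε / 3 < _ by linarith)
  obtain ⟨M, hM, hMle⟩ := exists_discount_small hP.discount_pos B (show 0 < ε / 3 by linarith)
  obtain ⟨y, hyadm, hyfin, hym, hyJ⟩ := hP.exists_truncation hη hadm hfin hB hM
  obtain ⟨m, hm, hxm⟩ := hadm.exists_floor hM
  obtain ⟨R, σ, hMR, hσ, htr⟩ := exists_transfer hP.state hP.discount_pos hm hM
    (show 0 < ε / 3 by linarith)
  have hR : 0 ≤ R := hM.trans hMR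
  obtain ⟨K, hK0, hK⟩ := exists_bound_Icc hyadm.solution.continuousOn R
  filter_upwards [hDn, hconv.trajectory hP.production hP.delay hDn hη
    (K := max K (∫ s in (0 : ℝ)..R, truncate M c s)) hR (le_max_of_le_left hK0) hη₀.le hσ]
    with k hDk hk
  obtain ⟨x', hx'⟩ := exists_solution hP.production hDk η₀ hη.integrable hyadm.locallyIntegrable
  have hclose := hk _ x' y y hyadm.locallyIntegrable hyadm.control_nonneg hx' hyadm.solution
    (Or.inr rfl) (fun t ht => ⟨(hyadm.state_pos t ht.1).le, (hK t ht).trans (le_max_left _ _)⟩)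
    (le_max_right _ _)
  obtain ⟨h1, h2, h3⟩ := htr A C f D (Dn k) U₁ η₀ η₁ _ y x' hP.production hDk hη hyadm hyfin
    (fun t ht => if_neg (not_le.2 ht)) (hym m hm.le hxm) hx'
    (fun t ht => by rw [abs_sub_comm]; exact hclose t ht)
  have hPk : IsControlProblem T A C ρ f (Dn k) U₁ U₂ := { hP with delay := hDk }
  have h4 := hPk.realPayoff_le_realValue hη hη₀ h1 h2
  have h5 := hMle M le_rfl
  linarith

/-- Truncations of optimal controls of approximating problems are nearly as good for the limit
problem. -/
theorem DelayConverges.eventually_truncate (hconv : DelayConverges T η₁ Dn D) (hT : 0 < T)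
    (hP : IsControlProblem T A C ρ f D U₁ U₂) (hDn : ∀ᶠ k in atTop, IsDelayOp T A (Dn k))
    (hmem : ∀ᶠ k in atTop, ∃ B, HasFadingMemory T A B (Dn k))
    (hsing : Tendsto (fun x => x * U₂ x) (𝓝[>] 0) atBot) (hη : IsHistory T η₁) (hη₀ : 0 < η₀)
    {ε B M : ℝ} (hε : 0 < ε) (hB : ∀ u, 0 ≤ u → |U₁ u| ≤ B) (hM : 0 ≤ M)
    (hMB : Real.exp (-ρ * M) * (2 * B) / ρ ≤ ε / 2) :
    ∀ᶠ k in atTop, ∀ c x, IsOptimalPair T ρ f U₁ U₂ (Dn k) η₀ η₁ c x →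
      ∃ y, IsAdmissiblePair T f D η₀ η₁ (truncate M c) y ∧ HasFinitePayoff ρ U₂ y ∧
        realValue T ρ f U₁ U₂ (Dn k) η₀ η₁ - ε ≤ realPayoff ρ U₁ U₂ (truncate M c) y := by
  have hf := hP.production
  have hD := hP.delay
  have hU := hP.consumption
  have hρ := hP.discount_pos
  obtain ⟨Y, hY⟩ := hP.exists_free hη η₀
  have hYpos : ∀ t, 0 ≤ t → 0 ≤ Y t := fun t ht => hη₀.le.trans (hY.ge_initial hf hD hη hη₀.le t ht)
  -- Comparing only the trajectories without consumption gives bounds for all states and all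
  -- cumulative consumptions that hold for every large k.
  have hfree : ∀ R, 0 ≤ R → ∃ K, 0 < K ∧ ∀ᶠ k in atTop, ∀ c x,
      IsAdmissiblePair T f (Dn k) η₀ η₁ c x →
      (∀ t ∈ Icc 0 R, x t ≤ K) ∧ ∫ s in (0 : ℝ)..R, c s ≤ K := by
    intro R hR
    obtain ⟨K, hK0, hK⟩ := exists_bound_Icc hY.continuousOn R
    refine ⟨K + 1, by linarith, ?_⟩
    filter_upwards [hDn, hconv.trajectory hf hD hDn hη hR hK0 hη₀.le zero_lt_one]
      with k hDk hk c x hadm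
    have h0 : LocallyIntegrableOn (fun _ : ℝ => (0 : ℝ)) (Ici 0) :=
      (locallyIntegrable_const (0 : ℝ)).locallyIntegrableOn _
    obtain ⟨X, hX⟩ := exists_solution hf hDk η₀ hη.integrable h0
    have h1 := hk _ X Y Y h0 (fun _ _ => le_rfl) hX hY (Or.inr rfl)
      (fun t ht => ⟨hYpos t ht.1, hK t ht⟩) (by simpa using hK0)
    have h2 : ∀ t ∈ Icc 0 R, X t ≤ K + 1 := fun t ht => by
      linarith [(abs_le.1 (h1 t ht)).2, hK t ht]
    refine ⟨fun t ht => (hadm.solution.le_free hf hDk hη hX hadm.control_nonneg t ht.1).trans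
      (h2 t ht), ?_⟩
    exact (hadm.solution.integral_control_le_free hf hDk hη hX hadm.control_nonneg hR
      (hadm.state_pos R hR).le).trans (h2 R ⟨hR, le_rfl⟩)
  obtain ⟨K, hK0, hK⟩ := hfree (M + 1) (by linarith)
  obtain ⟨N, hN, hNK⟩ := hU.exists_deriv_lt (ε := Real.exp (-ρ * (M + 1)) * deriv U₁ (2 * K))
    (mul_pos (Real.exp_pos _) (hU.deriv_pos _ (by linarith)))
  -- The loss of state utility at an optimum is at most B / ρ minus the lower bound for the value
  -- obtained from zero consumption.
  obtain ⟨m, hm, hfloor⟩ := exists_backward_floor hP.state hρ hsing hN hη₀ M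
    (B / ρ - (-B + U₂ η₀) / ρ)
  obtain ⟨R, σ, hMR, hσ, htr⟩ := exists_transfer hP.state hρ hm hM (show 0 < ε / 2 by linarith)
  have hR : 0 ≤ R := hM.trans hMR
  obtain ⟨K', hK0', hK'⟩ := hfree R hR
  filter_upwards [hDn, hmem, hK, hK', hconv.trajectory hf hD hDn hη hR hK0'.le hη₀.le hσ]
    with k hDk hmk hKk hKk' hk c x hopt
  have hPk : IsControlProblem T A C ρ f (Dn k) U₁ U₂ := { hP with delay := hDk }
  obtain ⟨Bk, hmk⟩ := hmk
  have hadm := hopt.admissible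
  have hcN := hopt.control_le hPk hT hmk hη hη₀ hK0 hN (hKk c x hadm).2 hNK
  have hJ : (-∫ t in Ioi 0, Real.exp (-ρ * t) * U₂ (x t)) ≤ B / ρ - (-B + U₂ η₀) / ρ := by
    have h1 := hPk.le_realValue hη hη₀ hB
    rw [← hopt.realPayoff_eq, realPayoff] at h1
    have h2 := integral_discount_mul_le hρ (hPk.integrable_consumption hadm) (B := B)
      fun t ht => (le_abs_self _).trans (hB (c t) (hadm.control_nonneg t ht.le))
    rw [mul_zero, Real.exp_zero, one_mul] at h2
    linarith
  have hxm := hfloor A C f (Dn k) η₁ c x hf hDk hη hadm hopt.finite hcN hJ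
  obtain ⟨z, hzadm, hzfin, hzm, hzJ⟩ := hPk.exists_truncation hη hadm hopt.finite hB hM
  obtain ⟨y, hy⟩ := exists_solution hf hD η₀ hη.integrable hzadm.locallyIntegrable
  obtain ⟨hz1, hz2⟩ := hKk' _ z hzadm
  have hclose := hk _ z y z hzadm.locallyIntegrable hzadm.control_nonneg hzadm.solution hy
    (Or.inl rfl) (fun t ht => ⟨(hzadm.state_pos t ht.1).le, hz1 t ht⟩) hz2
  obtain ⟨h1, h2, h3⟩ := htr A C f (Dn k) D U₁ η₀ η₁ _ z y hf hD hη hzadm hzfin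
    (fun t ht => if_neg (not_le.2 ht)) (hzm m hm.le hxm) hy hclose
  refine ⟨y, h1, h2, ?_⟩
  rw [hopt.realPayoff_eq] at hzJ
  linarith

lemma nonposUtility_zero : NonposUtility (fun _ => 0) :=
  ⟨continuousOn_const, monotoneOn_const, concaveOn_const 0 (convex_Ioi 0), fun _ _ => le_rfl⟩

lemma hasFinitePayoff_zero : HasFinitePayoff ρ (fun _ => 0) x := by
  simp [HasFinitePayoff]

lemma IsControlProblem.without_state (hP : IsControlProblem T A C ρ f D U₁ U₂) :
    IsControlProblem T A C ρ f D U₁ (fun _ => 0) := { hP with state := nonposUtility_zero }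

lemma IsControlProblem.realPayoff_le_without_state (hP : IsControlProblem T A C ρ f D U₁ U₂)
    (h : IsAdmissiblePair T f D η₀ η₁ c x) :
    realPayoff ρ U₁ U₂ c x ≤ realPayoff ρ U₁ (fun _ => 0) c x := by
  have := hP.state_integral_nonpos h.state_pos Subset.rfl measurableSet_Ioi
  simp only [realPayoff, mul_zero, integral_zero]
  linarith

lemma IsControlProblem.realValue_le_without_state (hP : IsControlProblem T A C ρ f D U₁ U₂)
    (hη : IsHistory T η₁) (hη₀ : 0 < η₀) :
    realValue T ρ f U₁ U₂ D η₀ η₁ ≤ realValue T ρ f U₁ (fun _ => 0) D η₀ η₁ := by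
  refine le_of_forall_lt fun r hr => ?_
  obtain ⟨c, x, hadm, -, hlt⟩ := hP.exists_near hη hη₀ hr
  exact hlt.trans_le ((hP.realPayoff_le_without_state hadm).trans
    (hP.without_state.realPayoff_le_realValue hη hη₀ hadm hasFinitePayoff_zero))

/-- State utilities vanishing outside a small neighbourhood of zero hardly change the value. -/
lemma exists_realValue_gt (hP : IsControlProblem T A C ρ f D U₁ (fun _ => 0))
    (hη : IsHistory T η₁) (hη₀ : 0 < η₀) {V : ℕ → ℝ → ℝ} (hV : ∀ n, 1 ≤ n → NonposUtility (V n))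
    (hV0 : ∀ n : ℕ, 1 ≤ n → ∀ x : ℝ, 1 / (n : ℝ) ≤ x → V n x = 0) {ε : ℝ} (hε : 0 < ε) :
    ∃ n, 1 ≤ n ∧ realValue T ρ f U₁ (fun _ => 0) D η₀ η₁ - ε <
      realValue T ρ f U₁ (V n) D η₀ η₁ := by
  obtain ⟨B, hB⟩ := hP.consumption.bounded
  obtain ⟨c, x, hadm, hfin, hlt⟩ := hP.exists_near hη hη₀
    (show realValue T ρ f U₁ (fun _ => 0) D η₀ η₁ - ε / 2 < _ by linarith)
  obtain ⟨M, hM, hMle⟩ := exists_discount_small hP.discount_pos B (show 0 < ε / 2 by linarith)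
  obtain ⟨y, hyadm, hyfin, hym, hyJ⟩ := hP.exists_truncation hη hadm hfin hB hM
  obtain ⟨m, hm, hxm⟩ := hadm.exists_floor hM
  -- Once 1/(n+1) lies below the floor of the truncated trajectory, the state utility with index n +
  -- 1 vanishes along it and the payoff is unchanged.
  obtain ⟨n, hn⟩ := exists_nat_one_div_lt hm
  have hy : ∀ t ∈ Ioi (0 : ℝ), V (n + 1) (y t) = 0 := fun t ht =>
    hV0 (n + 1) (by omega) _ (by
      have := hym m hm.le hxm t (le_of_lt ht)
      push_cast
      linarith)
  refine ⟨n + 1, by omega, ?_⟩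
  have hPn : IsControlProblem T A C ρ f D U₁ (V (n + 1)) := { hP with state := hV _ (by omega) }
  have hfin' : HasFinitePayoff ρ (V (n + 1)) y := by
    refine (integrableOn_zero (ε' := ℝ)).congr_fun (fun t ht => ?_) measurableSet_Ioi
    rw [hy t ht, mul_zero]
  have h1 := hPn.realPayoff_le_realValue hη hη₀ hyadm hfin'
  have h2 : realPayoff ρ U₁ (V (n + 1)) (truncate M c) y =
      realPayoff ρ U₁ (fun _ => 0) (truncate M c) y := by
    rw [realPayoff, realPayoff]
    congr 1
    refine setIntegral_congr_fun measurableSet_Ioi fun t ht => ?_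
    rw [hy t ht]
  have h3 := hMle M le_rfl
  linarith

end Approximation

/-! ### Passing to the extended production function. -/

section Extension

variable {T ρ C : ℝ} {f₀ : ℝ → ℝ → ℝ} {U₁ U₂ : ℝ → ℝ} {D : (ℝ → ℝ) → ℝ → ℝ} {η₀ : ℝ}
  {η₁ c x : ℝ → ℝ}

/-- Extension of a production function to negative states. -/
def extendProduction (f₀ : ℝ → ℝ → ℝ) (x y : ℝ) : ℝ := f₀ (max x 0) y

/-- Admissible trajectories are positive, and there the two production functions agree. -/
lemma isAdmissiblePair_extendProduction (T : ℝ) (f₀ : ℝ → ℝ → ℝ) :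
    IsAdmissiblePair T f₀ = IsAdmissiblePair T (extendProduction f₀) := by
  have hint : ∀ {D : (ℝ → ℝ) → ℝ → ℝ} {x : ℝ → ℝ}, (∀ t, 0 ≤ t → 0 < x t) → ∀ t, 0 ≤ t →
      ∫ s in (0 : ℝ)..t, f₀ (x s) (D x s) = ∫ s in (0 : ℝ)..t, extendProduction f₀ (x s) (D x s) :=
    fun hx t ht => intervalIntegral.integral_congr fun s hs => by
      rw [uIcc_of_le ht] at hs
      simp only [extendProduction, max_eq_left (hx s hs.1).le]
  funext D η₀ η₁ c x
  refine propext ⟨fun h => ?_, fun h => ?_⟩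
  · exact ⟨h.locallyIntegrable, h.control_nonneg, ⟨h.solution.history, h.solution.continuousOn,
      fun t ht => by rw [← hint h.state_pos t ht]; exact h.solution.integral_eq t ht⟩, h.state_pos⟩
  · exact ⟨h.locallyIntegrable, h.control_nonneg, ⟨h.solution.history, h.solution.continuousOn,
      fun t ht => by rw [hint h.state_pos t ht]; exact h.solution.integral_eq t ht⟩, h.state_pos⟩

lemma value_extendProduction (T ρ : ℝ) (f₀ : ℝ → ℝ → ℝ) :
    value T ρ f₀ = value T ρ (extendProduction f₀) := by
  unfold value
  rw [isAdmissiblePair_extendProduction]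

lemma isOptimal_extendProduction (T ρ : ℝ) (f₀ : ℝ → ℝ → ℝ) :
    IsOptimal T ρ f₀ = IsOptimal T ρ (extendProduction f₀) := by
  unfold IsOptimal
  rw [isAdmissiblePair_extendProduction, value_extendProduction]

lemma isEpsOptimal_extendProduction (T ρ : ℝ) (f₀ : ℝ → ℝ → ℝ) :
    IsEpsOptimal T ρ f₀ = IsEpsOptimal T ρ (extendProduction f₀) := by
  unfold IsEpsOptimal
  rw [isAdmissiblePair_extendProduction, value_extendProduction]

lemma isFeedback_extendProduction (T ρ : ℝ) (f₀ : ℝ → ℝ → ℝ) :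
    IsFeedback T ρ f₀ = IsFeedback T ρ (extendProduction f₀) := by
  unfold IsFeedback
  rw [isAdmissiblePair_extendProduction, value_extendProduction]

lemma StateUtility.nonposUtility (h : StateUtility ρ C U₂) {n : ℕ}
    (h0 : ∀ x : ℝ, 1 / (n : ℝ) ≤ x → U₂ x = 0) : NonposUtility U₂ :=
  ⟨h.continuousOn, h.mono, h.concave, fun x hx => by
    rw [← h0 (max x (1 / n)) (le_max_right _ _)]
    exact h.mono (mem_Ioi.2 hx) (mem_Ioi.2 (lt_max_of_lt_left hx)) (le_max_left _ _)⟩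

lemma isHistory_of_memLp (hη : MemLp η₁ 2 (volume.restrict (Icc (-T) 0)))
    (hη0 : ∀ᵐ s ∂(volume.restrict (Icc (-T) 0)), 0 ≤ η₁ s) : IsHistory T η₁ :=
  ⟨IntegrableOn.mono_set (hη.integrable (by norm_num)) Ico_subset_Icc_self,
    ae_restrict_of_ae_restrict_of_subset Ico_subset_Icc_self hη0⟩

end Extension

/-! ### Thresholds for the truncation time and the kernel index. -/

section Convergence

variable {T A C ρ : ℝ} {f : ℝ → ℝ → ℝ} {D : (ℝ → ℝ) → ℝ → ℝ} {Dn : ℕ → (ℝ → ℝ) → ℝ → ℝ}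
  {U₁ U₂ : ℝ → ℝ} {η₀ : ℝ} {η₁ : ℝ → ℝ}

/-- The values converge, and truncated optimal controls of the approximating problems are
`ε`-optimal for the limit problem. -/
theorem DelayConverges.exists_thresholds (hconv : DelayConverges T η₁ Dn D) (hT : 0 < T)
    (hP : IsControlProblem T A C ρ f D U₁ U₂) (hDn : ∀ᶠ k in atTop, IsDelayOp T A (Dn k))
    (hmem : ∀ᶠ k in atTop, ∃ B, HasFadingMemory T A B (Dn k))
    (hex : ∀ᶠ k in atTop, ∃ c x, IsOptimalPair T ρ f U₁ U₂ (Dn k) η₀ η₁ c x)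
    (hsing : Tendsto (fun x => x * U₂ x) (𝓝[>] 0) atBot) (hη : IsHistory T η₁) (hη₀ : 0 < η₀)
    {ε : ℝ} (hε : 0 < ε) :
    ∃ M₀ : ℝ, ∀ M, M₀ ≤ M → ∃ k₀, ∀ k, k₀ ≤ k →
      |realValue T ρ f U₁ U₂ (Dn k) η₀ η₁ - realValue T ρ f U₁ U₂ D η₀ η₁| ≤ ε ∧
      ∀ c, IsOptimal T ρ f U₁ U₂ (Dn k) η₀ η₁ c →
        ∃ y, IsAdmissiblePair T f D η₀ η₁ (truncate M c) y ∧ HasFinitePayoff ρ U₂ y ∧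
          realValue T ρ f U₁ U₂ D η₀ η₁ - ε < realPayoff ρ U₁ U₂ (truncate M c) y := by
  obtain ⟨B, hB⟩ := hP.consumption.bounded
  obtain ⟨M₀, hM₀, hM₀le⟩ := exists_discount_small hP.discount_pos B
    (show 0 < ε / 2 / 2 by linarith)
  refine ⟨M₀, fun M hM => eventually_atTop.1 ?_⟩
  filter_upwards [hDn, hex,
    hconv.eventually_realValue_ge hP hDn hη hη₀ (show 0 < ε / 4 by linarith),
    hconv.eventually_truncate hT hP hDn hmem hsing hη hη₀ (half_pos hε) hB (hM₀.trans hM)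
      (hM₀le M hM)] with k hDk hexk h1 h2
  have hPk : IsControlProblem T A C ρ f (Dn k) U₁ U₂ := { hP with delay := hDk }
  refine ⟨?_, fun c hc => ?_⟩
  · obtain ⟨c, x, hopt⟩ := hexk
    obtain ⟨y, hy, hyfin, hJ⟩ := h2 c x hopt
    have h3 := hP.realPayoff_le_realValue hη hη₀ hy hyfin
    exact abs_le.2 ⟨by linarith, by linarith⟩
  · obtain ⟨x, hopt⟩ := (hPk.isOptimal_iff hη hη₀).1 hc
    obtain ⟨y, hy, hyfin, hJ⟩ := h2 c x hopt
    exact ⟨y, hy, hyfin, by linarith⟩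

end Convergence
end DelayControl

theorem proposition4p8
    (T ρ C : ℝ) (hT : 0 < T) (hρ : 0 < ρ)
    (f₀ : ℝ → ℝ → ℝ) (hf₀ : ProductionHyp f₀ C)
    (U₁ : ℝ → ℝ) (hU₁ : ConsumptionUtility U₁)
    -- the state utilities, indexed by the integers `n ≥ 1`
    (U₂ : ℕ → ℝ → ℝ)
    (hU₂ : ∀ n, 1 ≤ n → StateUtility ρ C (U₂ n))
    (hU₂mono : ∀ n, 1 ≤ n → ∀ x, 0 < x → U₂ n x ≤ U₂ (n + 1) x)
    (hU₂zero : ∀ n : ℕ, 1 ≤ n → ∀ x : ℝ, 1 / (n : ℝ) ≤ x → U₂ n x = 0)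
    (hU₂sing : ∀ n, 1 ≤ n → Tendsto (fun x => x * U₂ n x) (𝓝[>] 0) atBot)
    -- the kernels, converging weakly-* to the Dirac mass at `-T/2`
    (a : ℕ → ℝ → ℝ) (ha : ∀ k, DelayKernel T (a k))
    (haδ : ∀ φ : ℝ → ℝ, ContinuousOn φ (Icc (-T) 0) →
      Tendsto (fun k => ∫ ξ in (-T)..0, a k ξ * φ ξ) atTop (𝓝 (φ (-(T / 2)))))
    -- the initial datum in `H₊₊`
    (η₀ : ℝ) (η₁ : ℝ → ℝ) (hη₀ : 0 < η₀)
    (hη₁ : MemLp η₁ 2 (volume.restrict (Icc (-T) 0)))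
    (hη₁nonneg : ∀ᵐ s ∂(volume.restrict (Icc (-T) 0)), 0 ≤ η₁ s) :
    -- every distributed-delay problem has an optimal feedback control
    (∀ n, 1 ≤ n → ∀ k, ∃ c : ℝ → ℝ,
      IsOptimal T ρ f₀ U₁ (U₂ n) (distributedDelay T (a k)) η₀ η₁ c ∧
      IsFeedback T ρ f₀ U₁ (U₂ n) (distributedDelay T (a k)) η₀ η₁ c) ∧
    -- `M` is large means `M ≥ Mbar ε n`, then `k` is large means `k ≥ Kbar ε n M`
    ∃ (Mbar : ℝ → ℕ → ℝ) (Kbar : ℝ → ℕ → ℝ → ℕ) (nn : ℝ → ℕ),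
      (∀ ε, 0 < ε → 1 ≤ nn ε) ∧
      ∀ (M : ℝ → ℕ → ℝ) (k : ℝ → ℕ → ℕ),
        (∀ ε, 0 < ε → ∀ n, 1 ≤ n → Mbar ε n ≤ M ε n ∧ Kbar ε n (M ε n) ≤ k ε n) →
        Tendsto
          (fun ε => value T ρ f₀ U₁ (U₂ (nn ε))
            (distributedDelay T (a (k ε (nn ε)))) η₀ η₁)
          (𝓝[>] 0)
          (𝓝 (value T ρ f₀ U₁ (fun _ => 0) (pointwiseDelay T) η₀ η₁)) ∧
        ∀ cstar : ℕ → ℕ → ℝ → ℝ,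
          (∀ n, 1 ≤ n → ∀ j,
            IsOptimal T ρ f₀ U₁ (U₂ n) (distributedDelay T (a j)) η₀ η₁ (cstar n j)) →
          (∀ ε, 0 < ε → ∀ n, 1 ≤ n →
            IsEpsOptimal T ρ f₀ U₁ (U₂ n) (pointwiseDelay T) η₀ η₁ ε
              (truncate (M ε n) (cstar n (k ε n)))) ∧
          (∀ ε, 0 < ε →
            IsEpsOptimal T ρ f₀ U₁ (fun _ => 0) (pointwiseDelay T) η₀ η₁ (3 * ε)
              (truncate (M ε (nn ε)) (cstar (nn ε) (k ε (nn ε))))) := by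
  have hη : IsHistory T η₁ := isHistory_of_memLp hη₁ hη₁nonneg
  have hf : RegularProduction (extendProduction f₀) C := hf₀.regular
  have hN : ∀ n, 1 ≤ n → NonposUtility (U₂ n) := fun n hn =>
    (hU₂ n hn).nonposUtility (hU₂zero n hn)
  have hac : ∀ k, ContinuousOn (a k) (Icc (-T) 0) := fun k => (ha k).memW12.continuousOn hT.le
  have hDk : ∀ k A, ∫ ξ in (-T)..0, a k ξ ≤ A → IsDelayOp T A (distributedDelay T (a k)) :=
    fun k A hA => isDelayOp_distributedDelay hT (hac k) (ha k).nonneg hA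
  have hPk : ∀ n, 1 ≤ n → ∀ k, IsControlProblem T (∫ ξ in (-T)..0, a k ξ) C ρ
      (extendProduction f₀) (distributedDelay T (a k)) U₁ (U₂ n) := fun n hn k =>
    ⟨hρ, hf, hDk k _ le_rfl, hU₁, hN n hn⟩
  have hP₀ : ∀ n, 1 ≤ n → IsControlProblem T 2 C ρ (extendProduction f₀) (pointwiseDelay T) U₁
      (U₂ n) := fun n hn => ⟨hρ, hf, isDelayOp_pointwiseDelay hT one_le_two, hU₁, hN n hn⟩
  have hP₀₀ := (hP₀ 1 le_rfl).without_state
  have hex : ∀ n, 1 ≤ n → ∀ k, ∃ c x, IsOptimalPair T ρ (extendProduction f₀) U₁ (U₂ n)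
      (distributedDelay T (a k)) η₀ η₁ c x := fun n hn k =>
    (hPk n hn k).exists_isOptimalPair hη hη₀ (hU₂sing n hn) fun y hy S =>
      distributedDelay_bddAbove hT (hac k) hy S
  rw [value_extendProduction, isOptimal_extendProduction, isEpsOptimal_extendProduction,
    isFeedback_extendProduction]
  refine ⟨fun n hn k => ?_, ?_⟩
  · obtain ⟨c, x, hopt⟩ := hex n hn k
    obtain ⟨B, hB⟩ := hasFadingMemory_distributedDelay hT (hac k) (ha k).nonneg
      (le_refl (∫ ξ in (-T)..0, a k ξ))
    exact hopt.exists_feedback (hPk n hn k) hT hB hη hη₀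
  -- The masses tend to 1, so 2 eventually bounds the norm of all delay operators, including the
  -- pointwise one.
  have hmass : ∀ᶠ k in atTop, ∫ ξ in (-T)..0, a k ξ ≤ 2 := by
    have := haδ (fun _ => 1) continuousOn_const
    simp only [mul_one] at this
    exact this.eventually_le_const one_lt_two
  have hconv := delayConverges_distributedDelay hT hac (fun k => (ha k).nonneg) haδ hη.integrable
  -- The side conditions sit inside the existentials, with dummy values when they fail, so that the
  -- thresholds can be chosen as total functions.
  have hthr : ∀ (ε : ℝ) (n : ℕ), ∃ M₀ : ℝ, ∀ M, ∃ k₀, 0 < ε → 1 ≤ n → M₀ ≤ M → ∀ k, k₀ ≤ k →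
      |realValue T ρ (extendProduction f₀) U₁ (U₂ n) (distributedDelay T (a k)) η₀ η₁ -
        realValue T ρ (extendProduction f₀) U₁ (U₂ n) (pointwiseDelay T) η₀ η₁| ≤ ε ∧
      ∀ c, IsOptimal T ρ (extendProduction f₀) U₁ (U₂ n) (distributedDelay T (a k)) η₀ η₁ c →
        ∃ y, IsAdmissiblePair T (extendProduction f₀) (pointwiseDelay T) η₀ η₁ (truncate M c) y ∧
          HasFinitePayoff ρ (U₂ n) y ∧
          realValue T ρ (extendProduction f₀) U₁ (U₂ n) (pointwiseDelay T) η₀ η₁ - ε <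
            realPayoff ρ U₁ (U₂ n) (truncate M c) y := by
    intro ε n
    by_cases h : 0 < ε ∧ 1 ≤ n
    · obtain ⟨M₀, hM₀⟩ := hconv.exists_thresholds hT (hP₀ n h.2) (hmass.mono fun k hk => hDk k 2 hk)
        (hmass.mono fun k hk => hasFadingMemory_distributedDelay hT (hac k) (ha k).nonneg hk)
        (Eventually.of_forall (hex n h.2)) (hU₂sing n h.2) hη hη₀ h.1
      refine ⟨M₀, fun M => ?_⟩
      by_cases hM : M₀ ≤ M
      · obtain ⟨k₀, hk₀⟩ := hM₀ M hM
        exact ⟨k₀, fun _ _ _ => hk₀⟩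
      · exact ⟨0, fun _ _ h' => absurd h' hM⟩
    · exact ⟨0, fun M => ⟨0, fun h1 h2 => absurd ⟨h1, h2⟩ h⟩⟩
  have hnn : ∀ ε : ℝ, ∃ n, 1 ≤ n ∧ (0 < ε →
      realValue T ρ (extendProduction f₀) U₁ (fun _ => 0) (pointwiseDelay T) η₀ η₁ - ε <
        realValue T ρ (extendProduction f₀) U₁ (U₂ n) (pointwiseDelay T) η₀ η₁) := by
    intro ε
    by_cases h : 0 < ε
    · obtain ⟨n, hn, hlt⟩ := exists_realValue_gt hP₀₀ hη hη₀ hN hU₂zero h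
      exact ⟨n, hn, fun _ => hlt⟩
    · exact ⟨1, le_rfl, fun h' => absurd h' h⟩
  choose Mbar Kbar hMK using hthr
  choose nn hnn1 hnn2 using hnn
  refine ⟨Mbar, Kbar, nn, fun ε _ => hnn1 ε, fun M k hMk => ⟨?_, fun cstar hcstar => ⟨?_, ?_⟩⟩⟩
  -- One ε for replacing the kernel by the pointwise delay and one for dropping the state utility.
  · have hbd : ∀ ε, 0 < ε →
        |realValue T ρ (extendProduction f₀) U₁ (U₂ (nn ε))
          (distributedDelay T (a (k ε (nn ε)))) η₀ η₁ -
          realValue T ρ (extendProduction f₀) U₁ (fun _ => 0) (pointwiseDelay T) η₀ η₁| ≤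
            2 * ε := by
      intro ε hε
      obtain ⟨hM, hk⟩ := hMk ε hε (nn ε) (hnn1 ε)
      have h1 := abs_le.1 (hMK ε (nn ε) (M ε (nn ε)) hε (hnn1 ε) hM _ hk).1
      have h2 := hnn2 ε hε
      have h3 := (hP₀ (nn ε) (hnn1 ε)).realValue_le_without_state hη hη₀
      exact abs_le.2 ⟨by linarith [h1.1], by linarith [h1.2]⟩
    have hlim : Tendsto (fun ε => realValue T ρ (extendProduction f₀) U₁ (U₂ (nn ε))
        (distributedDelay T (a (k ε (nn ε)))) η₀ η₁) (𝓝[>] 0)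
        (𝓝 (realValue T ρ (extendProduction f₀) U₁ (fun _ => 0) (pointwiseDelay T) η₀ η₁)) := by
      rw [tendsto_iff_dist_tendsto_zero]
      refine squeeze_zero' (Eventually.of_forall fun _ => dist_nonneg) (g := fun ε => 2 * ε) ?_
        ((by fun_prop : Continuous fun ε : ℝ => 2 * ε).tendsto_nhdsGT_zero (by simp))
      filter_upwards [self_mem_nhdsWithin] with ε hε
      exact hbd ε hε
    rw [hP₀₀.value_eq_coe hη hη₀]
    refine ((continuous_coe_real_ereal.tendsto _).comp hlim).congr fun ε => ?_
    exact ((hPk (nn ε) (hnn1 ε) _).value_eq_coe hη hη₀).symm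
  · intro ε hε n hn
    obtain ⟨hM, hk⟩ := hMk ε hε n hn
    obtain ⟨y, hy, hfin, hJ⟩ := (hMK ε n (M ε n) hε hn hM _ hk).2 _ (hcstar n hn _)
    exact (hP₀ n hn).isEpsOptimal hη hη₀ hy hfin hJ
  · intro ε hε
    obtain ⟨hM, hk⟩ := hMk ε hε (nn ε) (hnn1 ε)
    obtain ⟨y, hy, hfin, hJ⟩ := (hMK ε (nn ε) (M ε (nn ε)) hε (hnn1 ε) hM _ hk).2 _
      (hcstar (nn ε) (hnn1 ε) _)
    refine hP₀₀.isEpsOptimal hη hη₀ hy hasFinitePayoff_zero ?_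
    have h1 := (hP₀ (nn ε) (hnn1 ε)).realPayoff_le_without_state hy
    have h2 := hnn2 ε hε
    linarith
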